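/- For a real polynomial $f$ and an angle $\theta$, let $H(f,\theta)=\{(x,y)\in\mathbb R^2 : f(u)-v\ge 0\}$, where $u=\cos\theta\,x+\sin\theta\,y$ and $v=-\sin\theta\,x+\cos\theta\,y$; such a set is called a polynomial half plane. A region of type I is a simply connected (in particular nonempty and path connected) set $X=H(f_1,\theta_1)\cap\dots\cap H(f_k,\theta_k)$ with $k\ge 1$. The brick decomposition of $H(f,\theta)$ is the following decomposition into cells in the coordinates $(u,v)$. Let $S$ consist of the integers and, if $\deg f\ge 2$, also of the points at which $f''$ changes sign and the local minimum points of $f$. For consecutive $a<b$ in $S$ put on the strip $a<u<b$ the edges $v=\ell_j(u)$, $j=0,1,2,\dots$, where $\ell_0=f$ and, for $j\ge 1$, $\ell_j=\min_{[a,b]}f-j$ if $\deg f\ge 2$ and $\ell_j=f-j$ if $\deg f\le 1$; the 1-cells over $(a,b)$ are these open edges and the 2-cells are the sets $\{a<u<b,\ \ell_{j+1}(u)<v<\ell_j(u)\}$. On each vertical ray $u=c$, $v\le f(c)$, with $c\in S$, the 0-cells are the end points of the edges on the left and on the right of the ray, and the 1-cells are the open segments between consecutive 0-cells. A shortest-length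 curve from $A$ to $B$ in $X$ is a piecewise $C^2$ curve $\gamma:[a,b]\to X$ from $A$ to $B$ whose length is minimal among all piecewise $C^2$ curves from $A$ to $B$ in $X$. The number of times that $\gamma$ interacts with a cell $e$ (enters and leaves it) is the number of connected components of $\{t\in[a,b]:\gamma(t)\in e\}$. **Proposition.** Every region $X=H(f_1,\theta_1)\cap\dots\cap H(f_k,\theta_k)$ of type I has a cell decomposition (a CW structure) which refines the overlay of the brick decompositions of its polynomial half planes, that is, every open cell of $X$ lies, for each $i$, in a single cell of the brick decomposition of $H(f_i,\theta_i)$, and which has the following property: every shortest-length curve between two points of $X$ interacts with each open cell of the decomposition at most finitely many times. -/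

import Mathlib

open Set Polynomial

noncomputable section

namespace TypeIRegion

/-- The Euclidean plane. -/
abbrev Plane : Type := EuclideanSpace ℝ (Fin 2)

/-- The coordinates of a point in the frame rotated by the angle `θ`. -/
def frame (θ : ℝ) (p : Plane) : ℝ × ℝ :=
  (Real.cos θ * p 0 + Real.sin θ * p 1, -Real.sin θ * p 0 + Real.cos θ * p 1)

/-- The polynomial half plane of `f` and `θ`: the closed region on and below the graph of `f`,
where the graph is drawn in the frame rotated by `θ`. -/
def halfPlane (f : ℝ[X]) (θ : ℝ) : Set Plane :=
  {p | 0 ≤ f.eval (frame θ p).1 - (frame θ p).2}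

/-- `X` is the region of type I cut out by the polynomial half planes of `(f i, θ i)`:
it is the intersection of these finitely many (at least one) half planes, and it is
simply connected (in particular nonempty and path connected). -/
structure IsTypeIRegion {k : ℕ} (f : Fin k → ℝ[X]) (θ : Fin k → ℝ) (X : Set Plane) : Prop where
  pos : 0 < k
  eq_iInter : X = ⋂ i, halfPlane (f i) (θ i)
  simplyConnected : SimplyConnectedSpace X

/-! ### The brick decomposition of the region on and below the graph of a polynomial -/

/-- `f''` changes sign at `x`. -/
def IsStrictInflection (f : ℝ[X]) (x : ℝ) : Prop :=
  ((∀ᶠ t in nhdsWithin x (Iio x), f.derivative.derivative.eval t < 0) ∧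
    (∀ᶠ t in nhdsWithin x (Ioi x), 0 < f.derivative.derivative.eval t)) ∨
  ((∀ᶠ t in nhdsWithin x (Iio x), 0 < f.derivative.derivative.eval t) ∧
    (∀ᶠ t in nhdsWithin x (Ioi x), f.derivative.derivative.eval t < 0))

/-- The abscissae of the 0-cells on the graph: the integers and, if the degree is at least `2`,
the strict inflection points and the local minimum points. -/
def cutPoints (f : ℝ[X]) : Set ℝ :=
  {x | (∃ n : ℤ, x = n) ∨
    (2 ≤ f.natDegree ∧ (IsStrictInflection f x ∨ IsLocalMin (fun t => f.eval t) x))}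

/-- `a < b` are consecutive elements of `S`. -/
def Consecutive (S : Set ℝ) (a b : ℝ) : Prop :=
  a ∈ S ∧ b ∈ S ∧ a < b ∧ ∀ c ∈ S, c ≤ a ∨ b ≤ c

/-- The height of the `j`-th edge from the top between the consecutive cut points `a < b`: the edge
number `0` is on the graph. In degree at least `2` the others are horizontal, at the distances
`1, 2, …` below the minimum of `f` on `[a, b]`; in degree at most `1` they are the translates of
the edge on the graph by `1, 2, …` downwards. -/
def level (f : ℝ[X]) (a b : ℝ) (j : ℕ) (x : ℝ) : ℝ :=
  if j = 0 then f.eval x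
  else if f.natDegree ≤ 1 then f.eval x - j
  else sInf ((fun t => f.eval t) '' Icc a b) - j

/-- The heights of the 0-cells on the vertical ray below the graph at the cut point `c`: the ends of
the edges on its left and on its right. -/
def heights (f : ℝ[X]) (c : ℝ) : Set ℝ :=
  {y | ∃ a b, Consecutive (cutPoints f) a b ∧ (c = a ∨ c = b) ∧ ∃ j : ℕ, y = level f a b j c}

/-- The (open) cells of the brick decomposition of `{(x, y) | y ≤ f x}`. -/
inductive IsBrickCell (f : ℝ[X]) : Set (ℝ × ℝ) → Prop
  | vertex (c y : ℝ) (hc : c ∈ cutPoints f) (hy : y ∈ heights f c) : IsBrickCell f {(c, y)}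
  | wall (c y z : ℝ) (hc : c ∈ cutPoints f) (hyz : Consecutive (heights f c) y z) :
      IsBrickCell f {p | p.1 = c ∧ y < p.2 ∧ p.2 < z}
  | edge (a b : ℝ) (j : ℕ) (hab : Consecutive (cutPoints f) a b) :
      IsBrickCell f {p | a < p.1 ∧ p.1 < b ∧ p.2 = level f a b j p.1}
  | brick (a b : ℝ) (j : ℕ) (hab : Consecutive (cutPoints f) a b) :
      IsBrickCell f {p | a < p.1 ∧ p.1 < b ∧ level f a b (j + 1) p.1 < p.2 ∧
        p.2 < level f a b j p.1}

/-- A cell decomposition (CW structure) of `X` refines the overlay of the brick decompositions of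
the half planes of `(f i, θ i)`: for every `i`, each open cell lies in a single brick cell. -/
def RefinesOverlay {k : ℕ} (f : Fin k → ℝ[X]) (θ : Fin k → ℝ) (X : Set Plane)
    [Topology.CWComplex X] : Prop :=
  ∀ (n : ℕ) (e : Topology.RelCWComplex.cell X n) (i : Fin k),
    ∃ c : Set (ℝ × ℝ), IsBrickCell (f i) c ∧
      Topology.RelCWComplex.openCell n e ⊆ frame (θ i) ⁻¹' c

/-! ### Shortest-length curves -/

/-- `γ`, restricted to `[a, b]`, is a piecewise `C²` curve from `A` to `B` contained in `X`. -/
structure IsPiecewiseC2Curve (X : Set Plane) (A B : Plane) (a b : ℝ) (γ : ℝ → Plane) : Prop where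
  le : a ≤ b
  source : γ a = A
  target : γ b = B
  mapsTo : MapsTo γ (Icc a b) X
  continuousOn : ContinuousOn γ (Icc a b)
  pieces : ∃ (m : ℕ) (t : Fin (m + 1) → ℝ), Monotone t ∧ t 0 = a ∧ t (Fin.last m) = b ∧
    ∀ i : Fin m, ContDiffOn ℝ 2 γ (Icc (t i.castSucc) (t i.succ))

/-- `γ`, restricted to `[a, b]`, is a shortest-length curve from `A` to `B` in `X`: no piecewise
`C²` curve from `A` to `B` in `X` is shorter. The length is the supremum of the lengths of
inscribed polygonal lines. -/
def IsShortestCurve (X : Set Plane) (A B : Plane) (a b : ℝ) (γ : ℝ → Plane) : Prop :=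
  IsPiecewiseC2Curve X A B a b γ ∧
    ∀ (a' b' : ℝ) (δ : ℝ → Plane), IsPiecewiseC2Curve X A B a' b' δ →
      eVariationOn γ (Icc a b) ≤ eVariationOn δ (Icc a' b')

/-- The curve `γ` on `[a, b]` interacts with the cell `e` at most finitely many times. One
interaction (entering and leaving once) is a maximal interval of times that `γ` spends in `e`,
that is, a connected component of `{t ∈ [a, b] | γ t ∈ e}`. -/
def InteractsFinitely (a b : ℝ) (γ : ℝ → Plane) (e : Set Plane) : Prop :=
  Finite (ConnectedComponents ↥(Icc a b ∩ γ ⁻¹' e))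

end TypeIRegion

end

/-! Call a set of times tame if it is a finite union of intervals (`Tame`). Tame sets form a Boolean
algebra and have finitely many components. The cells are generated by a locally finite family of
arcs, each a compact piece of a polynomial graph in a rotated frame. It is therefore enough that a
shortest curve meets every vertex and every arc in a tame set of times.

Shape of a shortest curve. Between two visits of a point it stays at this point, so fibres are
intervals. Off the boundary graphs it runs along lines (`wbtw_of_isOpen`). Each boundary graph is
cut at the zeros of `f''` and of the other defining functions, as far as these do not vanish
identically on it. On a piece where `f` is convex, the set above the graph is convex, and nearest
point projection onto it strictly shortens every excursion from the graph; the time spent there is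
an interval (`ordConnected_convexArc`). On a strictly concave piece a short chord would be an
admissible shortcut, so only the ends of the curve can lie there (`eq_end_of_strictConcave`). The
exception is a second half plane on the other side of the same graph, and for that one the piece is
convex. Altogether `[a, b]` splits into finitely many tame pieces on which the curve follows a
polynomially parametrized curve. Along such a curve a polynomial equation holds identically or at
finitely many points, which gives `tame_zero` and `tame_arc`.

Cells. The arcs of all brick decompositions are cut into slanted and upright pieces. The horizontal
sides of unit squares are added, and then vertical segments through all vertices and upright pieces.
What remains consists of bands between two graphs, which are open 2-cells
(`LocFin.exists_decomposition`); local finiteness gives the weak topology (`exists_cwComplex`). A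
cell is connected and not cut by the arcs, so it lies in the region or outside it, and in one brick
cell for each half plane (`exists_isBrickCell`). An open `n`-cell is open and closed in `skel (n +
1) \ skel n`, so its times are a union of components of a tame set (`tame_cell`). -/

noncomputable section

namespace TypeIRegion

/-! ### Finite unions of intervals -/

/-- A set of reals which is a finite union of intervals. -/
def Tame (T : Set ℝ) : Prop :=
  ∃ F : Set (Set ℝ), F.Finite ∧ (∀ I ∈ F, I.OrdConnected) ∧ ⋃₀ F = T

theorem tame_of_ordConnected {I : Set ℝ} (h : I.OrdConnected) : Tame I :=
  ⟨{I}, finite_singleton I, by simpa using h, by simp⟩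

theorem tame_empty : Tame ∅ := tame_of_ordConnected ordConnected_empty

theorem Tame.union {S T : Set ℝ} (hS : Tame S) (hT : Tame T) : Tame (S ∪ T) := by
  obtain ⟨F, hF, hF', rfl⟩ := hS
  obtain ⟨G, hG, hG', rfl⟩ := hT
  refine ⟨F ∪ G, hF.union hG, ?_, sUnion_union F G⟩
  rintro I (h | h)
  exacts [hF' I h, hG' I h]

theorem Tame.inter {S T : Set ℝ} (hS : Tame S) (hT : Tame T) : Tame (S ∩ T) := by
  obtain ⟨F, hF, hF', rfl⟩ := hS
  obtain ⟨G, hG, hG', rfl⟩ := hT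
  refine ⟨image2 (· ∩ ·) F G, hF.image2 _ hG, ?_, ?_⟩
  · rintro _ ⟨I, hI, J, hJ, rfl⟩
    exact (hF' I hI).inter (hG' J hJ)
  · ext x
    simp only [mem_sUnion, mem_image2, mem_inter_iff]
    constructor
    · rintro ⟨_, ⟨I, hI, J, hJ, rfl⟩, hx⟩
      exact ⟨⟨I, hI, hx.1⟩, ⟨J, hJ, hx.2⟩⟩
    · rintro ⟨⟨I, hI, hx⟩, ⟨J, hJ, hx'⟩⟩
      exact ⟨_, ⟨I, hI, J, hJ, rfl⟩, hx, hx'⟩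

theorem Tame.biUnion {ι : Type*} {s : Set ι} (hs : s.Finite) {T : ι → Set ℝ}
    (h : ∀ i ∈ s, Tame (T i)) : Tame (⋃ i ∈ s, T i) := by
  induction s, hs using Set.Finite.induction_on with
  | empty => simpa using tame_empty
  | @insert i s _ _ ih =>
    rw [biUnion_insert]
    exact (h i (mem_insert i s)).union (ih fun j hj => h j (mem_insert_of_mem i hj))

theorem Tame.iUnion {ι : Type*} [Finite ι] {T : ι → Set ℝ} (h : ∀ i, Tame (T i)) :
    Tame (⋃ i, T i) := by
  simpa using Tame.biUnion (finite_univ (α := ι)) (T := T) fun i _ => h i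

/-- By de Morgan it suffices to treat one interval, whose complement consists of a part to its left
and a part to its right. -/
theorem Tame.compl {T : Set ℝ} (hT : Tame T) : Tame Tᶜ := by
  obtain ⟨F, hF, hF', rfl⟩ := hT
  induction F, hF using Set.Finite.induction_on with
  | empty => simpa using tame_of_ordConnected ordConnected_univ
  | @insert I F _ _ ih =>
    rw [sUnion_insert, compl_union]
    refine Tame.inter ?_ (ih fun J hJ => hF' J (mem_insert_of_mem I hJ))
    have hI := hF' I (mem_insert I F)
    have : Iᶜ = {x | x ∉ I ∧ ∃ y ∈ I, x < y} ∪ {x | ∀ y ∈ I, y < x} := by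
      ext x
      simp only [mem_compl_iff, mem_union, mem_ofPred_eq]
      constructor
      · intro hx
        by_cases h : ∃ y ∈ I, x < y
        · exact Or.inl ⟨hx, h⟩
        · push Not at h
          exact Or.inr fun y hy => lt_of_le_of_ne (h y hy) fun e => hx (e ▸ hy)
      · rintro (h | h) hx
        exacts [h.1 hx, lt_irrefl _ (h x hx)]
    rw [this]
    refine Tame.union (tame_of_ordConnected ⟨?_⟩) (tame_of_ordConnected ⟨?_⟩)
    · rintro x ⟨hx, -⟩ y ⟨hy, z, hz, hyz⟩ w hw
      refine ⟨fun hwI => hy (hI.out hwI hz ⟨hw.2, hyz.le⟩), z, hz, hw.2.trans_lt hyz⟩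
    · intro x hx y hy w hw z hz
      exact (hx z hz).trans_le hw.1

theorem Tame.diff {S T : Set ℝ} (hS : Tame S) (hT : Tame T) : Tame (S \ T) :=
  hS.inter hT.compl

theorem tame_of_finite {T : Set ℝ} (h : T.Finite) : Tame T := by
  have := Tame.biUnion h (T := fun x => {x}) fun x _ => tame_of_ordConnected ordConnected_singleton
  simpa using this

/-- A union of connected components of a finite union of intervals is again such a union. -/
theorem Tame.of_components {S T : Set ℝ} (hT : Tame T) (hST : S ⊆ T)
    (h : ∀ I : Set ℝ, I.OrdConnected → I ⊆ T → (I ∩ S).Nonempty → I ⊆ S) : Tame S := by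
  obtain ⟨F, hF, hF', rfl⟩ := hT
  refine ⟨{I ∈ F | (I ∩ S).Nonempty}, hF.subset (sep_subset _ _), fun I hI => hF' I hI.1, ?_⟩
  apply Subset.antisymm
  · exact sUnion_subset fun I hI => h I (hF' I hI.1) (subset_sUnion_of_mem hI.1) hI.2
  · intro x hx
    obtain ⟨I, hI, hxI⟩ := hST hx
    exact ⟨I, ⟨hI, x, hxI, hx⟩, hxI⟩

/-- A representative of each component lies in one of the finitely many intervals, and a connected
interval determines the component. -/
theorem Tame.finite_connectedComponents {T : Set ℝ} (hT : Tame T) :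
    Finite (ConnectedComponents ↥T) := by
  obtain ⟨F, hF, hF', rfl⟩ := hT
  have := hF.to_subtype
  have key : ∀ x : ↥(⋃₀ F), ∃ I : F, (x : ℝ) ∈ (I : Set ℝ) := fun x => by
    obtain ⟨I, hI, hx⟩ := x.2
    exact ⟨⟨I, hI⟩, hx⟩
  choose i hi using key
  refine Finite.of_injective (β := F)
    (fun c => i (Quotient.out (s := connectedComponentSetoid _) c)) ?_
  intro c d hcd
  rw [← Quotient.out_eq (s := connectedComponentSetoid _) c,
    ← Quotient.out_eq (s := connectedComponentSetoid _) d]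
  set x := Quotient.out (s := connectedComponentSetoid _) c
  set y := Quotient.out (s := connectedComponentSetoid _) d
  have hxy : i x = i y := hcd
  change ConnectedComponents.mk x = ConnectedComponents.mk y
  rw [ConnectedComponents.coe_eq_coe']
  have hc : IsPreconnected ((↑) ⁻¹' (i y : Set ℝ) : Set ↥(⋃₀ F)) := by
    rw [Topology.IsInducing.subtypeVal.isPreconnected_image.symm, Subtype.image_preimage_coe,
      inter_eq_right.2 (subset_sUnion_of_mem (i y).2)]
    exact (hF' _ (i y).2).isPreconnected
  exact hc.subset_connectedComponent (hi y) (hxy ▸ hi x)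


/-! ### Polynomial functions of a real variable -/

/-- A real function which is given by a polynomial. -/
def IsPoly (h : ℝ → ℝ) : Prop := ∃ P : ℝ[X], ∀ u, P.eval u = h u

namespace IsPoly

theorem const (c : ℝ) : IsPoly fun _ => c := ⟨C c, by simp⟩

theorem id : IsPoly fun u => u := ⟨X, by simp⟩

variable {g h : ℝ → ℝ}

theorem add (hg : IsPoly g) (hh : IsPoly h) : IsPoly fun u => g u + h u := by
  obtain ⟨P, hP⟩ := hg
  obtain ⟨Q, hQ⟩ := hh
  exact ⟨P + Q, by simp [hP, hQ]⟩

theorem sub (hg : IsPoly g) (hh : IsPoly h) : IsPoly fun u => g u - h u := by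
  obtain ⟨P, hP⟩ := hg
  obtain ⟨Q, hQ⟩ := hh
  exact ⟨P - Q, by simp [hP, hQ]⟩

theorem mul (hg : IsPoly g) (hh : IsPoly h) : IsPoly fun u => g u * h u := by
  obtain ⟨P, hP⟩ := hg
  obtain ⟨Q, hQ⟩ := hh
  exact ⟨P * Q, by simp [hP, hQ]⟩

theorem eval (f : ℝ[X]) (hg : IsPoly g) : IsPoly fun u => f.eval (g u) := by
  obtain ⟨P, hP⟩ := hg
  exact ⟨f.comp P, by simp [hP]⟩

theorem continuous (hg : IsPoly g) : Continuous g := by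
  obtain ⟨P, hP⟩ := hg
  rw [show g = fun u => P.eval u from funext fun u => (hP u).symm]
  exact P.continuous

theorem contDiff (hg : IsPoly g) {n : WithTop ℕ∞} : ContDiff ℝ n g := by
  obtain ⟨P, hP⟩ := hg
  rw [show g = fun u => aeval u P from funext fun u => by simp [hP]]
  exact P.contDiff_aeval n

/-- The source of finiteness for intersections of arcs and for contacts of curves with arcs. -/
theorem zero_or_finite (hg : IsPoly g) : (∀ u, g u = 0) ∨ {u | g u = 0}.Finite := by
  obtain ⟨P, hP⟩ := hg
  by_cases h : P = 0
  · exact Or.inl fun u => by rw [← hP, h, eval_zero]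
  · exact Or.inr <| (P.roots.toFinset.finite_toSet).subset fun u hu => by
      simpa [h, hP] using hu

theorem finite_frontier_zero (hg : IsPoly g) : (frontier {u | g u = 0}).Finite := by
  rcases hg.zero_or_finite with h | h
  · simp [h]
  · exact h.subset (isClosed_eq hg.continuous continuous_const).frontier_subset

theorem finite_frontier_nonneg (hg : IsPoly g) : (frontier {u | 0 ≤ g u}).Finite := by
  rcases hg.zero_or_finite with h | h
  · simp [h]
  · refine h.subset ((frontier_le_subset_eq continuous_const hg.continuous).trans ?_)
    exact fun u hu => Eq.symm hu

end IsPoly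

theorem finite_frontier_inter {S T : Set ℝ} (hS : (frontier S).Finite) (hT : (frontier T).Finite) :
    (frontier (S ∩ T)).Finite :=
  (hS.union hT).subset <| (frontier_inter_subset S T).trans <|
    union_subset_union inter_subset_left inter_subset_right

/-! ### Rotated coordinates -/

/-- The point with given coordinates in the frame rotated by the angle `θ`. -/
def unframe (θ : ℝ) (q : ℝ × ℝ) : Plane :=
  !₂[Real.cos θ * q.1 - Real.sin θ * q.2, Real.sin θ * q.1 + Real.cos θ * q.2]

@[simp] theorem unframe_zero_coord (θ : ℝ) (q : ℝ × ℝ) :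
    unframe θ q 0 = Real.cos θ * q.1 - Real.sin θ * q.2 := by simp [unframe]

@[simp] theorem unframe_one_coord (θ : ℝ) (q : ℝ × ℝ) :
    unframe θ q 1 = Real.sin θ * q.1 + Real.cos θ * q.2 := by simp [unframe]

@[simp] theorem frame_unframe (θ : ℝ) (q : ℝ × ℝ) : frame θ (unframe θ q) = q := by
  have h := Real.sin_sq_add_cos_sq θ
  ext
  · simp only [frame, unframe_zero_coord, unframe_one_coord]
    linear_combination q.1 * h
  · simp only [frame, unframe_zero_coord, unframe_one_coord]
    linear_combination q.2 * h

theorem plane_ext {p q : Plane} (h0 : p 0 = q 0) (h1 : p 1 = q 1) : p = q := by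
  ext i
  fin_cases i
  exacts [h0, h1]

@[simp] theorem unframe_frame (θ : ℝ) (p : Plane) : unframe θ (frame θ p) = p := by
  have h := Real.sin_sq_add_cos_sq θ
  apply plane_ext
  · simp only [frame, unframe_zero_coord]
    linear_combination p 0 * h
  · simp only [frame, unframe_one_coord]
    linear_combination p 1 * h

theorem frame_injective (θ : ℝ) : Function.Injective (frame θ) :=
  Function.LeftInverse.injective (unframe_frame θ)

theorem continuous_frame (θ : ℝ) : Continuous (frame θ) := by
  unfold frame
  fun_prop

theorem continuous_unframe (θ : ℝ) : Continuous (unframe θ) := by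
  refine (PiLp.continuous_toLp 2 _).comp (continuous_pi fun i => ?_)
  fin_cases i <;> simp <;> fun_prop

theorem frame_combo (θ a b : ℝ) (p q : Plane) :
    frame θ (a • p + b • q) = (a * (frame θ p).1 + b * (frame θ q).1,
      a * (frame θ p).2 + b * (frame θ q).2) := by
  ext <;> simp [frame] <;> ring

theorem dist_sq_eq (θ : ℝ) (p q : Plane) :
    dist p q ^ 2 = ((frame θ p).1 - (frame θ q).1) ^ 2 + ((frame θ p).2 - (frame θ q).2) ^ 2 := by
  rw [EuclideanSpace.dist_eq, Real.sq_sqrt (by positivity)]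
  have h := Real.sin_sq_add_cos_sq θ
  simp only [Fin.sum_univ_two, Real.dist_eq, sq_abs, frame]
  linear_combination (-(p 0 - q 0) ^ 2 - (p 1 - q 1) ^ 2) * h

theorem abs_frame_fst_le (θ : ℝ) (p : Plane) : |(frame θ p).1| ≤ ‖p‖ := by
  have h := dist_sq_eq θ p 0
  rw [dist_zero_right] at h
  simp only [frame, PiLp.zero_apply, mul_zero, add_zero, sub_zero] at h ⊢
  exact abs_le_of_sq_le_sq (by nlinarith [sq_nonneg (-Real.sin θ * p 0 + Real.cos θ * p 1)])
    (norm_nonneg p)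

theorem abs_frame_snd_le (θ : ℝ) (p : Plane) : |(frame θ p).2| ≤ ‖p‖ := by
  have h := dist_sq_eq θ p 0
  rw [dist_zero_right] at h
  simp only [frame, PiLp.zero_apply, mul_zero, add_zero, sub_zero] at h ⊢
  exact abs_le_of_sq_le_sq (by nlinarith [sq_nonneg (Real.cos θ * p 0 + Real.sin θ * p 1)])
    (norm_nonneg p)

theorem frame_zero (p : Plane) : frame 0 p = (p 0, p 1) := by simp [frame]

/-- A quarter turn makes a vertical line the graph of a constant, so that walls are arcs and bounds
on an abscissa are sign conditions on `side`. -/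
theorem frame_add_pi_div_two (θ : ℝ) (p : Plane) :
    frame (θ + Real.pi / 2) p = ((frame θ p).2, -(frame θ p).1) := by
  simp only [frame, Real.cos_add_pi_div_two, Real.sin_add_pi_div_two]
  ext <;> simp
  ring

/-! ### Graphs of polynomials in rotated coordinates -/

/-- The function which is nonnegative on the half plane of `f` and `θ`. -/
def side (f : ℝ[X]) (θ : ℝ) (p : Plane) : ℝ := f.eval (frame θ p).1 - (frame θ p).2

theorem mem_halfPlane {f : ℝ[X]} {θ : ℝ} {p : Plane} : p ∈ halfPlane f θ ↔ 0 ≤ side f θ p :=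
  Iff.rfl

theorem continuous_side (f : ℝ[X]) (θ : ℝ) : Continuous (side f θ) :=
  (f.continuous.comp (continuous_frame θ).fst).sub (continuous_frame θ).snd

/-- The point of the graph of `f`, in the frame rotated by `θ`, with abscissa `u`. -/
def graphPt (f : ℝ[X]) (θ u : ℝ) : Plane := unframe θ (u, f.eval u)

@[simp] theorem frame_graphPt (f : ℝ[X]) (θ u : ℝ) : frame θ (graphPt f θ u) = (u, f.eval u) :=
  frame_unframe θ _

@[simp] theorem side_graphPt (f : ℝ[X]) (θ u : ℝ) : side f θ (graphPt f θ u) = 0 := by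
  simp [side]

theorem continuous_graphPt (f : ℝ[X]) (θ : ℝ) : Continuous (graphPt f θ) :=
  (continuous_unframe θ).comp (continuous_id.prodMk f.continuous)

theorem graphPt_injective (f : ℝ[X]) (θ : ℝ) : Function.Injective (graphPt f θ) := fun u v h => by
  simpa using congrArg (fun p => (frame θ p).1) h

theorem side_eq_zero_iff {f : ℝ[X]} {θ : ℝ} {p : Plane} :
    side f θ p = 0 ↔ graphPt f θ (frame θ p).1 = p := by
  constructor
  · intro h
    apply frame_injective θ
    rw [frame_graphPt]
    ext
    · rfl
    · exact sub_eq_zero.1 h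
  · intro h
    rw [← h, side_graphPt]

theorem isPoly_frame_fst_of_coords {c : ℝ → Plane} (h0 : IsPoly fun u => c u 0)
    (h1 : IsPoly fun u => c u 1) (θ : ℝ) :
    (IsPoly fun u => (frame θ (c u)).1) ∧ IsPoly fun u => (frame θ (c u)).2 :=
  ⟨((IsPoly.const _).mul h0).add ((IsPoly.const _).mul h1),
    ((IsPoly.const _).mul h0).add ((IsPoly.const _).mul h1)⟩

theorem isPoly_side {c : ℝ → Plane} (h0 : IsPoly fun u => c u 0)
    (h1 : IsPoly fun u => c u 1) (f : ℝ[X]) (θ : ℝ) : IsPoly fun u => side f θ (c u) :=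
  ((isPoly_frame_fst_of_coords h0 h1 θ).1.eval f).sub (isPoly_frame_fst_of_coords h0 h1 θ).2

theorem isPoly_graphPt_zero (f : ℝ[X]) (θ : ℝ) : IsPoly fun u => graphPt f θ u 0 := by
  simp only [graphPt, unframe_zero_coord]
  exact ((IsPoly.const _).mul IsPoly.id).sub ((IsPoly.const _).mul (IsPoly.id.eval f))

theorem isPoly_graphPt_one (f : ℝ[X]) (θ : ℝ) : IsPoly fun u => graphPt f θ u 1 := by
  simp only [graphPt, unframe_one_coord]
  exact ((IsPoly.const _).mul IsPoly.id).add ((IsPoly.const _).mul (IsPoly.id.eval f))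

theorem isPoly_side_graphPt (f g : ℝ[X]) (θ φ : ℝ) : IsPoly fun u => side g φ (graphPt f θ u) :=
  isPoly_side (isPoly_graphPt_zero f θ) (isPoly_graphPt_one f θ) g φ

theorem isPoly_side_lineMap (g : ℝ[X]) (φ : ℝ) (p q : Plane) :
    IsPoly fun s => side g φ (AffineMap.lineMap p q s) := by
  refine isPoly_side ?_ ?_ g φ
  all_goals
    simp only [AffineMap.lineMap_apply_module, PiLp.add_apply, PiLp.smul_apply, smul_eq_mul]
    exact (((IsPoly.const 1).sub IsPoly.id).mul (IsPoly.const _)).add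
      (IsPoly.id.mul (IsPoly.const _))

/-! ### Arcs -/

/-- A compact arc on the graph of a polynomial in a rotated frame. -/
structure Arc where
  poly : ℝ[X]
  ang : ℝ
  lo : ℝ
  hi : ℝ

namespace Arc

variable (A B : Arc)

/-- The parametrization of an arc by the abscissa in its frame. -/
def pt (u : ℝ) : Plane := graphPt A.poly A.ang u

/-- The set of points of an arc. -/
def carrier : Set Plane := A.pt '' Icc A.lo A.hi

theorem continuous_pt : Continuous A.pt := continuous_graphPt _ _

theorem pt_injective : Function.Injective A.pt := graphPt_injective _ _

theorem frame_pt (u : ℝ) : (frame A.ang (A.pt u)).1 = u := by simp [pt]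

theorem isCompact_carrier : IsCompact A.carrier := isCompact_Icc.image A.continuous_pt

theorem isClosed_carrier : IsClosed A.carrier := A.isCompact_carrier.isClosed

variable {A B} in
theorem mem_carrier {p : Plane} : p ∈ A.carrier ↔
    A.lo ≤ (frame A.ang p).1 ∧ (frame A.ang p).1 ≤ A.hi ∧ side A.poly A.ang p = 0 := by
  constructor
  · rintro ⟨u, hu, rfl⟩
    simpa [pt] using hu
  · rintro ⟨h1, h2, h3⟩
    exact ⟨_, ⟨h1, h2⟩, side_eq_zero_iff.1 h3⟩

/-- The parameters of the points of `A` which lie on `B`. -/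
def onArc : Set ℝ := {u | u ∈ Icc A.lo A.hi ∧ A.pt u ∈ B.carrier}

/-- Along `A`, lying on `B` is a conjunction of polynomial sign conditions on the parameter. Each
has a finite frontier, even when the two arcs overlap. -/
theorem finite_frontier_onArc : (frontier (A.onArc B)).Finite := by
  have hx := isPoly_graphPt_zero A.poly A.ang
  have hy := isPoly_graphPt_one A.poly A.ang
  have hu := (isPoly_frame_fst_of_coords hx hy B.ang).1
  have h : A.onArc B = ({u | 0 ≤ u - A.lo} ∩ {u | 0 ≤ A.hi - u}) ∩
      (({u | 0 ≤ (frame B.ang (A.pt u)).1 - B.lo} ∩ {u | 0 ≤ B.hi - (frame B.ang (A.pt u)).1}) ∩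
        {u | side B.poly B.ang (A.pt u) = 0}) := by
    ext u
    simp only [onArc, mem_carrier, mem_inter_iff, mem_Icc, mem_ofPred_eq, sub_nonneg, and_assoc]
  rw [h]
  refine finite_frontier_inter (finite_frontier_inter ?_ ?_)
    (finite_frontier_inter (finite_frontier_inter ?_ ?_) ?_)
  · exact (IsPoly.id.sub (IsPoly.const _)).finite_frontier_nonneg
  · exact ((IsPoly.const _).sub IsPoly.id).finite_frontier_nonneg
  · exact (hu.sub (IsPoly.const _)).finite_frontier_nonneg
  · exact ((IsPoly.const _).sub hu).finite_frontier_nonneg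
  · exact (isPoly_side_graphPt _ _ _ _).finite_frontier_zero

end Arc


/-! ### Piecewise `C²` curves and their lengths -/

theorem eVariationOn_Icc_add_Icc {E : Type*} [PseudoEMetricSpace E] (g : ℝ → E) {a b c : ℝ}
    (hab : a ≤ b) (hbc : b ≤ c) :
    eVariationOn g (Icc a b) + eVariationOn g (Icc b c) = eVariationOn g (Icc a c) := by
  simpa using eVariationOn.Icc_add_Icc g (s := univ) hab hbc (mem_univ b)

/-- A function `M` whose increments dominate the distances is monotone, and its variation
telescopes. -/
theorem eVariationOn_le_of_dist_le {E : Type*} [PseudoMetricSpace E] {g : ℝ → E} {M : ℝ → ℝ}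
    {a b : ℝ} (hab : a ≤ b)
    (h : ∀ s ∈ Icc a b, ∀ t ∈ Icc a b, s ≤ t → dist (g s) (g t) ≤ M t - M s) :
    eVariationOn g (Icc a b) ≤ ENNReal.ofReal (M b - M a) := by
  have hM : MonotoneOn M (Icc a b) := fun s hs t ht hst =>
    sub_nonneg.1 (dist_nonneg.trans (h s hs t ht hst))
  have := hM.eVariationOn_eq (left_mem_Icc.2 hab) (right_mem_Icc.2 hab)
  rw [inter_self] at this
  rw [← this]
  refine iSup_le fun p => le_trans (Finset.sum_le_sum fun i _ => ?_)
    (eVariationOn.sum_le (f := M) (n := p.1) p.2.2.1 p.2.2.2)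
  have hi := h _ (p.2.2.2 i) _ (p.2.2.2 (i + 1)) (p.2.2.1 i.le_succ)
  rw [edist_dist, edist_dist, Real.dist_eq, dist_comm]
  exact ENNReal.ofReal_le_ofReal (hi.trans (le_abs_self _))

theorem eVariationOn_lineMap_le {E : Type*} [NormedAddCommGroup E] [NormedSpace ℝ E] (p q : E)
    {s t : ℝ} (hst : s < t) :
    eVariationOn (fun r => AffineMap.lineMap p q ((r - s) / (t - s)) : ℝ → E) (Icc s t) ≤
      edist p q := by
  have ht : 0 < t - s := sub_pos.2 hst
  refine (eVariationOn_le_of_dist_le (M := fun r => (r - s) / (t - s) * dist p q) hst.le ?_).trans ?_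
  · intro x _ y _ hxy
    rw [dist_lineMap_lineMap, dist_comm, Real.dist_eq, abs_of_nonneg, sub_mul]
    rw [← sub_div]
    exact div_nonneg (by linarith) ht.le
  · rw [edist_dist]
    apply ENNReal.ofReal_le_ofReal
    rw [div_self ht.ne']
    simp

/-- `γ` is `C²` on each interval of some partition of `[a, b]`. -/
def HasC2Pieces (γ : ℝ → Plane) (a b : ℝ) : Prop :=
  ∃ (m : ℕ) (s : ℕ → ℝ), Monotone s ∧ s 0 = a ∧ s m = b ∧
    ∀ i < m, ContDiffOn ℝ 2 γ (Icc (s i) (s (i + 1)))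

namespace HasC2Pieces

variable {γ δ : ℝ → Plane} {a b c : ℝ}

theorem iff_exists_fin : HasC2Pieces γ a b ↔
    ∃ (m : ℕ) (t : Fin (m + 1) → ℝ), Monotone t ∧ t 0 = a ∧ t (Fin.last m) = b ∧
      ∀ i : Fin m, ContDiffOn ℝ 2 γ (Icc (t i.castSucc) (t i.succ)) := by
  constructor
  · rintro ⟨m, s, hs, h0, hm, h⟩
    exact ⟨m, fun i => s i, fun i j hij => hs hij, h0, hm, fun i => h i i.2⟩
  · rintro ⟨m, t, ht, h0, hm, h⟩
    refine ⟨m, fun n => t ⟨min n m, by omega⟩, fun i j hij => ht ?_, ?_, ?_, ?_⟩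
    · exact Fin.mk_le_mk.2 (min_le_min_right m hij)
    · rw [← h0]
      exact congrArg t (Fin.ext (by simp))
    · rw [← hm]
      exact congrArg t (Fin.ext (by simp))
    · intro i hi
      have e1 : (⟨min i m, by omega⟩ : Fin (m + 1)) = Fin.castSucc ⟨i, hi⟩ :=
        Fin.ext (by simp [hi.le])
      have e2 : (⟨min (i + 1) m, by omega⟩ : Fin (m + 1)) = Fin.succ ⟨i, hi⟩ :=
        Fin.ext (by simp only [Fin.val_succ]; omega)
      beta_reduce
      rw [e1, e2]
      exact h ⟨i, hi⟩

theorem of_contDiffOn (hab : a ≤ b) (h : ContDiffOn ℝ 2 γ (Icc a b)) : HasC2Pieces γ a b := by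
  refine ⟨1, fun n => if n = 0 then a else b, ?_, by simp, by simp, by simpa using h⟩
  intro i j hij
  by_cases hi : i = 0 <;> by_cases hj : j = 0 <;> simp [hi, hj, hab]
  omega

theorem trans (h₁ : HasC2Pieces γ a b) (h₂ : HasC2Pieces γ b c) : HasC2Pieces γ a c := by
  obtain ⟨m, s, hs, h0, hm, h⟩ := h₁
  obtain ⟨n, t, ht, h0', hn, h'⟩ := h₂
  refine ⟨m + n, fun i => if i ≤ m then s i else t (i - m), ?_, by simpa using h0, ?_, ?_⟩
  · refine monotone_nat_of_le_succ fun i => ?_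
    by_cases hi : i + 1 ≤ m
    · simp only [hi, (Nat.le_succ i).trans hi, if_true]
      exact hs i.le_succ
    · by_cases hi' : i ≤ m
      · have : i = m := by omega
        subst this
        simp only [le_refl, if_true, hi, if_false, hm, ← h0']
        exact ht (Nat.zero_le _)
      · simp only [hi, hi', if_false]
        exact ht (by omega)
  · by_cases hn0 : n = 0
    · subst hn0
      simp [hm, ← hn, h0']
    · simp [hn0, hn]
  · intro i hi
    by_cases hi1 : i + 1 ≤ m
    · simp only [hi1, (Nat.le_succ i).trans hi1, if_true]
      exact h i (by omega)
    · by_cases hi' : i ≤ m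
      · have : i = m := by omega
        subst this
        simp only [le_refl, if_true, hi1, if_false, hm, ← h0']
        simpa using h' 0 (by omega)
      · simp only [hi1, hi', if_false]
        have := h' (i - m) (by omega)
        rwa [show i - m + 1 = i + 1 - m by omega] at this

theorem congr (h : HasC2Pieces γ a b) (hγδ : EqOn δ γ (Icc a b)) : HasC2Pieces δ a b := by
  obtain ⟨m, s, hs, h0, hm, h⟩ := h
  refine ⟨m, s, hs, h0, hm, fun i hi => (h i hi).congr fun x hx => hγδ ?_⟩
  exact ⟨h0 ▸ (hs (Nat.zero_le i)).trans hx.1, hm ▸ hx.2.trans (hs hi)⟩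

/-- The partition is clamped to `[s, t]`: a clamped interval is contained in the original one or
degenerates to a point. -/
theorem restrict (h : HasC2Pieces γ a b) {s t : ℝ} (hs : a ≤ s) (hst : s ≤ t) (ht : t ≤ b) :
    HasC2Pieces γ s t := by
  obtain ⟨m, r, hr, h0, hm, h⟩ := h
  refine ⟨m, fun n => max s (min t (r n)), ?_, ?_, ?_, ?_⟩
  · exact fun i j hij => max_le_max_left _ (min_le_min_left _ (hr hij))
  · simp only [h0]
    rw [min_eq_right (hs.trans hst), max_eq_left hs]
  · simp only [hm]
    rw [min_eq_left ht, max_eq_right hst]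
  · intro i hi
    have hri := hr (Nat.le_succ i)
    rcases (max_le_max_left s (min_le_min_left t hri)).lt_or_eq with hlt | heq
    · refine (h i hi).mono (Icc_subset_Icc ?_ ?_)
      · by_contra! hc
        have h1 : t < r i := by
          by_contra! h2
          rw [min_eq_right h2] at hc
          exact absurd (le_max_right s (r i)) hc.not_ge
        rw [min_eq_left h1.le, min_eq_left (h1.le.trans hri)] at hlt
        exact lt_irrefl _ hlt
      · by_contra! hc
        have h1 : r (i + 1) < s := by
          by_contra! h2
          exact absurd (max_le h2 (min_le_right t _)) hc.not_ge
        rw [max_eq_left ((min_le_right _ _).trans h1.le),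
          max_eq_left ((min_le_right _ _).trans (hri.trans h1.le))] at hlt
        exact lt_irrefl _ hlt
    · beta_reduce
      rw [heq, Icc_self]
      intro x hx
      rw [mem_singleton_iff.1 hx]
      exact contDiffWithinAt_singleton

/-- Each piece is Lipschitz, since its derivative is bounded on a compact interval. Finiteness
allows the lengths of common parts of two curves to be cancelled. -/
theorem eVariationOn_ne_top (h : HasC2Pieces γ a b) : eVariationOn γ (Icc a b) ≠ ⊤ := by
  obtain ⟨m, s, hs, rfl, rfl, h⟩ := h
  have key : ∀ k ≤ m, eVariationOn γ (Icc (s 0) (s k)) ≠ ⊤ := by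
    intro k
    induction k with
    | zero => simp
    | succ k ih =>
      intro hk
      rw [← eVariationOn_Icc_add_Icc γ (hs (Nat.zero_le k)) (hs k.le_succ)]
      refine ENNReal.add_ne_top.2 ⟨ih (by omega), ?_⟩
      rcases (hs k.le_succ).eq_or_lt with he | hlt
      · rw [he]
        simp
      · have hc := h k (by omega)
        have hd := hc.continuousOn_derivWithin (uniqueDiffOn_Icc hlt) (by norm_num)
        obtain ⟨K, hK⟩ := isCompact_Icc.exists_bound_of_continuousOn hd
        have hL : LipschitzOnWith (Real.toNNReal K) γ (Icc (s k) (s (k + 1))) := by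
          refine Convex.lipschitzOnWith_of_nnnorm_derivWithin_le (𝕜 := ℝ) (convex_Icc _ _)
            (hc.differentiableOn (by norm_num)) fun x hx => ?_
          rw [← NNReal.coe_le_coe, coe_nnnorm]
          exact (hK x hx).trans (Real.le_coe_toNNReal K)
        have := hL.comp_eVariationOn_le (g := id) (mapsTo_id (Icc (s k) (s (k + 1))))
        refine ne_top_of_le_ne_top ?_ this
        have hid := (monotone_id (α := ℝ)).monotoneOn (Icc (s k) (s (k + 1)))
        have he := hid.eVariationOn_eq (left_mem_Icc.2 hlt.le) (right_mem_Icc.2 hlt.le)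
        rw [inter_self] at he
        rw [he]
        exact ENNReal.mul_ne_top ENNReal.coe_ne_top ENNReal.ofReal_ne_top
  exact key m le_rfl

end HasC2Pieces

/-! ### Replacing a part of a shortest curve -/

namespace IsShortestCurve

variable {X : Set Plane} {A B : Plane} {a b : ℝ} {γ : ℝ → Plane}

theorem hasC2Pieces (h : IsShortestCurve X A B a b γ) : HasC2Pieces γ a b :=
  HasC2Pieces.iff_exists_fin.2 h.1.pieces

theorem eVariationOn_ne_top (h : IsShortestCurve X A B a b γ) {s t : ℝ} (hs : a ≤ s)
    (ht : t ≤ b) : eVariationOn γ (Icc s t) ≠ ⊤ :=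
  ne_top_of_le_ne_top h.hasC2Pieces.eVariationOn_ne_top
    (eVariationOn.mono γ (Icc_subset_Icc hs ht))

/-- Replacing a part of a shortest curve does not shorten this part. -/
theorem eVariationOn_le (h : IsShortestCurve X A B a b γ) {s t : ℝ} (hs : a ≤ s) (hst : s < t)
    (ht : t ≤ b) {η : ℝ → Plane} (hη : ContDiffOn ℝ 2 η (Icc s t)) (hηs : η s = γ s)
    (hηt : η t = γ t) (hX : MapsTo η (Icc s t) X) :
    eVariationOn γ (Icc s t) ≤ eVariationOn η (Icc s t) := by
  set δ : ℝ → Plane := fun r => if r ∈ Icc s t then η r else γ r with hδ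
  have e1 : EqOn δ γ (Icc a s) := by
    intro r hr
    simp only [hδ]
    split_ifs with h'
    · rw [le_antisymm hr.2 h'.1, hηs]
    · rfl
  have e2 : EqOn δ η (Icc s t) := fun r hr => if_pos hr
  have e3 : EqOn δ γ (Icc t b) := by
    intro r hr
    simp only [hδ]
    split_ifs with h'
    · rw [le_antisymm h'.2 hr.1, hηt]
    · rfl
  have hu : Icc a b = Icc a s ∪ (Icc s t ∪ Icc t b) := by
    rw [Icc_union_Icc_eq_Icc hst.le ht, Icc_union_Icc_eq_Icc hs (hst.le.trans ht)]
  have hc : ContinuousOn δ (Icc a b) := by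
    rw [hu]
    have hγ := h.1.continuousOn
    rw [hu] at hγ
    refine ContinuousOn.union_of_isClosed ?_ (ContinuousOn.union_of_isClosed ?_ ?_
      isClosed_Icc isClosed_Icc) isClosed_Icc (isClosed_Icc.union isClosed_Icc)
    · exact (hγ.mono subset_union_left).congr e1
    · exact hη.continuousOn.congr e2
    · exact (hγ.mono (subset_union_right.trans subset_union_right)).congr e3
  have hp : HasC2Pieces δ a b := by
    have hγ := h.hasC2Pieces
    refine ((hγ.restrict le_rfl hs (hst.le.trans ht)).congr e1).trans
      (((HasC2Pieces.of_contDiffOn hst.le hη).congr e2).trans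
        ((hγ.restrict (hs.trans hst.le) ht le_rfl).congr e3))
  have hcurve : IsPiecewiseC2Curve X A B a b δ := by
    refine ⟨h.1.le, ?_, ?_, ?_, hc, HasC2Pieces.iff_exists_fin.1 hp⟩
    · rw [e1 (left_mem_Icc.2 hs), h.1.source]
    · rw [e3 (right_mem_Icc.2 ht), h.1.target]
    · intro r hr
      simp only [hδ]
      split_ifs with h'
      exacts [hX h', h.1.mapsTo hr]
  have hle := h.2 a b δ hcurve
  rw [← eVariationOn_Icc_add_Icc γ hs (hst.le.trans ht),
    ← eVariationOn_Icc_add_Icc γ hst.le ht, ← eVariationOn_Icc_add_Icc δ hs (hst.le.trans ht),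
    ← eVariationOn_Icc_add_Icc δ hst.le ht, eVariationOn.congr e1, eVariationOn.congr e2,
    eVariationOn.congr e3] at hle
  have h1 := h.eVariationOn_ne_top (s := a) (t := s) le_rfl (hst.le.trans ht)
  have h3 := h.eVariationOn_ne_top (s := t) (t := b) (hs.trans hst.le) le_rfl
  exact (ENNReal.add_le_add_iff_right h3).1 ((ENNReal.add_le_add_iff_left h1).1 hle)

/-- A shortest curve runs straight between two of its points whose segment lies in the region. -/
theorem wbtw (h : IsShortestCurve X A B a b γ) {s r t : ℝ} (hs : a ≤ s) (hsr : s ≤ r)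
    (hrt : r ≤ t) (ht : t ≤ b) (hX : segment ℝ (γ s) (γ t) ⊆ X) : Wbtw ℝ (γ s) (γ r) (γ t) := by
  rcases (hsr.trans hrt).eq_or_lt with he | hst
  · rw [le_antisymm (he ▸ hrt) hsr]
    exact wbtw_self_left ℝ _ _
  have hst0 : 0 < t - s := sub_pos.2 hst
  have hle : eVariationOn γ (Icc s t) ≤ edist (γ s) (γ t) := by
    refine (h.eVariationOn_le hs hst ht
      (η := fun r => AffineMap.lineMap (γ s) (γ t) ((r - s) / (t - s))) ?_ ?_ ?_ ?_).trans
      (eVariationOn_lineMap_le _ _ hst)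
    · refine ContDiff.contDiffOn ?_
      simp only [AffineMap.lineMap_apply_module]
      fun_prop
    · simp
    · simp [div_self hst0.ne']
    · intro r hr
      apply hX
      rw [segment_eq_image_lineMap]
      exact ⟨_, ⟨div_nonneg (sub_nonneg.2 hr.1) hst0.le,
        (div_le_one hst0).2 (by linarith [hr.2])⟩, rfl⟩
  rw [← eVariationOn_Icc_add_Icc γ hsr hrt] at hle
  have h1 := eVariationOn.edist_le γ (left_mem_Icc.2 hsr) (right_mem_Icc.2 hsr)
  have h2 := eVariationOn.edist_le γ (left_mem_Icc.2 hrt) (right_mem_Icc.2 hrt)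
  have h3 := (add_le_add h1 h2).trans hle
  rw [edist_dist, edist_dist, edist_dist, ← ENNReal.ofReal_add dist_nonneg dist_nonneg,
    ENNReal.ofReal_le_ofReal_iff dist_nonneg] at h3
  -- In a strictly convex norm, equality in the triangle inequality means betweenness.
  exact dist_add_dist_eq_iff.1 (le_antisymm h3 (dist_triangle _ _ _))

/-- The degenerate segment at `p` lies in the region, so between two visits of `p` the curve can
only rest there. -/
theorem ordConnected_fibre (h : IsShortestCurve X A B a b γ) (p : Plane) :
    {t | t ∈ Icc a b ∧ γ t = p}.OrdConnected := by
  refine ⟨?_⟩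
  rintro s ⟨hs, hsp⟩ t ⟨ht, htp⟩ r hr
  refine ⟨⟨hs.1.trans hr.1, hr.2.trans ht.2⟩, ?_⟩
  have := h.wbtw hs.1 hr.1 hr.2 ht.2 (by
    rw [hsp, htp, segment_same, singleton_subset_iff, ← hsp]
    exact h.1.mapsTo hs)
  rw [hsp, htp] at this
  exact (wbtw_self_iff ℝ).1 this

end IsShortestCurve


/-! ### Nearest point projection on a closed convex set -/

/-- `π` is the nearest point projection on `S`, characterized by obtuse angles. -/
structure IsNearestPoint (S : Set Plane) (π : Plane → Plane) : Prop where
  mem : ∀ x, π x ∈ S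
  inner_le : ∀ x, ∀ w ∈ S, inner ℝ (x - π x) (w - π x) ≤ 0

theorem exists_isNearestPoint {S : Set Plane} (hne : S.Nonempty) (hc : IsClosed S)
    (hS : Convex ℝ S) : ∃ π, IsNearestPoint S π := by
  choose π hπ hπ' using exists_norm_eq_iInf_of_complete_convex hne hc.isComplete hS
  exact ⟨π, hπ, fun x => (norm_eq_iInf_iff_real_inner_le_zero hS (hπ x)).1 (hπ' x)⟩

namespace IsNearestPoint

variable {S : Set Plane} {π : Plane → Plane} (h : IsNearestPoint S π)
include h

theorem eq_of_mem {x : Plane} (hx : x ∈ S) : π x = x := by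
  have := h.inner_le x x hx
  rw [real_inner_self_eq_norm_sq] at this
  have h0 : ‖x - π x‖ = 0 := by nlinarith [norm_nonneg (x - π x)]
  exact (sub_eq_zero.1 (norm_eq_zero.1 h0)).symm

/-- By the two obtuse angle inequalities, the increment of the projection and the increment of the
normal part have nonnegative inner product. The second square on the left records the loss of length
under projection. -/
theorem dist_sq_add_le (x y : Plane) :
    dist (π x) (π y) ^ 2 + ‖(x - π x) - (y - π y)‖ ^ 2 ≤ dist x y ^ 2 := by
  have h1 := h.inner_le x (π y) (h.mem y)
  have h2 := h.inner_le y (π x) (h.mem x)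
  have e : x - y = (π x - π y) + ((x - π x) - (y - π y)) := by abel
  rw [dist_eq_norm, dist_eq_norm, e, norm_add_sq_real]
  have e' : inner ℝ (π x - π y) ((x - π x) - (y - π y)) =
      -inner ℝ (x - π x) (π y - π x) - inner ℝ (y - π y) (π x - π y) := by
    rw [inner_sub_right, real_inner_comm (x - π x), real_inner_comm (y - π y),
      ← inner_neg_right, neg_sub]
  rw [e']
  linarith

theorem dist_le (x y : Plane) : dist (π x) (π y) ≤ dist x y :=
  abs_le_of_sq_le_sq' (by nlinarith [h.dist_sq_add_le x y, sq_nonneg ‖(x - π x) - (y - π y)‖])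
    dist_nonneg |>.2

theorem continuous : Continuous π :=
  (LipschitzWith.of_dist_le_mul (K := 1) fun x y => by simpa using h.dist_le x y).continuous

theorem eVariationOn_comp_le (g : ℝ → Plane) (T : Set ℝ) :
    eVariationOn (π ∘ g) T ≤ eVariationOn g T := by
  have hL : LipschitzOnWith 1 π univ :=
    (LipschitzWith.of_dist_le_mul (K := 1) fun x y => by simpa using h.dist_le x y).lipschitzOnWith
  simpa using hL.comp_eVariationOn_le (g := g) (mapsTo_univ g T)

/-- Let `l` and `V r` be the lengths of the projected and the original curve and `d` the final
distance from `S`. Summing `dist_sq_add_le` along the curve suggests `l ^ 2 + d ^ 2 ≤ V r ^ 2`. Its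
linear consequences `key`, one for each unit vector `(c, σ)`, are proved instead, because they are
additive along the curve. -/
theorem eVariationOn_comp_lt_of_end {g : ℝ → Plane} {s r : ℝ} (hsr : s ≤ r) (hs : g s ∈ S)
    (hr : g r ∉ S) (hfin : eVariationOn g (Icc s r) ≠ ⊤) :
    eVariationOn (π ∘ g) (Icc s r) < eVariationOn g (Icc s r) := by
  set D : ℝ → Plane := fun x => g x - π (g x) with hD
  set d : ℝ := ‖D r‖ with hd
  have hd0 : 0 < d := by
    rw [hd, norm_pos_iff]
    exact fun h0 => hr (sub_eq_zero.1 h0 ▸ h.mem (g r))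
  have hDs : D s = 0 := by
    rw [hD]
    beta_reduce
    rw [h.eq_of_mem hs, sub_self]
  have hfin' := ne_top_of_le_ne_top hfin (h.eVariationOn_comp_le g (Icc s r))
  set V : ℝ → ℝ := fun x => (eVariationOn g (Icc s x)).toReal with hV
  set l : ℝ := (eVariationOn (π ∘ g) (Icc s r)).toReal with hl
  have hl0 : 0 ≤ l := ENNReal.toReal_nonneg
  have hVd : ∀ x ∈ Icc s r, ∀ y ∈ Icc s r, x ≤ y → dist (g x) (g y) ≤ V y - V x := by
    intro x hx y hy hxy
    have hsub : ∀ u v, s ≤ u → v ≤ r → eVariationOn g (Icc u v) ≠ ⊤ := fun u v hu hv =>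
      ne_top_of_le_ne_top hfin (eVariationOn.mono g (Icc_subset_Icc hu hv))
    have h1 := eVariationOn_Icc_add_Icc g hx.1 hxy
    have h2 := eVariationOn.edist_le g (left_mem_Icc.2 hxy) (right_mem_Icc.2 hxy)
    rw [hV]
    beta_reduce
    rw [← h1, ENNReal.toReal_add (hsub _ _ le_rfl hx.2) (hsub _ _ hx.1 hy.2), add_sub_cancel_left,
      dist_edist]
    exact ENNReal.toReal_mono (hsub _ _ hx.1 hy.2) h2
  have key : ∀ c σ : ℝ, 0 < c → 0 ≤ σ → c ^ 2 + σ ^ 2 = 1 → c * l + σ * d ≤ V r := by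
    intro c σ hc hσ hcσ
    -- Pairing `D` with the fixed unit vector in the direction of `D r` replaces the norm of an
    -- increment by an increment of a real function, so that the estimate telescopes.
    set M : ℝ → ℝ := fun x => (V x - σ * inner ℝ (d⁻¹ • D r) (D x)) / c with hM
    have hdist : ∀ x ∈ Icc s r, ∀ y ∈ Icc s r, x ≤ y →
        dist ((π ∘ g) x) ((π ∘ g) y) ≤ M y - M x := by
      intro x hx y hy hxy
      have h1 := hVd x hx y hy hxy
      have h2 := h.dist_sq_add_le (g x) (g y)
      have h3 : inner ℝ (d⁻¹ • D r) (D y) - inner ℝ (d⁻¹ • D r) (D x) ≤ ‖D x - D y‖ := by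
        rw [← inner_sub_right, norm_sub_rev]
        refine (real_inner_le_norm _ _).trans ?_
        rw [norm_smul, norm_inv, norm_norm, inv_mul_cancel₀ hd0.ne', one_mul]
      set a := dist (π (g x)) (π (g y))
      set b := ‖D x - D y‖ with hb
      have h4 : c * a + σ * b ≤ dist (g x) (g y) := by
        refine (abs_le_of_sq_le_sq' ?_ dist_nonneg).2
        refine le_trans ?_ h2
        have : (c * a + σ * b) ^ 2 + (c * b - σ * a) ^ 2 = (c ^ 2 + σ ^ 2) * (a ^ 2 + b ^ 2) := by
          ring
        rw [hcσ, one_mul] at this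
        change _ ≤ a ^ 2 + b ^ 2
        nlinarith [sq_nonneg (c * b - σ * a)]
      have h5 := mul_le_mul_of_nonneg_left h3 hσ
      change a ≤ _
      rw [hM]
      beta_reduce
      rw [← sub_div, le_div_iff₀ hc]
      nlinarith
    have hle := eVariationOn_le_of_dist_le hsr hdist
    have hMle : l ≤ M r - M s := by
      have hM0 : 0 ≤ M r - M s :=
        dist_nonneg.trans (hdist s (left_mem_Icc.2 hsr) r (right_mem_Icc.2 hsr) hsr)
      rw [hl]
      exact (ENNReal.toReal_mono ENNReal.ofReal_ne_top hle).trans (ENNReal.toReal_ofReal hM0).le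
    have hin : inner ℝ (d⁻¹ • D r) (D r) = d := by
      rw [inner_smul_left, real_inner_self_eq_norm_sq, ← hd]
      simp
      field_simp
    have hMr : M r - M s = (V r - V s - σ * d) / c := by
      simp only [hM, hDs, hin, inner_zero_right]
      ring
    have hVs : V s = 0 := by simp [hV]
    rw [hMr, le_div_iff₀ hc, hVs] at hMle
    linarith
  have hlt : l < V r := by
    -- With the parametrization `c = (1 - x ^ 2) / (1 + x ^ 2)`, `σ = 2 * x / (1 + x ^ 2)` of the
    -- circle, `l < c * l + σ * d` amounts to `x * l < d` for positive `x`.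
    set x : ℝ := d / (l + 2 * d) with hx
    have hden : 0 < l + 2 * d := by linarith
    have hx0 : 0 < x := div_pos hd0 hden
    have hx1 : x < 1 := (div_lt_one hden).2 (by linarith)
    have hxl : x * l < d := by
      rw [hx, div_mul_eq_mul_div, div_lt_iff₀ hden]
      nlinarith
    have h1x : 0 < 1 + x ^ 2 := by positivity
    have := key ((1 - x ^ 2) / (1 + x ^ 2)) (2 * x / (1 + x ^ 2))
      (div_pos (by nlinarith) h1x) (by positivity) (by field_simp; ring)
    refine lt_of_lt_of_le ?_ this
    rw [div_mul_eq_mul_div, div_mul_eq_mul_div, ← add_div, lt_div_iff₀ h1x]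
    nlinarith [mul_pos hx0 (sub_pos.2 hxl)]
  exact (ENNReal.toReal_lt_toReal hfin' hfin).1 hlt

theorem eVariationOn_comp_lt {g : ℝ → Plane} {s r t : ℝ} (hsr : s ≤ r) (hrt : r ≤ t)
    (hs : g s ∈ S) (hr : g r ∉ S) (hfin : eVariationOn g (Icc s t) ≠ ⊤) :
    eVariationOn (π ∘ g) (Icc s t) < eVariationOn g (Icc s t) := by
  rw [← eVariationOn_Icc_add_Icc g hsr hrt, ← eVariationOn_Icc_add_Icc (π ∘ g) hsr hrt]
  have h1 : eVariationOn g (Icc s r) ≠ ⊤ :=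
    ne_top_of_le_ne_top hfin (eVariationOn.mono g (Icc_subset_Icc_right hrt))
  have h2 : eVariationOn g (Icc r t) ≠ ⊤ :=
    ne_top_of_le_ne_top hfin (eVariationOn.mono g (Icc_subset_Icc_left hsr))
  exact ENNReal.add_lt_add_of_lt_of_le
    (ne_top_of_le_ne_top h2 (h.eVariationOn_comp_le g (Icc r t)))
    (h.eVariationOn_comp_lt_of_end hsr hs hr h1) (h.eVariationOn_comp_le g _)

end IsNearestPoint

/-! ### The region above an arc of a convex graph -/

/-- The part of a strip on and above the graph of `f`, in the frame rotated by `θ`. -/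
def overGraph (f : ℝ[X]) (θ α β : ℝ) : Set Plane :=
  {p | (frame θ p).1 ∈ Icc α β ∧ f.eval (frame θ p).1 ≤ (frame θ p).2}

theorem isClosed_overGraph (f : ℝ[X]) (θ α β : ℝ) : IsClosed (overGraph f θ α β) :=
  (isClosed_Icc.preimage (continuous_frame θ).fst).inter
    (isClosed_le (f.continuous.comp (continuous_frame θ).fst) (continuous_frame θ).snd)

theorem convex_overGraph {f : ℝ[X]} (θ : ℝ) {α β : ℝ}
    (hf : ConvexOn ℝ (Icc α β) fun u => f.eval u) : Convex ℝ (overGraph f θ α β) := by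
  rintro p ⟨hp, hp'⟩ q ⟨hq, hq'⟩ a b ha hb hab
  have h1 := hf.1 hp hq ha hb hab
  have h2 := hf.2 hp hq ha hb hab
  simp only [smul_eq_mul] at h1 h2
  simp only [overGraph, mem_ofPred_eq, frame_combo]
  exact ⟨h1, h2.trans (add_le_add (mul_le_mul_of_nonneg_left hp' ha)
    (mul_le_mul_of_nonneg_left hq' hb))⟩

/-- A nearest point strictly above the graph and inside the strip would be interior to `overGraph`.
A small move towards `x` would then stay in the set and violate the obtuse angle condition. The
hypothesis `hx` excludes points `x` strictly above the graph, which are their own projections. -/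
theorem IsNearestPoint.eq_graphPt {f : ℝ[X]} {θ α β : ℝ} {π : Plane → Plane}
    (h : IsNearestPoint (overGraph f θ α β) π) {x : Plane}
    (hx : x ∈ overGraph f θ α β → side f θ x = 0)
    (hu : (frame θ (π x)).1 ∈ Ioo α β) : π x = graphPt f θ (frame θ (π x)).1 := by
  by_cases hxS : x ∈ overGraph f θ α β
  · rw [h.eq_of_mem hxS]
    exact (side_eq_zero_iff.1 (hx hxS)).symm
  symm
  rw [← side_eq_zero_iff]
  by_contra hne
  have hlt : f.eval (frame θ (π x)).1 < (frame θ (π x)).2 :=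
    lt_of_le_of_ne (h.mem x).2 fun e => hne (sub_eq_zero.2 e)
  set c : ℝ → Plane := fun ε => π x + ε • (x - π x) with hc
  have hcc : Continuous c := by fun_prop
  have hc0 : c 0 = π x := by simp [hc]
  have hopen : IsOpen {p : Plane | (frame θ p).1 ∈ Ioo α β ∧
      f.eval (frame θ p).1 < (frame θ p).2} :=
    (isOpen_Ioo.preimage (continuous_frame θ).fst).inter
      (isOpen_lt (f.continuous.comp (continuous_frame θ).fst) (continuous_frame θ).snd)
  have hev : ∀ᶠ ε in nhds (0 : ℝ), c ε ∈ {p : Plane | (frame θ p).1 ∈ Ioo α β ∧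
      f.eval (frame θ p).1 < (frame θ p).2} :=
    hcc.continuousAt.eventually_mem (hopen.mem_nhds (by rw [hc0]; exact ⟨hu, hlt⟩))
  obtain ⟨ε, hε, hε0⟩ := ((hev.filter_mono nhdsWithin_le_nhds).and
    (self_mem_nhdsWithin (a := (0 : ℝ)) (s := Ioi 0))).exists
  have hin := h.inner_le x (c ε) ⟨Ioo_subset_Icc_self hε.1, hε.2.le⟩
  have e : c ε - π x = ε • (x - π x) := by simp [hc]
  rw [e, inner_smul_right, real_inner_self_eq_norm_sq] at hin
  have hε0 : 0 < ε := hε0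
  have hn : ‖x - π x‖ = 0 := by
    have h2 : ‖x - π x‖ ^ 2 ≤ 0 := by
      by_contra! h3
      exact absurd hin (mul_pos hε0 h3).not_ge
    nlinarith [norm_nonneg (x - π x)]
  apply hxS
  rw [sub_eq_zero.1 (norm_eq_zero.1 hn)]
  exact h.mem x

/-- The projected curve sweeps the whole arc. Its abscissa moves continuously from `α` to `β`, and
the first time at which it reaches `u` is monotone in `u`. Thus the arc is `π ∘ g` composed with a
monotone map of times, and it cannot be longer than `π ∘ g`. -/
theorem IsNearestPoint.eVariationOn_graphPt_le {f : ℝ[X]} {θ α β : ℝ} (hαβ : α < β)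
    {π : Plane → Plane} (h : IsNearestPoint (overGraph f θ α β) π) {g : ℝ → Plane} {s t : ℝ}
    (hst : s ≤ t) (hg : ContinuousOn g (Icc s t)) (hgs : g s = graphPt f θ α)
    (hgt : g t = graphPt f θ β)
    (hS : ∀ x ∈ Icc s t, g x ∈ overGraph f θ α β → side f θ (g x) = 0) :
    eVariationOn (graphPt f θ) (Icc α β) ≤ eVariationOn (π ∘ g) (Icc s t) := by
  set U : ℝ → ℝ := fun x => (frame θ (π (g x))).1 with hU
  have hUc : ContinuousOn U (Icc s t) :=
    ((continuous_frame θ).fst.comp h.continuous).comp_continuousOn hg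
  have hmem : ∀ u ∈ Icc α β, graphPt f θ u ∈ overGraph f θ α β := fun u hu => by
    simp only [overGraph, mem_ofPred_eq, frame_graphPt]
    exact ⟨hu, le_rfl⟩
  have hπs : π (g s) = graphPt f θ α := by
    rw [hgs, h.eq_of_mem (hmem α (left_mem_Icc.2 hαβ.le))]
  have hπt : π (g t) = graphPt f θ β := by
    rw [hgt, h.eq_of_mem (hmem β (right_mem_Icc.2 hαβ.le))]
  have hUs : U s = α := by simp only [hU, hπs, frame_graphPt]
  have hUt : U t = β := by simp only [hU, hπt, frame_graphPt]
  set T : ℝ → Set ℝ := fun u => {x | x ∈ Icc s t ∧ u ≤ U x} with hT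
  have hTne : ∀ u ≤ β, (T u).Nonempty := fun u hu => ⟨t, right_mem_Icc.2 hst, hUt ▸ hu⟩
  have hTbdd : ∀ u, BddBelow (T u) := fun u => ⟨s, fun x hx => hx.1.1⟩
  have hTc : ∀ u, IsClosed (T u) := fun u => by
    have := hUc.preimage_isClosed_of_isClosed isClosed_Icc (isClosed_Ici (a := u))
    exact this
  have hτm : ∀ u ≤ β, sInf (T u) ∈ T u := fun u hu => (hTc u).csInf_mem (hTne u hu) (hTbdd u)
  have hτU : ∀ u ∈ Icc α β, U (sInf (T u)) = u := by
    intro u hu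
    obtain ⟨h1, h2⟩ := hτm u hu.2
    refine le_antisymm ?_ h2
    have hsub : Icc s (sInf (T u)) ⊆ Icc s t := Icc_subset_Icc_right h1.2
    obtain ⟨y, hy, hyu⟩ := intermediate_value_Icc h1.1 (hUc.mono hsub)
      ⟨hUs ▸ hu.1, h2⟩
    have hle : sInf (T u) ≤ y := csInf_le (hTbdd u) ⟨hsub hy, hyu.ge⟩
    rw [le_antisymm hle hy.2, hyu]
  -- When the abscissa first reaches `β`, the projection may lie on the vertical side of `overGraph`
  -- above the graph; the final time is used there instead.
  set τ : ℝ → ℝ := fun u => if u = β then t else sInf (T u) with hτ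
  have hτmaps : MapsTo τ (Icc α β) (Icc s t) := by
    intro u hu
    simp only [hτ]
    split_ifs
    exacts [right_mem_Icc.2 hst, (hτm u hu.2).1]
  have hτmono : MonotoneOn τ (Icc α β) := by
    intro u hu v hv huv
    by_cases hvβ : v = β
    · simp only [hτ, hvβ, if_true]
      exact (hτmaps hu).2
    · have huβ : u ≠ β := fun e => hvβ (le_antisymm hv.2 (e ▸ huv))
      simp only [hτ, hvβ, huβ, if_false]
      exact csInf_le_csInf (hTbdd u) (hTne v hv.2) fun x hx => ⟨hx.1, huv.trans hx.2⟩
  have heq : EqOn (graphPt f θ) ((π ∘ g) ∘ τ) (Icc α β) := by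
    intro u hu
    simp only [Function.comp, hτ]
    split_ifs with huβ
    · rw [hπt, huβ]
    · rcases hu.1.eq_or_lt with hα | hα
      · have : sInf (T u) = s := by
          refine le_antisymm (csInf_le (hTbdd u) ⟨left_mem_Icc.2 hst, ?_⟩) (hτm u hu.2).1.1
          rw [hUs, hα]
        rw [this, hπs, hα]
      · have hUu := hτU u hu
        have := h.eq_graphPt (hS _ (hτm u hu.2).1) (x := g (sInf (T u)))
          (by rw [show (frame θ (π (g (sInf (T u))))).1 = u from hUu]
              exact ⟨hα, lt_of_le_of_ne hu.2 huβ⟩)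
        rw [this, show (frame θ (π (g (sInf (T u))))).1 = u from hUu]
  rw [eVariationOn.congr heq]
  exact eVariationOn.comp_le_of_monotoneOn _ τ hτmono hτmaps

/-- The same for curves which run from right to left. -/
theorem IsNearestPoint.eVariationOn_graphPt_le' {f : ℝ[X]} {θ α β : ℝ} (hαβ : α < β)
    {π : Plane → Plane} (h : IsNearestPoint (overGraph f θ α β) π) {g : ℝ → Plane} {s t : ℝ}
    (hst : s ≤ t) (hg : ContinuousOn g (Icc s t)) (hgs : g s = graphPt f θ β)
    (hgt : g t = graphPt f θ α)
    (hS : ∀ x ∈ Icc s t, g x ∈ overGraph f θ α β → side f θ (g x) = 0) :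
    eVariationOn (graphPt f θ) (Icc α β) ≤ eVariationOn (π ∘ g) (Icc s t) := by
  have hneg : MapsTo (fun x : ℝ => -x) (Icc (-t) (-s)) (Icc s t) := fun x hx =>
    ⟨by linarith [hx.2], by linarith [hx.1]⟩
  have := h.eVariationOn_graphPt_le (g := fun x => g (-x)) hαβ (neg_le_neg hst)
    (hg.comp continuous_neg.continuousOn hneg) (by simpa using hgt) (by simpa using hgs)
    (fun x hx => hS _ (hneg hx))
  refine this.trans ?_
  exact eVariationOn.comp_le_of_antitoneOn (π ∘ g) (fun x => -x)
    (fun x _ y _ hxy => neg_le_neg hxy) hneg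

/-! ### Shortest curves along convex boundary arcs -/

namespace IsShortestCurve

variable {X : Set Plane} {A B : Plane} {a b : ℝ} {γ : ℝ → Plane}

/-- The curve stays on or below the graph, so it meets the convex set `overGraph` only on the graph.
If it left the arc, its projection would be strictly shorter than the curve and at least as long as
the arc. Replacing this part of the curve by the arc would then shorten it. -/
theorem mem_graph_of_convexOn (h : IsShortestCurve X A B a b γ) {f : ℝ[X]} {θ α β : ℝ}
    (hXf : X ⊆ halfPlane f θ) (hαβ : α < β) (hf : ConvexOn ℝ (Icc α β) fun u => f.eval u)
    (hX : ∀ u ∈ Icc α β, graphPt f θ u ∈ X) {s r t : ℝ} (hs : a ≤ s) (hsr : s ≤ r)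
    (hrt : r ≤ t) (ht : t ≤ b)
    (hends : (γ s = graphPt f θ α ∧ γ t = graphPt f θ β) ∨
      (γ s = graphPt f θ β ∧ γ t = graphPt f θ α)) :
    γ r ∈ graphPt f θ '' Icc α β := by
  have hsub : Icc s t ⊆ Icc a b := Icc_subset_Icc hs ht
  have hS : ∀ x ∈ Icc s t, γ x ∈ overGraph f θ α β → side f θ (γ x) = 0 := fun x hx hxS =>
    le_antisymm (sub_nonpos.2 hxS.2) (hXf (h.1.mapsTo (hsub hx)))
  by_cases hrS : γ r ∈ overGraph f θ α β
  · exact ⟨_, hrS.1, side_eq_zero_iff.1 (hS r ⟨hsr, hrt⟩ hrS)⟩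
  exfalso
  have hst : s < t := by
    refine lt_of_le_of_ne (hsr.trans hrt) fun e => ?_
    subst e
    rcases hends with ⟨h1, h2⟩ | ⟨h1, h2⟩
    · exact hαβ.ne (graphPt_injective f θ (h1.symm.trans h2))
    · exact hαβ.ne (graphPt_injective f θ (h2.symm.trans h1))
  have hst0 : 0 < t - s := sub_pos.2 hst
  have hmem : ∀ u ∈ Icc α β, graphPt f θ u ∈ overGraph f θ α β := fun u hu => by
    simp only [overGraph, mem_ofPred_eq, frame_graphPt]
    exact ⟨hu, le_rfl⟩
  obtain ⟨π, hπ⟩ := exists_isNearestPoint ⟨_, hmem α (left_mem_Icc.2 hαβ.le)⟩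
    (isClosed_overGraph f θ α β) (convex_overGraph θ hf)
  have hC2 : ContDiff ℝ 2 (graphPt f θ) := by
    rw [contDiff_euclidean]
    intro i
    fin_cases i
    · exact (isPoly_graphPt_zero f θ).contDiff
    · exact (isPoly_graphPt_one f θ).contDiff
  have hγc := h.1.continuousOn.mono hsub
  have hfin := h.eVariationOn_ne_top hs ht
  have hratio : ∀ x ∈ Icc s t, (x - s) / (t - s) ∈ Icc (0 : ℝ) 1 := fun x hx =>
    ⟨div_nonneg (sub_nonneg.2 hx.1) hst0.le, (div_le_one hst0).2 (by linarith [hx.2])⟩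
  have hmono : Monotone fun x : ℝ => (x - s) / (t - s) := fun x y hxy =>
    (div_le_div_iff_of_pos_right hst0).2 (by linarith)
  have hβα : 0 < β - α := sub_pos.2 hαβ
  rcases hends with ⟨h1, h2⟩ | ⟨h1, h2⟩
  · have hcov := hπ.eVariationOn_graphPt_le hαβ hst.le hγc h1 h2 hS
    have hlt := hπ.eVariationOn_comp_lt hsr hrt (h1 ▸ hmem α (left_mem_Icc.2 hαβ.le)) hrS hfin
    set ρ : ℝ → ℝ := fun x => α + (β - α) * ((x - s) / (t - s)) with hρ
    have hρm : MapsTo ρ (Icc s t) (Icc α β) := fun x hx => by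
      have := hratio x hx
      exact ⟨by simp only [hρ]; nlinarith [this.1], by simp only [hρ]; nlinarith [this.2]⟩
    have hrep := h.eVariationOn_le hs hst ht (η := graphPt f θ ∘ ρ)
      (hC2.comp (by fun_prop)).contDiffOn (by simp [hρ, h1])
      (by simp [hρ, h2, div_self hst0.ne']) (fun x hx => hX _ (hρm hx))
    have hle := eVariationOn.comp_le_of_monotoneOn (graphPt f θ) ρ (t := Icc s t)
      (fun x _ y _ hxy => by
        simp only [hρ]
        nlinarith [mul_le_mul_of_nonneg_left (hmono hxy) hβα.le]) hρm
    exact absurd (hrep.trans (hle.trans hcov)) hlt.not_ge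
  · have hcov := hπ.eVariationOn_graphPt_le' hαβ hst.le hγc h1 h2 hS
    have hlt := hπ.eVariationOn_comp_lt hsr hrt (h1 ▸ hmem β (right_mem_Icc.2 hαβ.le)) hrS hfin
    set ρ : ℝ → ℝ := fun x => β - (β - α) * ((x - s) / (t - s)) with hρ
    have hρm : MapsTo ρ (Icc s t) (Icc α β) := fun x hx => by
      have := hratio x hx
      exact ⟨by simp only [hρ]; nlinarith [this.2], by simp only [hρ]; nlinarith [this.1]⟩
    have hrep := h.eVariationOn_le hs hst ht (η := graphPt f θ ∘ ρ)
      (hC2.comp (by fun_prop)).contDiffOn (by simp [hρ, h1])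
      (by simp [hρ, h2, div_self hst0.ne']) (fun x hx => hX _ (hρm hx))
    have hle := eVariationOn.comp_le_of_antitoneOn (graphPt f θ) ρ (t := Icc s t)
      (fun x _ y _ hxy => by
        simp only [hρ]
        nlinarith [mul_le_mul_of_nonneg_left (hmono hxy) hβα.le]) hρm
    exact absurd (hrep.trans (hle.trans hcov)) hlt.not_ge

/-- A shortest curve spends an interval of time on an arc of the boundary where the complement of
the half plane is convex. -/
theorem ordConnected_convexArc (h : IsShortestCurve X A B a b γ) {f : ℝ[X]} {θ : ℝ}
    (hXf : X ⊆ halfPlane f θ) {I : Set ℝ} (hI : I.OrdConnected)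
    (hf : ConvexOn ℝ I fun u => f.eval u) (hX : ∀ u ∈ I, graphPt f θ u ∈ X) :
    {t | t ∈ Icc a b ∧ γ t ∈ graphPt f θ '' I}.OrdConnected := by
  refine ⟨?_⟩
  rintro s ⟨hs, u, hu, hus⟩ t ⟨ht, v, hv, hvt⟩ r hr
  refine ⟨⟨hs.1.trans hr.1, hr.2.trans ht.2⟩, ?_⟩
  rcases lt_trichotomy u v with huv | huv | huv
  · have hsub : Icc u v ⊆ I := hI.out hu hv
    exact image_mono hsub (h.mem_graph_of_convexOn hXf huv (hf.subset hsub (convex_Icc _ _))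
      (fun x hx => hX x (hsub hx)) hs.1 hr.1 hr.2 ht.2 (Or.inl ⟨hus.symm, hvt.symm⟩))
  · have := (h.ordConnected_fibre (graphPt f θ u)).out ⟨hs, hus.symm⟩ ⟨ht, by rw [huv, hvt]⟩ hr
    exact ⟨u, hu, this.2.symm⟩
  · have hsub : Icc v u ⊆ I := hI.out hv hu
    exact image_mono hsub (h.mem_graph_of_convexOn hXf huv (hf.subset hsub (convex_Icc _ _))
      (fun x hx => hX x (hsub hx)) hs.1 hr.1 hr.2 ht.2 (Or.inr ⟨hus.symm, hvt.symm⟩))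

end IsShortestCurve


/-! ### Two graphs which coincide -/

theorem frame_graphPt_rotated (f : ℝ[X]) (θ φ u : ℝ) :
    frame φ (graphPt f θ u) =
      (Real.cos (φ - θ) * u + Real.sin (φ - θ) * f.eval u,
        -Real.sin (φ - θ) * u + Real.cos (φ - θ) * f.eval u) := by
  simp only [graphPt, frame, unframe_zero_coord, unframe_one_coord, Real.cos_sub, Real.sin_sub]
  ext <;> ring

theorem frame_eq_of_sin_eq_zero {θ φ : ℝ} (hs : Real.sin (φ - θ) = 0) (p : Plane) :
    frame φ p = (Real.cos (φ - θ) * (frame θ p).1, Real.cos (φ - θ) * (frame θ p).2) := by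
  have e : φ = θ + (φ - θ) := by ring
  conv_lhs => rw [e]
  set c := φ - θ
  simp only [frame, Real.cos_add, Real.sin_add, hs]
  ext <;> simp <;> ring

/-- A polynomial graph which is not a line lies on another polynomial graph only if the frames
are equal or opposite. -/
theorem sin_eq_zero_of_side_graphPt {f g : ℝ[X]} {θ φ : ℝ} (hf : f.derivative.derivative ≠ 0)
    (h : ∀ u, side g φ (graphPt f θ u) = 0) : Real.sin (φ - θ) = 0 := by
  by_contra hs
  set c := Real.cos (φ - θ) with hc
  set s := Real.sin (φ - θ) with hsdef
  have hd : 2 ≤ f.natDegree := by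
    by_contra! hlt
    exact hf (derivative_of_natDegree_zero (by
      have := natDegree_derivative_le f
      omega))
  have hpoly : g.comp (C c * X + C s * f) = C (-s) * X + C c * f := by
    refine Polynomial.funext fun u => ?_
    have := h u
    rw [side, frame_graphPt_rotated, sub_eq_zero] at this
    simpa [eval_comp] using this
  have hin : (C c * X + C s * f).natDegree = f.natDegree := by
    rw [natDegree_add_eq_right_of_natDegree_lt, natDegree_C_mul hs]
    rw [natDegree_C_mul hs]
    exact (natDegree_C_mul_le c X).trans_lt (by rw [natDegree_X]; omega)
  have hout : (C (-s) * X + C c * f).natDegree ≤ f.natDegree :=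
    (natDegree_add_le _ _).trans (max_le ((natDegree_C_mul_le _ X).trans (by rw [natDegree_X]; omega))
      (natDegree_C_mul_le _ _))
  -- The composition has degree `deg g * deg f` and equals a polynomial of degree at most `deg f`,
  -- where `deg f ≥ 2`.
  have hg : g.natDegree ≤ 1 := by
    have hcomp := congrArg natDegree hpoly
    rw [natDegree_comp, hin] at hcomp
    nlinarith
  obtain ⟨p, q, rfl⟩ := exists_eq_X_add_C_of_natDegree_le_one hg
  have hev : ∀ u, p * (c * u + s * f.eval u) + q = -s * u + c * f.eval u := fun u => by
    simpa using congrArg (eval u) hpoly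
  have hder : C (p * s - c) * f = C (-(s + p * c)) * X - C q := by
    refine Polynomial.funext fun u => ?_
    simp only [eval_mul, eval_C, eval_sub, eval_X]
    linear_combination hev u
  -- Two derivatives kill the right-hand side of `hder`, while `f''` is not zero.
  have hpc : p * s - c = 0 := by
    have := congrArg (fun P => derivative (derivative P)) hder
    simp only [derivative_sub, derivative_C_mul, derivative_C, derivative_X, mul_one,
      sub_zero] at this
    rcases mul_eq_zero.1 this with h0 | h0
    · exact C_eq_zero.1 h0
    · exact absurd h0 hf
  have h0 := hev 0
  have h1 := hev 1
  have hcs : c = p * s := by linarith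
  rw [hcs] at h0 h1
  have : s * (p ^ 2 + 1) = 0 := by linear_combination h1 - h0
  rcases mul_eq_zero.1 this with h' | h'
  · exact hs h'
  · nlinarith [sq_nonneg p]

/-- The cosine of the angle between the frames is `1` or `-1`. In the second case the half planes
lie on opposite sides of the common graph, and a concave arc of one is a convex arc of the other. -/
theorem halfPlane_eq_or_opposite {f g : ℝ[X]} {θ φ : ℝ} (hf : f.derivative.derivative ≠ 0)
    (h : ∀ u, side g φ (graphPt f θ u) = 0) :
    halfPlane g φ = halfPlane f θ ∨ ((∀ u, graphPt f θ u = graphPt g φ (-u)) ∧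
      ∀ u, g.derivative.derivative.eval (-u) = -f.derivative.derivative.eval u) := by
  have hs := sin_eq_zero_of_side_graphPt hf h
  have hside : ∀ u, g.eval (Real.cos (φ - θ) * u) = Real.cos (φ - θ) * f.eval u := fun u => by
    have := h u
    rw [side, frame_graphPt_rotated, hs, sub_eq_zero] at this
    simpa using this
  have hc : Real.cos (φ - θ) = 1 ∨ Real.cos (φ - θ) = -1 := by
    have := Real.sin_sq_add_cos_sq (φ - θ)
    rw [hs] at this
    exact sq_eq_one_iff.1 (by linarith)
  rcases hc with hc | hc
  · left
    have hgf : g = f := Polynomial.funext fun u => by simpa [hc] using hside u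
    ext p
    rw [mem_halfPlane, mem_halfPlane, side, side, frame_eq_of_sin_eq_zero hs, hc, hgf]
    simp
  · right
    have hg : ∀ u, g.eval (-u) = -f.eval u := fun u => by simpa [hc] using hside u
    have hgf : f = -(g.comp (-X)) := Polynomial.funext fun u => by simp [hg]
    constructor
    · intro u
      rw [← side_eq_zero_iff.1 (h u), frame_graphPt_rotated, hs, hc]
      simp
    · intro u
      rw [hgf]
      simp [derivative_comp]

/-! ### The shape of a shortest curve -/

theorem convexOn_eval {f : ℝ[X]} {I : Set ℝ} (hI : I.OrdConnected)
    (h : ∀ u ∈ I, 0 ≤ f.derivative.derivative.eval u) : ConvexOn ℝ I fun u => f.eval u := by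
  have hd : deriv (fun u => f.eval u) = fun u => f.derivative.eval u := by
    ext u
    exact f.deriv
  refine convexOn_of_deriv2_nonneg hI.convex f.continuous.continuousOn
    f.differentiable.differentiableOn ?_ fun u hu => ?_
  · rw [hd]
    exact f.derivative.differentiable.differentiableOn
  · rw [Function.iterate_succ, Function.iterate_one, Function.comp, hd, Polynomial.deriv]
    exact h u (interior_subset hu)

theorem strictConcaveOn_eval {f : ℝ[X]} {I : Set ℝ} (hI : I.OrdConnected)
    (h : ∀ u ∈ I, f.derivative.derivative.eval u < 0) :
    StrictConcaveOn ℝ I fun u => f.eval u := by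
  have hd : deriv (fun u => f.eval u) = fun u => f.derivative.eval u := by
    ext u
    exact f.deriv
  refine strictConcaveOn_of_deriv2_neg hI.convex f.continuous.continuousOn fun u hu => ?_
  rw [Function.iterate_succ, Function.iterate_one, Function.comp, hd, Polynomial.deriv]
  exact h u (interior_subset hu)

theorem continuousOn_dist {g h : ℝ → Plane} {T : Set ℝ} (hg : ContinuousOn g T)
    (hh : ContinuousOn h T) : ContinuousOn (fun t => dist (g t) (h t)) T :=
  fun t ht => (hg t ht).dist (hh t ht)

/-- Intermediate values of the distance to `p`. The points obtained serve as ends of short chords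
and as witnesses of a direction of arrival. -/
theorem exists_mem_ball_ne {γ : ℝ → Plane} {s t : ℝ} {p : Plane} (hst : s ≤ t)
    (hγ : ContinuousOn γ (Icc s t)) (h : (γ s = p ∧ γ t ≠ p) ∨ (γ s ≠ p ∧ γ t = p)) {ε : ℝ}
    (hε : 0 < ε) : ∃ r ∈ Icc s t, γ r ∈ Metric.ball p ε ∧ γ r ≠ p := by
  have hc : ContinuousOn (fun r => dist (γ r) p) (Icc s t) :=
    continuousOn_dist hγ continuousOn_const
  have key : ∀ d, 0 < d → ∃ e, 0 < e ∧ e ≤ d ∧ e < ε := fun d hd =>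
    ⟨min d (ε / 2), lt_min hd (half_pos hε), min_le_left _ _,
      (min_le_right _ _).trans_lt (half_lt_self hε)⟩
  rcases h with ⟨h1, h2⟩ | ⟨h1, h2⟩
  · obtain ⟨e, he, hed, heε⟩ := key _ (dist_pos.2 h2)
    obtain ⟨r, hr, hre⟩ := intermediate_value_Icc hst hc ⟨by simp [h1, he.le], hed⟩
    exact ⟨r, hr, by simpa [← hre] using heε, dist_pos.1 (he.trans_eq hre.symm)⟩
  · obtain ⟨e, he, hed, heε⟩ := key _ (dist_pos.2 h1)
    obtain ⟨r, hr, hre⟩ := intermediate_value_Icc' hst hc ⟨by simp [h2, he.le], hed⟩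
    exact ⟨r, hr, by simpa [← hre] using heε, dist_pos.1 (he.trans_eq hre.symm)⟩

theorem forall_pos_or_neg_of_ne_zero {h : ℝ → ℝ} {I : Set ℝ} (hI : I.OrdConnected)
    (hc : ContinuousOn h I) (h0 : ∀ u ∈ I, h u ≠ 0) :
    (∀ u ∈ I, 0 < h u) ∨ ∀ u ∈ I, h u < 0 := by
  by_contra! hcon
  obtain ⟨⟨u, hu, hu0⟩, v, hv, hv0⟩ := hcon
  obtain ⟨w, hw, hw0⟩ := hI.isPreconnected.intermediate_value hu hv hc ⟨hu0, hv0⟩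
  exact h0 w hw hw0

/-- One exceptional set serves the whole family: on an interval that avoids it, every member
vanishes identically or has constant sign. -/
theorem exists_finite_zeros {ι : Type*} [Finite ι] {h : ι → ℝ → ℝ} (hh : ∀ i, IsPoly (h i)) :
    ∃ R : Set ℝ, R.Finite ∧ ∀ i, (∀ u, h i u = 0) ∨ ∀ u ∉ R, h i u ≠ 0 := by
  refine ⟨⋃ i ∈ {i | {u | h i u = 0}.Finite}, {u | h i u = 0},
    (toFinite _).biUnion fun i hi => hi, fun i => ?_⟩
  rcases (hh i).zero_or_finite with h0 | h0
  · exact Or.inl h0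
  · exact Or.inr fun u hu h1 => hu (mem_biUnion (show i ∈ {i | {u | h i u = 0}.Finite} from h0) h1)

/-! ### Tameness of the contacts with polynomial graphs -/

namespace IsShortestCurve

variable {X : Set Plane} {A B : Plane} {a b : ℝ} {γ : ℝ → Plane}

/-- A shortest curve is straight as long as it stays in the interior of the region. -/
theorem wbtw_of_isOpen (h : IsShortestCurve X A B a b γ) {U : Set Plane} (hU : IsOpen U)
    (hUX : U ⊆ X) {s t : ℝ} (hs : a ≤ s) (ht : t ≤ b) (hγU : ∀ r ∈ Icc s t, γ r ∈ U) :
    ∀ x ∈ Icc s t, ∀ r ∈ Icc s x, Wbtw ℝ (γ s) (γ r) (γ x) := by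
  rcases lt_or_ge t s with hts | hst
  · simp [hts]
  have hγ : ContinuousOn γ (Icc s t) := h.1.continuousOn.mono (Icc_subset_Icc hs ht)
  -- Continuous induction on `x`. Writing `min r x` lets `r` range over a fixed interval, so that
  -- the good `x` form an intersection of closed sets.
  set T : Set ℝ := {x | ∀ r ∈ Icc s t, Wbtw ℝ (γ s) (γ (min r x)) (γ x)} with hT
  have hTcl : IsClosed (T ∩ Icc s t) := by
    have : T ∩ Icc s t = ⋂ r ∈ Icc s t, {x | x ∈ Icc s t ∧
        dist (γ s) (γ (min r x)) + dist (γ (min r x)) (γ x) - dist (γ s) (γ x) = 0} := by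
      ext x
      simp only [hT, mem_inter_iff, mem_ofPred_eq, mem_iInter, sub_eq_zero]
      exact ⟨fun hx r hr => ⟨hx.2, dist_add_dist_eq_iff.2 (hx.1 r hr)⟩, fun hx =>
        ⟨fun r hr => dist_add_dist_eq_iff.1 (hx r hr).2, (hx s (left_mem_Icc.2 hst)).1⟩⟩
    rw [this]
    refine isClosed_biInter fun r hr => ?_
    have hmin : ContinuousOn (fun x => γ (min r x)) (Icc s t) :=
      hγ.comp (continuous_const.min continuous_id).continuousOn fun x hx =>
        ⟨le_min hr.1 hx.1, (min_le_right _ _).trans hx.2⟩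
    exact ((((continuousOn_dist continuousOn_const hmin).add (continuousOn_dist hmin hγ)).sub
      (continuousOn_dist continuousOn_const hγ)).preimage_isClosed_of_isClosed isClosed_Icc
        (isClosed_singleton (x := (0 : ℝ))))
  have hsub := hTcl.Icc_subset_of_forall_mem_nhdsWithin
    (by
      intro r hr
      rw [min_eq_right hr.1]
      exact wbtw_self_right ℝ _ _)
    (by
      rintro x ⟨hxT, hxs, hxt⟩
      have hxm : x ∈ Icc s t := ⟨hxs, hxt.le⟩
      obtain ⟨ε, hε, hball⟩ := Metric.isOpen_iff.1 hU (γ x) (hγU x hxm)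
      have hloc : ∀ u ∈ Icc s t, ∀ v ∈ Icc s t, γ u ∈ Metric.ball (γ x) ε →
          γ v ∈ Metric.ball (γ x) ε → ∀ r ∈ Icc u v, Wbtw ℝ (γ u) (γ r) (γ v) := by
        intro u hu v hv huB hvB r hr
        exact h.wbtw (hs.trans hu.1) hr.1 hr.2 (hv.2.trans ht)
          (((convex_ball _ _).segment_subset huB hvB).trans (hball.trans hUX))
      have hev : ∀ᶠ y in nhdsWithin x (Ioi x), y ∈ Ioc x t ∧ γ y ∈ Metric.ball (γ x) ε := by
        have h1 : ∀ᶠ y in nhdsWithin x (Ioi x), y ∈ Ioc x t := Ioc_mem_nhdsGT hxt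
        refine h1.and ?_
        have h2 := (hγ x hxm).eventually_mem (Metric.ball_mem_nhds (γ x) hε)
        refine Filter.Eventually.filter_mono ?_ h2
        rw [nhdsWithin_le_iff]
        filter_upwards [h1] with y hy
        exact ⟨hxs.trans hy.1.le, hy.2⟩
      filter_upwards [hev] with y hy
      have hym : y ∈ Icc s t := ⟨hxs.trans hy.1.1.le, hy.1.2⟩
      intro r hr
      rcases le_total y r with hyr | hry
      · rw [min_eq_right hyr]
        exact wbtw_self_right ℝ _ _
      rw [min_eq_left hry]
      have hxB := Metric.mem_ball_self (x := γ x) hε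
      by_cases hne : γ s = γ x
      · rcases le_total r x with hrx | hxr
        · have := hxT r hr
          rw [min_eq_left hrx, ← hne, wbtw_self_iff] at this
          rw [this]
          exact wbtw_self_left ℝ _ _
        · rw [hne]
          exact hloc x hxm y hym hxB hy.2 r ⟨hxr, hry⟩
      -- A point `γ z` near `γ x` and different from it fixes the direction of arrival. Inside the
      -- ball the curve is straight from `z` to `y`, so the two straight parts overlap in a
      -- nondegenerate segment and can be joined.
      · obtain ⟨z, hz, hzB, hzne⟩ := exists_mem_ball_ne hxs
          (hγ.mono (Icc_subset_Icc_right hxt.le)) (Or.inr ⟨hne, rfl⟩) hε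
        have hzm : z ∈ Icc s t := ⟨hz.1, hz.2.trans hxt.le⟩
        have h1 : Wbtw ℝ (γ s) (γ z) (γ x) := by
          have := hxT z hzm
          rwa [min_eq_left hz.2] at this
        have h2 := hloc z hzm y hym hzB hy.2 x ⟨hz.2, hy.1.1.le⟩
        have h3 := h1.trans_expand_right h2 hzne
        rcases le_total r x with hrx | hxr
        · have := hxT r hr
          rw [min_eq_left hrx] at this
          exact h3.trans_left this
        · exact h3.trans_right (hloc x hxm y hym hxB hy.2 r ⟨hxr, hry⟩))
  intro x hx r hr
  have := hsub hx r ⟨hr.1, hr.2.trans hx.2⟩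
  rwa [min_eq_left hr.2] at this

/-- A shortest curve does not touch the boundary from the interior at a point where the half plane
is locally strictly convex. -/
theorem eq_end_of_strictConcave {k : ℕ} {f : Fin k → ℝ[X]} {θ : Fin k → ℝ}
    (h : IsShortestCurve (⋂ i, halfPlane (f i) (θ i)) A B a b γ) {i : Fin k} {u : ℝ}
    (hu : (f i).derivative.derivative.eval u < 0)
    (hj : ∀ j, halfPlane (f j) (θ j) = halfPlane (f i) (θ i) ∨
      0 < side (f j) (θ j) (graphPt (f i) (θ i) u)) {r : ℝ} (hr : r ∈ Icc a b)
    (hγr : γ r = graphPt (f i) (θ i) u) : γ r = A ∨ γ r = B := by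
  by_contra! hne
  obtain ⟨hA, hB⟩ := hne
  set p := γ r with hp
  have hup : (frame (θ i) p).1 = u := by rw [hγr, frame_graphPt]
  obtain ⟨ρ, hρ, hρ'⟩ := Metric.isOpen_iff.1
    (isOpen_lt (f i).derivative.derivative.continuous continuous_const) u hu
  -- Near `p` only the half plane of `i` matters: every other one coincides with it or contains a
  -- neighbourhood of `p`.
  have hball : ∀ᶠ q in nhds p, (frame (θ i) q).1 ∈ Metric.ball u ρ ∧
      ∀ j, halfPlane (f j) (θ j) = halfPlane (f i) (θ i) ∨ 0 < side (f j) (θ j) q := by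
    refine ((continuous_frame (θ i)).fst.continuousAt.eventually_mem
      (by rw [hup]; exact Metric.ball_mem_nhds u hρ)).and (Filter.eventually_all.2 fun j => ?_)
    rcases hj j with hj | hj
    · exact Filter.Eventually.of_forall fun _ => Or.inl hj
    · rw [← hγr] at hj
      filter_upwards [(continuous_side (f j) (θ j)).continuousAt.eventually_mem
        (lt_mem_nhds hj)] with q hq
      exact Or.inr hq
  obtain ⟨ε, hε, hεball⟩ := Metric.eventually_nhds_iff_ball.1 hball
  have hγ := h.1.continuousOn
  obtain ⟨s, hs, hsB, hsp⟩ := exists_mem_ball_ne hr.1 (hγ.mono (Icc_subset_Icc_right hr.2))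
    (Or.inr ⟨by rw [h.1.source]; exact hA.symm, rfl⟩) hε
  obtain ⟨t, ht, htB, htp⟩ := exists_mem_ball_ne hr.2 (hγ.mono (Icc_subset_Icc_left hr.1))
    (Or.inl ⟨rfl, by rw [h.1.target]; exact hB.symm⟩) hε
  have hsX := h.1.mapsTo (show s ∈ Icc a b from ⟨hs.1, hs.2.trans hr.2⟩)
  have htX := h.1.mapsTo (show t ∈ Icc a b from ⟨hr.1.trans ht.1, ht.2⟩)
  have hconc : StrictConcaveOn ℝ (Metric.ball u ρ) fun v => (f i).eval v := by
    refine strictConcaveOn_eval ?_ fun v hv => hρ' hv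
    rw [Real.ball_eq_Ioo]
    exact ordConnected_Ioo
  have hside : ∀ q ∈ ⋂ i, halfPlane (f i) (θ i),
      (frame (θ i) q).2 ≤ (f i).eval (frame (θ i) q).1 := fun q hq =>
    sub_nonneg.1 (mem_iInter.1 hq i)
  have hseg : segment ℝ (γ s) (γ t) ⊆ ⋂ i, halfPlane (f i) (θ i) := by
    intro q hq
    have hqB := (convex_ball p ε).segment_subset hsB htB hq
    have hqi : q ∈ halfPlane (f i) (θ i) := by
      obtain ⟨c, d, hc, hd, hcd, rfl⟩ := hq
      have := hconc.concaveOn.2 (hεball _ hsB).1 (hεball _ htB).1 hc hd hcd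
      rw [mem_halfPlane, side, frame_combo, sub_nonneg]
      refine le_trans ?_ this
      exact add_le_add (mul_le_mul_of_nonneg_left (hside _ hsX) hc)
        (mul_le_mul_of_nonneg_left (hside _ htX) hd)
    refine mem_iInter.2 fun j => ?_
    rcases (hεball q hqB).2 j with hj | hj
    · rw [hj]
      exact hqi
    · exact hj.le
  have hw := h.wbtw hs.1 hs.2 ht.1 ht.2 hseg
  obtain ⟨c, d, hc, hd, hcd, hcdp⟩ := mem_segment_iff_wbtw.2 hw
  rw [← hp] at hcdp
  have hc0 : 0 < c := lt_of_le_of_ne hc fun e => htp (by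
    rw [← hp, ← hcdp, ← e, show d = 1 by linarith]; simp)
  have hd0 : 0 < d := lt_of_le_of_ne hd fun e => hsp (by
    rw [← hp, ← hcdp, ← e, show c = 1 by linarith]; simp)
  have hfp : frame (θ i) p = (u, (f i).eval u) := by rw [hγr, frame_graphPt]
  rw [← hcdp, frame_combo, Prod.mk.injEq] at hfp
  obtain ⟨e1, e2⟩ := hfp
  have hs2 := hside _ hsX
  have ht2 := hside _ htX
  -- The point `p` of the graph lies strictly inside the chord. If the chord is vertical, its ends
  -- lie at or below `p`, which forces `γ s = p`. Otherwise strict concavity puts the inner points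
  -- of the chord strictly below the graph.
  by_cases hst : (frame (θ i) (γ s)).1 = (frame (θ i) (γ t)).1
  · rw [← hst, ← add_mul, hcd, one_mul] at e1
    rw [← hst, e1] at ht2
    rw [e1] at hs2
    have hs3 : (frame (θ i) (γ s)).2 = (f i).eval u := by
      refine le_antisymm hs2 ?_
      by_contra! hlt
      have h1 := mul_lt_mul_of_pos_left hlt hc0
      have h2 := mul_le_mul_of_nonneg_left ht2 hd
      have h3 : c * (f i).eval u + d * (f i).eval u = (f i).eval u := by rw [← add_mul, hcd, one_mul]
      linarith
    apply hsp
    apply frame_injective (θ i)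
    rw [← hp, hγr, frame_graphPt]
    exact Prod.ext e1 hs3
  · have h1 := hconc.2 (hεball _ hsB).1 (hεball _ htB).1 hst hc0 hd0 hcd
    simp only [smul_eq_mul] at h1
    rw [e1] at h1
    have h2 := mul_le_mul_of_nonneg_left hs2 hc
    have h3 := mul_le_mul_of_nonneg_left ht2 hd
    linarith

theorem tame_fibre (h : IsShortestCurve X A B a b γ) (p : Plane) :
    Tame {t | t ∈ Icc a b ∧ γ t = p} :=
  tame_of_ordConnected (h.ordConnected_fibre p)

/-- By constancy of signs on `I`, if one point of the piece violates a half plane, then all its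
points do, and the curve never visits it. Otherwise the piece is convex and visited during one
interval, or it is strictly concave. In the latter case either an opposite half plane has the same
graph and sees the piece as convex, or only the ends `A` and `B` of the curve can lie on it. -/
theorem tame_graphPt_image {k : ℕ} {f : Fin k → ℝ[X]} {θ : Fin k → ℝ}
    (h : IsShortestCurve (⋂ i, halfPlane (f i) (θ i)) A B a b γ) (i : Fin k) {I : Set ℝ}
    (hI : I.OrdConnected)
    (hf : (∀ u, (f i).derivative.derivative.eval u = 0) ∨
      ∀ u ∈ I, (f i).derivative.derivative.eval u ≠ 0)
    (hj : ∀ j, (∀ u, side (f j) (θ j) (graphPt (f i) (θ i) u) = 0) ∨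
      ∀ u ∈ I, side (f j) (θ j) (graphPt (f i) (θ i) u) ≠ 0) :
    Tame {t | t ∈ Icc a b ∧ γ t ∈ graphPt (f i) (θ i) '' I} := by
  by_cases hX : ∀ u ∈ I, graphPt (f i) (θ i) u ∈ ⋂ i, halfPlane (f i) (θ i)
  swap
  · push Not at hX
    obtain ⟨u, hu, huX⟩ := hX
    simp only [mem_iInter, not_forall, mem_halfPlane, not_le] at huX
    obtain ⟨j, hju⟩ := huX
    have hneg : ∀ v ∈ I, side (f j) (θ j) (graphPt (f i) (θ i) v) < 0 := by
      rcases hj j with h0 | h0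
      · exact absurd (h0 u) hju.ne
      · rcases forall_pos_or_neg_of_ne_zero hI
          (isPoly_side_graphPt (f i) (f j) (θ i) (θ j)).continuous.continuousOn h0 with h1 | h1
        · exact absurd (h1 u hu) hju.not_gt
        · exact h1
    convert tame_empty
    ext t
    simp only [mem_ofPred_eq, mem_empty_iff_false, iff_false]
    rintro ⟨ht, v, hv, hvt⟩
    have h1 := mem_iInter.1 (h.1.mapsTo ht) j
    rw [← hvt, mem_halfPlane] at h1
    exact absurd h1 (hneg v hv).not_ge
  have hconv : (∀ u ∈ I, 0 ≤ (f i).derivative.derivative.eval u) →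
      Tame {t | t ∈ Icc a b ∧ γ t ∈ graphPt (f i) (θ i) '' I} := fun h0 =>
    tame_of_ordConnected (h.ordConnected_convexArc (iInter_subset _ i) hI (convexOn_eval hI h0) hX)
  rcases hf with hf | hf
  · exact hconv fun u _ => (hf u).ge
  rcases forall_pos_or_neg_of_ne_zero hI
    (f i).derivative.derivative.continuous.continuousOn hf with hf | hf
  · exact hconv fun u hu => (hf u hu).le
  rcases I.eq_empty_or_nonempty with rfl | ⟨u₀, hu₀⟩
  · simpa using tame_empty
  have hf0 : (f i).derivative.derivative ≠ 0 := fun e => by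
    have := hf u₀ hu₀
    rw [e, eval_zero] at this
    exact lt_irrefl _ this
  by_cases hopp : ∃ j, (∀ u, graphPt (f i) (θ i) u = graphPt (f j) (θ j) (-u)) ∧
      ∀ u, (f j).derivative.derivative.eval (-u) = -(f i).derivative.derivative.eval u
  · obtain ⟨j, hj1, hj2⟩ := hopp
    have hI' : (Neg.neg '' I).OrdConnected := by
      refine ⟨?_⟩
      rintro _ ⟨u, hu, rfl⟩ _ ⟨v, hv, rfl⟩ w hw
      exact ⟨-w, hI.out hv hu ⟨by linarith [hw.2], by linarith [hw.1]⟩, neg_neg w⟩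
    have himg : graphPt (f i) (θ i) '' I = graphPt (f j) (θ j) '' (Neg.neg '' I) := by
      rw [image_image]
      exact image_congr fun u _ => hj1 u
    rw [himg]
    refine tame_of_ordConnected (h.ordConnected_convexArc (iInter_subset _ j) hI'
      (convexOn_eval hI' ?_) ?_)
    · rintro _ ⟨u, hu, rfl⟩
      rw [hj2]
      exact neg_nonneg.2 (hf u hu).le
    · rintro _ ⟨u, hu, rfl⟩
      rw [← hj1]
      exact hX u hu
  · have hends : ∀ t ∈ Icc a b, γ t ∈ graphPt (f i) (θ i) '' I → γ t = A ∨ γ t = B := by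
      rintro t ht ⟨u, hu, hut⟩
      refine h.eq_end_of_strictConcave (hf u hu) (fun j => ?_) ht hut.symm
      rcases hj j with h0 | h0
      · rcases halfPlane_eq_or_opposite hf0 h0 with h1 | h1
        · exact Or.inl h1
        · exact absurd ⟨j, h1⟩ hopp
      · exact Or.inr (lt_of_le_of_ne (mem_iInter.1 (hX u hu) j) (h0 u hu).symm)
    have key : ∀ p, Tame {t | t ∈ Icc a b ∧ γ t = p ∧ p ∈ graphPt (f i) (θ i) '' I} := by
      intro p
      by_cases hp : p ∈ graphPt (f i) (θ i) '' I
      · simpa [hp] using h.tame_fibre p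
      · simpa [hp] using tame_empty
    convert (key A).union (key B) using 1
    ext t
    simp only [mem_ofPred_eq, mem_union]
    constructor
    · rintro ⟨ht, hI⟩
      rcases hends t ht hI with h1 | h1
      · exact Or.inl ⟨ht, h1, h1 ▸ hI⟩
      · exact Or.inr ⟨ht, h1, h1 ▸ hI⟩
    · rintro (⟨ht, h1, h2⟩ | ⟨ht, h1, h2⟩)
      · exact ⟨ht, h1 ▸ h2⟩
      · exact ⟨ht, h1 ▸ h2⟩

/-- The graph is cut at the finite set `R` of zeros of `f''` and of the `side` functions that do not
vanish identically on it. Points over `R` are visited during intervals, and the rest is covered by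
`tame_graphPt_image`. -/
theorem tame_boundary {k : ℕ} {f : Fin k → ℝ[X]} {θ : Fin k → ℝ}
    (h : IsShortestCurve (⋂ i, halfPlane (f i) (θ i)) A B a b γ) (i : Fin k) :
    Tame {t | t ∈ Icc a b ∧ side (f i) (θ i) (γ t) = 0} := by
  obtain ⟨R, hR, hR'⟩ := exists_finite_zeros
    (h := fun (o : Option (Fin k)) => o.elim (fun u => (f i).derivative.derivative.eval u)
      fun j u => side (f j) (θ j) (graphPt (f i) (θ i) u)) (by
      rintro (_ | j)
      · exact ⟨_, fun u => rfl⟩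
      · exact isPoly_side_graphPt _ _ _ _)
  obtain ⟨F, hF, hF', hFR⟩ := (tame_of_finite hR).compl
  have h1 : Tame (⋃ u ∈ R, {t | t ∈ Icc a b ∧ γ t = graphPt (f i) (θ i) u}) :=
    Tame.biUnion hR fun u _ => h.tame_fibre _
  have h2 : Tame (⋃ I ∈ F, {t | t ∈ Icc a b ∧ γ t ∈ graphPt (f i) (θ i) '' I}) := by
    refine Tame.biUnion hF fun I hI => ?_
    have hIR : ∀ u ∈ I, u ∉ R := fun u hu => hFR.subset (subset_sUnion_of_mem hI hu)
    refine h.tame_graphPt_image i (hF' I hI) ?_ fun j => ?_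
    · exact (hR' none).imp id fun h0 u hu => h0 u (hIR u hu)
    · exact (hR' (some j)).imp id fun h0 u hu => h0 u (hIR u hu)
  convert h1.union h2 using 1
  ext t
  simp only [mem_ofPred_eq, mem_union, mem_iUnion, exists_prop]
  constructor
  · rintro ⟨ht, h0⟩
    have h0 := (side_eq_zero_iff.1 h0).symm
    by_cases hu : (frame (θ i) (γ t)).1 ∈ R
    · exact Or.inl ⟨_, hu, ht, h0⟩
    · obtain ⟨I, hI, huI⟩ := hFR.superset hu
      exact Or.inr ⟨I, hI, ht, _, huI, h0.symm⟩
  · rintro (⟨u, -, ht, h0⟩ | ⟨I, -, ht, u, -, h0⟩)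
    · exact ⟨ht, by rw [h0, side_graphPt]⟩
    · exact ⟨ht, by rw [← h0, side_graphPt]⟩

/-- During `T` the curve stays on the image of `c`, where the equation holds everywhere or at
finitely many points; each such point is visited during an interval. -/
theorem tame_zero_of_isPoly (h : IsShortestCurve X A B a b γ) {g : ℝ[X]} {φ : ℝ} {c : ℝ → Plane}
    (hc : IsPoly fun s => side g φ (c s)) {T : Set ℝ} (hT : Tame T) (hTab : T ⊆ Icc a b)
    (hTc : ∀ t ∈ T, ∃ s, c s = γ t) : Tame (T ∩ {t | side g φ (γ t) = 0}) := by
  rcases hc.zero_or_finite with h0 | h0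
  · convert hT using 1
    refine inter_eq_left.2 fun t ht => ?_
    obtain ⟨s, hs⟩ := hTc t ht
    rw [mem_ofPred_eq, ← hs]
    exact h0 s
  · convert hT.inter (Tame.biUnion h0 fun s _ => h.tame_fibre (c s)) using 1
    ext t
    simp only [mem_inter_iff, mem_ofPred_eq, mem_iUnion, exists_prop]
    constructor
    · rintro ⟨ht, hz⟩
      obtain ⟨s, hs⟩ := hTc t ht
      exact ⟨ht, s, by rw [hs]; exact hz, hTab ht, hs.symm⟩
    · rintro ⟨ht, s, hz, -, hs⟩
      exact ⟨ht, by rw [hs]; exact hz⟩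

/-- Here `g` need not be one of the defining polynomials. The times on a boundary graph are
parametrized by this graph; the other times form finitely many intervals, during each of which the
curve runs along a line or rests. -/
theorem tame_zero {k : ℕ} {f : Fin k → ℝ[X]} {θ : Fin k → ℝ}
    (h : IsShortestCurve (⋂ i, halfPlane (f i) (θ i)) A B a b γ) (g : ℝ[X]) (φ : ℝ) :
    Tame {t | t ∈ Icc a b ∧ side g φ (γ t) = 0} := by
  set T : Fin k → Set ℝ := fun i => {t | t ∈ Icc a b ∧ side (f i) (θ i) (γ t) = 0} with hT
  have hTt : ∀ i, Tame (T i) := h.tame_boundary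
  obtain ⟨F, hF, hF', hFW⟩ := (tame_of_ordConnected ordConnected_Icc : Tame (Icc a b)).diff
    (Tame.iUnion hTt)
  have h1 : Tame (⋃ i, T i ∩ {t | side g φ (γ t) = 0}) := Tame.iUnion fun i =>
    h.tame_zero_of_isPoly (isPoly_side_graphPt (f i) g (θ i) φ) (hTt i) (fun t ht => ht.1)
      fun t ht => ⟨_, side_eq_zero_iff.1 ht.2⟩
  have h2 : Tame (⋃ J ∈ F, J ∩ {t | side g φ (γ t) = 0}) := by
    refine Tame.biUnion hF fun J hJ => ?_
    have hJW : J ⊆ Icc a b \ ⋃ i, T i := hFW ▸ subset_sUnion_of_mem hJ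
    have hJo := hF' J hJ
    by_cases hconst : ∃ t₁ ∈ J, ∃ t₂ ∈ J, t₁ ≤ t₂ ∧ γ t₁ ≠ γ t₂
    · obtain ⟨t₁, ht₁, t₂, ht₂, h12, hne⟩ := hconst
      refine h.tame_zero_of_isPoly (isPoly_side_lineMap g φ (γ t₁) (γ t₂))
        (tame_of_ordConnected hJo) (fun t ht => (hJW ht).1) fun t ht => ?_
      rw [← mem_affineSpan_pair_iff_exists_lineMap_eq]
      have hU : IsOpen {p | ∀ i, 0 < side (f i) (θ i) p} := by
        simp only [ofPred_forall]
        exact isOpen_iInter_of_finite fun i =>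
          isOpen_lt continuous_const (continuous_side (f i) (θ i))
      have hw : ∀ u ∈ J, ∀ v ∈ J, ∀ w ∈ Icc u v, Wbtw ℝ (γ u) (γ w) (γ v) := by
        intro u hu v hv w hw
        refine h.wbtw_of_isOpen hU ?_ (hJW hu).1.1 (hJW hv).1.2 ?_ v
          (right_mem_Icc.2 (hw.1.trans hw.2)) w hw
        · exact fun p hp => mem_iInter.2 fun i => (hp i).le
        · intro x hx i
          have hxJ := hJW (hJo.out hu hv hx)
          refine lt_of_le_of_ne (mem_iInter.1 (h.1.mapsTo hxJ.1) i) fun e => hxJ.2 ?_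
          exact mem_iUnion.2 ⟨i, hxJ.1, e.symm⟩
      rcases le_total t t₁ with h3 | h3
      · rw [pair_comm]
        exact (hw t ht t₂ ht₂ t₁ ⟨h3, h12⟩).left_mem_affineSpan_of_right_ne hne.symm
      · rcases le_total t t₂ with h4 | h4
        · exact (hw t₁ ht₁ t₂ ht₂ t ⟨h3, h4⟩).mem_affineSpan
        · exact (hw t₁ ht₁ t ht t₂ ⟨h12, h4⟩).right_mem_affineSpan_of_left_ne hne
    · push Not at hconst
      rcases J.eq_empty_or_nonempty with rfl | ⟨t₀, ht₀⟩
      · simpa using tame_empty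
      refine h.tame_zero_of_isPoly (c := fun _ => γ t₀) (IsPoly.const _)
        (tame_of_ordConnected hJo) (fun t ht => (hJW ht).1) fun t ht => ⟨0, ?_⟩
      rcases le_total t t₀ with h3 | h3
      · exact (hconst t ht t₀ ht₀ h3).symm
      · exact hconst t₀ ht₀ t ht h3
  convert h1.union h2 using 1
  ext t
  simp only [mem_ofPred_eq, mem_union, mem_iUnion, mem_inter_iff, exists_prop]
  constructor
  · rintro ⟨ht, h0⟩
    by_cases hti : ∃ i, t ∈ T i
    · obtain ⟨i, hi⟩ := hti
      exact Or.inl ⟨i, hi, h0⟩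
    · obtain ⟨J, hJ, htJ⟩ := hFW.superset ⟨ht, by simpa using hti⟩
      exact Or.inr ⟨J, hJ, htJ, h0⟩
  · rintro (⟨i, hi, h0⟩ | ⟨J, hJ, htJ, h0⟩)
    · exact ⟨hi.1, h0⟩
    · exact ⟨(hFW.subset (mem_sUnion_of_mem htJ hJ)).1, h0⟩

/-- The sign of `side g φ` is constant on every interval of times that avoids its zeros. -/
theorem tame_pos {k : ℕ} {f : Fin k → ℝ[X]} {θ : Fin k → ℝ}
    (h : IsShortestCurve (⋂ i, halfPlane (f i) (θ i)) A B a b γ) (g : ℝ[X]) (φ : ℝ) :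
    Tame {t | t ∈ Icc a b ∧ 0 < side g φ (γ t)} := by
  refine ((tame_of_ordConnected ordConnected_Icc : Tame (Icc a b)).diff
    (h.tame_zero g φ)).of_components ?_ ?_
  · exact fun t ht => ⟨ht.1, fun h0 => ht.2.ne' h0.2⟩
  · rintro I hI hIT ⟨t, htI, ht⟩
    have hc : ContinuousOn (fun t => side g φ (γ t)) I :=
      (continuous_side g φ).comp_continuousOn (h.1.continuousOn.mono fun s hs => (hIT hs).1)
    rcases forall_pos_or_neg_of_ne_zero hI hc
      (fun s hs h0 => (hIT hs).2 ⟨(hIT hs).1, h0⟩) with h1 | h1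
    · exact fun s hs => ⟨(hIT hs).1, h1 s hs⟩
    · exact absurd ht.2 (h1 t htI).not_gt

/-- The times which a shortest curve spends on an arc form a finite union of intervals. -/
theorem tame_arc {k : ℕ} {f : Fin k → ℝ[X]} {θ : Fin k → ℝ}
    (h : IsShortestCurve (⋂ i, halfPlane (f i) (θ i)) A B a b γ) (E : Arc) :
    Tame {t | t ∈ Icc a b ∧ γ t ∈ E.carrier} := by
  have hs : ∀ c p, side (C (-c)) (E.ang + Real.pi / 2) p = (frame E.ang p).1 - c := fun c p => by
    rw [side, frame_add_pi_div_two, eval_C]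
    ring
  have h1 := (h.tame_pos (C (-E.lo)) (E.ang + Real.pi / 2)).union
    (h.tame_zero (C (-E.lo)) (E.ang + Real.pi / 2))
  have h2 := (h.tame_pos (C (-E.hi)) (E.ang + Real.pi / 2)).compl
  convert (h1.inter h2).inter (h.tame_zero E.poly E.ang) using 1
  ext t
  simp only [Arc.mem_carrier, mem_inter_iff, mem_union, mem_compl_iff, mem_ofPred_eq, hs, sub_pos,
    sub_eq_zero, not_and, not_lt]
  constructor
  · rintro ⟨ht, h3, h4, h5⟩
    refine ⟨⟨?_, fun _ => h4⟩, ht, h5⟩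
    rcases h3.eq_or_lt with h6 | h6
    · exact Or.inr ⟨ht, h6.symm⟩
    · exact Or.inl ⟨ht, h6⟩
  · rintro ⟨⟨h3, h4⟩, ht, h5⟩
    refine ⟨ht, ?_, h4 ht, h5⟩
    rcases h3 with h3 | h3
    · exact h3.2.le
    · exact h3.2.ge

end IsShortestCurve


/-! ### Cell decompositions of the plane -/

/-- `e` is an open cell of dimension `n` whose boundary is contained in `K`. -/
def HasCharMap (n : ℕ) (K e : Set Plane) : Prop :=
  ∃ φ : PartialEquiv (Fin n → ℝ) Plane, φ.source = Metric.ball 0 1 ∧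
    ContinuousOn φ (Metric.closedBall 0 1) ∧ ContinuousOn φ.symm φ.target ∧
    φ '' Metric.ball 0 1 = e ∧ MapsTo φ (Metric.sphere 0 1) K

theorem HasCharMap.isPreconnected {n : ℕ} {K e : Set Plane} (h : HasCharMap n K e) :
    IsPreconnected e := by
  obtain ⟨φ, -, hc, -, rfl, -⟩ := h
  exact (convex_ball _ _).isPreconnected.image _ (hc.mono Metric.ball_subset_closedBall)

theorem HasCharMap.nonempty {n : ℕ} {K e : Set Plane} (h : HasCharMap n K e) : e.Nonempty := by
  obtain ⟨φ, -, -, -, rfl, -⟩ := h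
  exact ⟨_, mem_image_of_mem _ (Metric.mem_ball_self one_pos)⟩

/-- The image of the closed ball is compact, hence closed, and it adds to `e` only the image of the
sphere. -/
theorem HasCharMap.closure_subset {n : ℕ} {K e : Set Plane} (h : HasCharMap n K e) :
    closure e ⊆ e ∪ K := by
  obtain ⟨φ, -, hc, -, rfl, hK⟩ := h
  refine (closure_mono (image_mono Metric.ball_subset_closedBall)).trans ?_
  rw [((isCompact_closedBall _ _).image_of_continuousOn hc).isClosed.closure_eq,
    ← Metric.ball_union_sphere, image_union]
  exact union_subset_union_right _ hK.image_subset

/-- `e` is an open `n`-cell of the difference `L \ K`, attached to `K`. -/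
structure IsCell (n : ℕ) (K L e : Set Plane) : Prop where
  hasCharMap : HasCharMap n K e
  subset : e ⊆ L \ K
  isOpen : ∃ O, IsOpen O ∧ O ∩ (L \ K) = e

/-- The cell is open in `L \ K` by `isOpen`, and closed there because `closure e ⊆ e ∪ K`. -/
theorem IsCell.subset_of_isPreconnected {n : ℕ} {K L e s : Set Plane} (h : IsCell n K L e)
    (hs : IsPreconnected s) (hsL : s ⊆ L \ K) (hse : (s ∩ e).Nonempty) : s ⊆ e := by
  obtain ⟨O, hO, hOe⟩ := h.isOpen
  have hcl := h.hasCharMap.closure_subset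
  have hmem : ∀ x ∈ s, x ∈ O → x ∈ e := fun x hx hxO => hOe.subset ⟨hxO, hsL hx⟩
  have hcle : ∀ x ∈ s, x ∈ closure e → x ∈ e := fun x hx hxe =>
    (hcl hxe).resolve_right (hsL hx).2
  have hcov : s ⊆ O ∪ (closure e)ᶜ := fun x hx => by
    by_cases hxe : x ∈ closure e
    · exact Or.inl (hOe.superset (hcle x hx hxe)).1
    · exact Or.inr hxe
  have hdisj : s ∩ (O ∩ (closure e)ᶜ) = ∅ := by
    ext x
    simp only [mem_inter_iff, mem_compl_iff, mem_empty_iff_false, iff_false]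
    rintro ⟨hx, hxO, hxe⟩
    exact hxe (subset_closure (hmem x hx hxO))
  rcases isPreconnected_iff_subset_of_disjoint.1 hs O (closure e)ᶜ hO
    isClosed_closure.isOpen_compl hcov hdisj with h1 | h1
  · exact fun x hx => hmem x hx (h1 hx)
  · obtain ⟨x, hx, hxe⟩ := hse
    exact absurd (subset_closure hxe) (h1 hx)

/-- A filtration of the plane by skeleta, with a locally finite set of cells; `skel n` is the union
of the cells of dimension less than `n`. -/
structure PlaneDecomposition where
  skel : ℕ → Set Plane
  skel_zero : skel 0 = ∅
  skel_three : skel 3 = univ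
  skel_mono : Monotone skel
  exists_cover : ∀ n < 3, ∀ R : ℝ, ∃ F : Set (Set Plane), F.Finite ∧
    (∀ e ∈ F, IsCell n (skel n) (skel (n + 1)) e) ∧
      ∀ p ∈ skel (n + 1) \ skel n, ‖p‖ ≤ R → ∃ e ∈ F, p ∈ e

namespace PlaneDecomposition

variable (D : PlaneDecomposition)

/-- The open cells of dimension `n`. -/
def cells (n : ℕ) : Set (Set Plane) := {e | n < 3 ∧ IsCell n (D.skel n) (D.skel (n + 1)) e}

variable {D} in
theorem subset_skel {n : ℕ} {e : Set Plane} (he : e ∈ D.cells n) :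
    e ⊆ D.skel (n + 1) \ D.skel n :=
  he.2.subset

/-- The filtration determines the dimension. Cells of equal dimension are connected and relatively
open and closed, so they coincide once they meet. -/
theorem eq_of_mem {n m : ℕ} {e e' : Set Plane} (he : e ∈ D.cells n) (he' : e' ∈ D.cells m)
    {p : Plane} (hp : p ∈ e) (hp' : p ∈ e') : n = m ∧ e = e' := by
  have key : ∀ {n m : ℕ} {e e' : Set Plane}, e ∈ D.cells n → e' ∈ D.cells m → p ∈ e → p ∈ e' →
      n ≤ m := by
    intro n m e e' he he' hp hp'
    by_contra! h
    exact (subset_skel he hp).2 (D.skel_mono h (subset_skel he' hp').1)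
  obtain rfl := le_antisymm (key he he' hp hp') (key he' he hp' hp)
  refine ⟨rfl, Subset.antisymm ?_ ?_⟩
  · exact he'.2.subset_of_isPreconnected he.2.hasCharMap.isPreconnected he.2.subset ⟨p, hp, hp'⟩
  · exact he.2.subset_of_isPreconnected he'.2.hasCharMap.isPreconnected he'.2.subset ⟨p, hp', hp⟩

theorem finite_cells (n : ℕ) (R : ℝ) :
    {e ∈ D.cells n | (e ∩ Metric.closedBall 0 R).Nonempty}.Finite := by
  rcases lt_or_ge n 3 with hn | hn
  · obtain ⟨F, hF, hF', hcov⟩ := D.exists_cover n hn R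
    refine hF.subset ?_
    rintro e ⟨he, p, hpe, hpR⟩
    obtain ⟨e', he', hpe'⟩ := hcov p (subset_skel he hpe) (mem_closedBall_zero_iff.1 hpR)
    rwa [(D.eq_of_mem he ⟨hn, hF' e' he'⟩ hpe hpe').2]
  · exact finite_empty.subset fun e he => absurd he.1.1 hn.not_gt

theorem exists_mem_of_mem_skel {n : ℕ} {p : Plane} (hp : p ∈ D.skel n) :
    ∃ m < n, ∃ e ∈ D.cells m, p ∈ e := by
  induction n with
  | zero =>
    rw [D.skel_zero] at hp
    exact hp.elim
  | succ n ih =>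
    by_cases hpn : p ∈ D.skel n
    · obtain ⟨m, hm, h⟩ := ih hpn
      exact ⟨m, hm.trans n.lt_succ_self, h⟩
    · rcases lt_or_ge n 3 with hn | hn
      · obtain ⟨F, -, hF', hcov⟩ := D.exists_cover n hn ‖p‖
        obtain ⟨e, he, hpe⟩ := hcov p ⟨hp, hpn⟩ le_rfl
        exact ⟨n, n.lt_succ_self, e, ⟨hn, hF' e he⟩, hpe⟩
      · exact absurd (D.skel_mono hn (D.skel_three ▸ mem_univ p)) hpn

/-- A closed union of cells is a CW complex. -/
theorem exists_cwComplex {X : Set Plane} (hX : IsClosed X)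
    (hD : ∀ n, ∀ e ∈ D.cells n, (e ∩ X).Nonempty → e ⊆ X) :
    ∃ _ : Topology.CWComplex X, ∀ (n : ℕ) (c : Topology.RelCWComplex.cell X n),
      Topology.RelCWComplex.openCell n c ∈ D.cells n ∧
        Topology.RelCWComplex.openCell n c ⊆ X := by
  let Cell : ℕ → Type := fun n => {e : Set Plane // e ∈ D.cells n ∧ e ⊆ X}
  choose φ hφs hφc hφc' hφe hφK using fun n (e : Cell n) => e.2.1.2.hasCharMap
  have hclosed : ∀ n (e : Cell n), φ n e '' Metric.closedBall 0 1 ⊆ X := by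
    intro n e
    have h1 : closure (Metric.ball (0 : Fin n → ℝ) 1) = Metric.closedBall 0 1 :=
      closure_ball _ one_ne_zero
    have h2 : ContinuousOn (φ n e) (closure (Metric.ball (0 : Fin n → ℝ) 1)) := by
      rw [h1]
      exact hφc n e
    rw [← h1]
    refine h2.image_closure.trans (closure_minimal ?_ hX)
    rw [hφe]
    exact e.2.2
  have hcompact : ∀ n (e : Cell n), IsCompact (φ n e '' Metric.closedBall 0 1) := fun n e =>
    (isCompact_closedBall _ _).image_of_continuousOn (hφc n e)
  have hfin : ∀ n R, {e : Cell n | (e.1 ∩ Metric.closedBall 0 R).Nonempty}.Finite := fun n R =>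
    Set.Finite.of_finite_image ((D.finite_cells n R).subset (by
      rintro _ ⟨e, he, rfl⟩
      exact ⟨e.2.1, he⟩)) Subtype.val_injective.injOn
  have hcov : ∀ p ∈ X, ∀ n, p ∈ D.skel n → ∃ m < n, ∃ e : Cell m, p ∈ e.1 := by
    intro p hp n hpn
    obtain ⟨m, hm, e, he, hpe⟩ := D.exists_mem_of_mem_skel hpn
    exact ⟨m, hm, ⟨e, he, hD m e he ⟨p, hpe, hp⟩⟩, hpe⟩
  have hsub : ∀ n (e : Cell n), e.1 ⊆ φ n e '' Metric.closedBall 0 1 := fun n e => by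
    conv_lhs => rw [← hφe n e]
    exact image_mono Metric.ball_subset_closedBall
  let inst : Topology.CWComplex X :=
    { cell := Cell
      map := φ
      source_eq := hφs
      continuousOn := hφc
      continuousOn_symm := hφc'
      pairwiseDisjoint' := by
        rintro ⟨n, e⟩ - ⟨m, e'⟩ - hne
        refine Set.disjoint_left.2 fun p hp hp' => hne ?_
        beta_reduce at hp hp'
        rw [hφe] at hp hp'
        obtain ⟨rfl, h⟩ := D.eq_of_mem e.2.1 e'.2.1 hp hp'
        rw [Subtype.ext h]
      mapsTo' := by
        intro n e
        -- The image of the closed ball is bounded, so it meets finitely many cells of each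
        -- dimension; the image of the sphere lies in `skel n`, whose cells have dimension less than
        -- `n`.
        obtain ⟨R, hR⟩ := (hcompact n e).isBounded.subset_closedBall 0
        refine ⟨fun m => (hfin m R).toFinset, fun x hx => ?_⟩
        have hx' : φ n e x ∈ φ n e '' Metric.closedBall 0 1 :=
          mem_image_of_mem _ (Metric.sphere_subset_closedBall hx)
        obtain ⟨m, hm, e', he'⟩ := hcov _ (hclosed n e hx') n (hφK n e hx)
        simp only [mem_iUnion]
        refine ⟨m, hm, e', ?_, hsub m e' he'⟩
        rw [Set.Finite.mem_toFinset]
        exact ⟨_, he', hR hx'⟩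
      closed' := by
        intro A hA hcl
        -- Only finitely many cells meet a given ball, so `A` is closed in every ball, and
        -- closedness is a local property.
        have hcc : ∀ R : ℝ, IsClosed (A ∩ Metric.closedBall 0 R) := by
          intro R
          have : A ∩ Metric.closedBall 0 R = (⋃ n : Fin 3, ⋃ e ∈ {e : Cell n |
              (e.1 ∩ Metric.closedBall 0 R).Nonempty}, A ∩ φ n e '' Metric.closedBall 0 1) ∩
                Metric.closedBall 0 R := by
            ext p
            simp only [mem_inter_iff, mem_iUnion, exists_prop]
            constructor
            · rintro ⟨hpA, hpR⟩
              obtain ⟨m, hm, e, he⟩ := hcov p (hA hpA) 3 (D.skel_three ▸ mem_univ p)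
              exact ⟨⟨⟨m, hm⟩, e, ⟨p, he, hpR⟩, hpA, hsub m e he⟩, hpR⟩
            · rintro ⟨⟨n, e, -, hpA, -⟩, hpR⟩
              exact ⟨hpA, hpR⟩
          rw [this]
          refine IsClosed.inter (isClosed_iUnion_of_finite fun n => ?_) Metric.isClosed_closedBall
          exact (hfin n R).isClosed_biUnion fun e _ => hcl n e
        refine isClosed_of_closure_subset fun p hp => ?_
        have h1 : p ∈ closure (A ∩ Metric.closedBall 0 (‖p‖ + 1)) := by
          rw [mem_closure_iff_nhds] at hp ⊢
          intro U hU
          obtain ⟨q, hq, hqA⟩ := hp _ (Filter.inter_mem hU (Metric.closedBall_mem_nhds p one_pos))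
          refine ⟨q, hq.1, hqA, ?_⟩
          have h2 := hq.2
          rw [Metric.mem_closedBall, dist_eq_norm] at h2
          rw [mem_closedBall_zero_iff]
          calc ‖q‖ = ‖p + (q - p)‖ := by rw [add_sub_cancel]
            _ ≤ ‖p‖ + ‖q - p‖ := norm_add_le _ _
            _ ≤ ‖p‖ + 1 := by linarith
        rw [(hcc _).closure_eq] at h1
        exact h1.1
      union' := by
        apply Subset.antisymm
        · exact iUnion_subset fun n => iUnion_subset fun e => hclosed n e
        · intro p hp
          obtain ⟨m, -, e, he⟩ := hcov p hp 3 (D.skel_three ▸ mem_univ p)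
          exact mem_iUnion.2 ⟨m, mem_iUnion.2 ⟨e, hsub m e he⟩⟩ }
  refine ⟨inst, fun n c => ?_⟩
  have : Topology.RelCWComplex.openCell n c = (c : Cell n).1 := hφe n c
  rw [this]
  exact (c : Cell n).2

end PlaneDecomposition


/-! ### Locally finite families of arcs -/

/-- Only finitely many arcs of the family meet each disc. -/
def LocFin (𝓐 : Set Arc) : Prop := ∀ R : ℝ, {A ∈ 𝓐 | ∃ p ∈ A.carrier, ‖p‖ ≤ R}.Finite

/-- The union of a family of arcs. -/
def support (𝓐 : Set Arc) : Set Plane := ⋃ A ∈ 𝓐, A.carrier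

/-- The ends of the arcs of a family and the points where two of them meet or part. -/
def vertices (𝓐 : Set Arc) : Set Plane :=
  ⋃ A ∈ 𝓐, ⋃ B ∈ 𝓐, A.pt '' frontier (A.onArc B)

variable {𝓐 : Set Arc}

theorem mem_support {p : Plane} : p ∈ support 𝓐 ↔ ∃ A ∈ 𝓐, p ∈ A.carrier := by simp [support]

theorem Arc.isClosed_onArc (A B : Arc) : IsClosed (A.onArc B) :=
  isClosed_Icc.inter (B.isClosed_carrier.preimage A.continuous_pt)

theorem Arc.onArc_self (A : Arc) : A.onArc A = Icc A.lo A.hi :=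
  Set.ext fun _ => ⟨fun h => h.1, fun h => ⟨h, mem_image_of_mem _ h⟩⟩

theorem mem_vertices {p : Plane} : p ∈ vertices 𝓐 ↔
    ∃ A ∈ 𝓐, ∃ B ∈ 𝓐, ∃ u ∈ frontier (A.onArc B), A.pt u = p := by
  simp [vertices]

theorem pt_mem_vertices {A B : Arc} (hA : A ∈ 𝓐) (hB : B ∈ 𝓐) {u : ℝ}
    (hu : u ∈ frontier (A.onArc B)) : A.pt u ∈ vertices 𝓐 :=
  mem_vertices.2 ⟨A, hA, B, hB, u, hu, rfl⟩

theorem vertices_subset : vertices 𝓐 ⊆ support 𝓐 := by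
  intro p hp
  obtain ⟨A, hA, B, -, u, hu, rfl⟩ := mem_vertices.1 hp
  exact mem_support.2 ⟨A, hA, mem_image_of_mem _ ((A.isClosed_onArc B).frontier_subset hu).1⟩

/-- A vertex in a disc arises from two arcs which both meet this disc. -/
theorem LocFin.finite_vertices (h : LocFin 𝓐) (R : ℝ) : {p ∈ vertices 𝓐 | ‖p‖ ≤ R}.Finite := by
  refine ((h R).biUnion fun A _ => (h R).biUnion fun B _ =>
    (A.finite_frontier_onArc B).image A.pt).subset ?_
  rintro p ⟨hp, hpR⟩
  obtain ⟨A, hA, B, hB, u, hu, rfl⟩ := mem_vertices.1 hp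
  have hm := (A.isClosed_onArc B).frontier_subset hu
  simp only [mem_iUnion]
  exact ⟨A, ⟨hA, _, mem_image_of_mem _ hm.1, hpR⟩, B, ⟨hB, _, hm.2, hpR⟩, mem_image_of_mem _ hu⟩

/-- At a common point that is not a vertex, `A` runs along `B` on both sides of the point. Every
local statement away from the vertices rests on this. -/
theorem mem_interior_onArc {A B : Arc} (hA : A ∈ 𝓐) (hB : B ∈ 𝓐) {p : Plane}
    (hpA : p ∈ A.carrier) (hpB : p ∈ B.carrier) (hp : p ∉ vertices 𝓐) :
    (frame A.ang p).1 ∈ interior (A.onArc B) := by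
  obtain ⟨u, hu, rfl⟩ := hpA
  rw [A.frame_pt]
  by_contra hint
  exact hp (pt_mem_vertices hA hB ⟨subset_closure ⟨hu, hpB⟩, hint⟩)

theorem frame_mem_Ioo {A : Arc} (hA : A ∈ 𝓐) {p : Plane} (hpA : p ∈ A.carrier)
    (hp : p ∉ vertices 𝓐) : (frame A.ang p).1 ∈ Ioo A.lo A.hi := by
  have := mem_interior_onArc hA hA hpA hpA hp
  rwa [A.onArc_self, interior_Icc] at this

theorem LocFin.eventually (h : LocFin 𝓐) {P : Arc → Plane → Prop} {q : Plane}
    (hP : ∀ B ∈ 𝓐, ∀ᶠ p in nhds q, p ∈ B.carrier → P B p) :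
    ∀ᶠ p in nhds q, ∀ B ∈ 𝓐, p ∈ B.carrier → P B p := by
  have h1 := (Filter.eventually_all_finite (h (‖q‖ + 1))).2 fun B hB => hP B hB.1
  have h2 : ∀ᶠ p in nhds q, ‖p‖ < ‖q‖ + 1 :=
    continuous_norm.continuousAt.eventually_mem (gt_mem_nhds (lt_add_one ‖q‖))
  filter_upwards [h1, h2] with p hp1 hp2 B hB hpB
  exact hp1 B ⟨hB, p, hpB, hp2.le⟩ hpB

/-- Away from the vertices, a family of arcs looks locally like each of its arcs. -/
theorem LocFin.eventually_mem_carrier (h : LocFin 𝓐) {A : Arc} (hA : A ∈ 𝓐) {q : Plane}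
    (hqA : q ∈ A.carrier) (hq : q ∉ vertices 𝓐) :
    ∀ᶠ p in nhds q, p ∈ support 𝓐 → p ∈ A.carrier := by
  have := h.eventually (P := fun _ p => p ∈ A.carrier) (q := q) fun B hB => by
    by_cases hqB : q ∈ B.carrier
    · filter_upwards [(continuous_frame B.ang).fst.continuousAt.eventually_mem
        (isOpen_interior.mem_nhds (mem_interior_onArc hB hA hqB hqA hq))] with p hp hpB
      have h1 := (interior_subset hp).2
      have h2 : B.pt (frame B.ang p).1 = p := side_eq_zero_iff.1 (Arc.mem_carrier.1 hpB).2.2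
      rwa [h2] at h1
    · filter_upwards [B.isClosed_carrier.isOpen_compl.mem_nhds hqB] with p hp hpB
      exact absurd hpB hp
  filter_upwards [this] with p hp hps
  obtain ⟨B, hB, hpB⟩ := mem_support.1 hps
  exact hp B hB hpB

/-- A connected set without vertices lies on an arc of the family or does not meet it. -/
theorem LocFin.subset_or_disjoint (h : LocFin 𝓐) {A : Arc} (hA : A ∈ 𝓐) {s : Set Plane}
    (hs : IsPreconnected s) (hsG : s ⊆ support 𝓐 \ vertices 𝓐) :
    s ⊆ A.carrier ∨ Disjoint s A.carrier := by
  have hcov : s ⊆ interior (A.carrier ∪ (support 𝓐)ᶜ) ∪ A.carrierᶜ := by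
    intro q hq
    by_cases hqA : q ∈ A.carrier
    · refine Or.inl (mem_interior_iff_mem_nhds.2 ?_)
      filter_upwards [h.eventually_mem_carrier hA hqA (hsG hq).2] with p hp
      by_cases hps : p ∈ support 𝓐
      exacts [Or.inl (hp hps), Or.inr hps]
    · exact Or.inr hqA
  have hdisj : s ∩ (interior (A.carrier ∪ (support 𝓐)ᶜ) ∩ A.carrierᶜ) = ∅ := by
    ext q
    simp only [mem_inter_iff, mem_empty_iff_false, iff_false]
    rintro ⟨hq, hq1, hq2⟩
    rcases interior_subset hq1 with h1 | h1
    exacts [hq2 h1, h1 (hsG hq).1]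
  rcases isPreconnected_iff_subset_of_disjoint.1 hs _ _ isOpen_interior
    A.isClosed_carrier.isOpen_compl hcov hdisj with h1 | h1
  · exact Or.inl fun q hq => (interior_subset (h1 hq)).resolve_right fun h2 => h2 (hsG hq).1
  · exact Or.inr (Set.disjoint_left.2 h1)

/-! ### Cells of dimension zero and one -/

theorem LocFin.isCell_vertex (h : LocFin 𝓐) {p : Plane} (hp : p ∈ vertices 𝓐) :
    IsCell 0 ∅ (vertices 𝓐) {p} where
  hasCharMap := by
    have hball : ∀ x : Fin 0 → ℝ, x ∈ Metric.ball (0 : Fin 0 → ℝ) 1 := fun x => by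
      rw [Subsingleton.elim x 0]
      exact Metric.mem_ball_self one_pos
    refine ⟨{ toFun := fun _ => p, invFun := fun _ => 0, source := Metric.ball 0 1, target := {p},
              map_source' := fun _ _ => rfl, map_target' := fun _ _ => hball 0,
              left_inv' := fun x _ => Subsingleton.elim _ _,
              right_inv' := fun q hq => (mem_singleton_iff.1 hq).symm }, rfl,
      continuousOn_const, continuousOn_const, ?_, ?_⟩
    · exact Set.Nonempty.image_const ⟨0, hball 0⟩ p
    · intro x hx
      rw [Subsingleton.elim x 0, mem_sphere_zero_iff_norm, norm_zero] at hx
      exact absurd hx zero_ne_one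
  subset := by simpa using hp
  isOpen := by
    set S : Set Plane := {q ∈ vertices 𝓐 | ‖q‖ ≤ ‖p‖ + 1} \ {p}
    have hS : S.Finite := (h.finite_vertices (‖p‖ + 1)).sdiff
    refine ⟨Sᶜ ∩ {q | ‖q‖ < ‖p‖ + 1}, hS.isClosed.isOpen_compl.inter
      (isOpen_lt continuous_norm continuous_const), ?_⟩
    ext q
    simp only [mem_inter_iff, mem_compl_iff, mem_ofPred_eq, sdiff_empty, mem_singleton_iff]
    constructor
    · rintro ⟨⟨hq, hq'⟩, hqV⟩
      by_contra hne
      exact hq ⟨⟨hqV, hq'.le⟩, hne⟩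
    · rintro rfl
      exact ⟨⟨fun h => h.2 rfl, lt_add_one _⟩, hp⟩

/-- Relative openness holds because near a point that is not a vertex the support of the whole
family is contained in `A`. -/
theorem LocFin.isCell_arc (h : LocFin 𝓐) {A : Arc} (hA : A ∈ 𝓐) {v w : ℝ} (hvw : v < w)
    (hv : A.lo ≤ v) (hw : w ≤ A.hi) (hvV : A.pt v ∈ vertices 𝓐) (hwV : A.pt w ∈ vertices 𝓐)
    (hV : ∀ u ∈ Ioo v w, A.pt u ∉ vertices 𝓐) :
    IsCell 1 (vertices 𝓐) (support 𝓐) (A.pt '' Ioo v w) where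
  hasCharMap := by
    have hpos : 0 < (w - v) / 2 := by linarith
    have hne : w - v ≠ 0 := by linarith
    have hball : ∀ x : Fin 1 → ℝ, x ∈ Metric.ball (0 : Fin 1 → ℝ) 1 ↔ |x 0| < 1 := fun x => by
      rw [mem_ball_zero_iff, pi_norm_lt_iff one_pos]
      simp [Fin.forall_fin_one]
    refine ⟨{ toFun := fun x => A.pt ((v + w) / 2 + (w - v) / 2 * x 0),
              invFun := fun p => fun _ => ((frame A.ang p).1 - (v + w) / 2) / ((w - v) / 2),
              source := Metric.ball 0 1, target := A.pt '' Ioo v w,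
              map_source' := ?_, map_target' := ?_, left_inv' := ?_, right_inv' := ?_ }, rfl,
      ?_, ?_, ?_, ?_⟩
    · intro x hx
      have := abs_lt.1 ((hball x).1 hx)
      exact mem_image_of_mem _ ⟨by nlinarith [this.1], by nlinarith [this.2]⟩
    · rintro _ ⟨u, hu, rfl⟩
      rw [hball, A.frame_pt, abs_lt, lt_div_iff₀ hpos, div_lt_iff₀ hpos]
      exact ⟨by linarith [hu.1], by linarith [hu.2]⟩
    · intro x hx
      ext i
      rw [Subsingleton.elim i 0]
      simp only [A.frame_pt]
      field_simp
      ring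
    · rintro _ ⟨u, hu, rfl⟩
      simp only [A.frame_pt]
      congr 1
      field_simp
      ring
    · exact (A.continuous_pt.comp (by fun_prop)).continuousOn
    · exact (continuous_pi fun _ =>
        ((continuous_frame A.ang).fst.sub continuous_const).div_const _).continuousOn
    · apply Subset.antisymm
      · rintro _ ⟨x, hx, rfl⟩
        have := abs_lt.1 ((hball x).1 hx)
        exact mem_image_of_mem _ ⟨by nlinarith [this.1], by nlinarith [this.2]⟩
      · rintro _ ⟨u, hu, rfl⟩
        refine ⟨fun _ => (u - (v + w) / 2) / ((w - v) / 2), ?_, ?_⟩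
        · rw [hball, abs_lt, lt_div_iff₀ hpos, div_lt_iff₀ hpos]
          exact ⟨by linarith [hu.1], by linarith [hu.2]⟩
        · change A.pt _ = _
          congr 1
          field_simp
          ring
    · intro x hx
      rw [mem_sphere_zero_iff_norm] at hx
      have h1 : |x 0| = 1 := by
        rw [← hx, Pi.norm_def]
        simp
      change A.pt _ ∈ _
      rcases eq_or_eq_neg_of_abs_eq h1 with h2 | h2
      · rw [h2]
        convert hwV using 2
        ring
      · rw [h2]
        convert hvV using 2
        ring
  subset := by
    rintro _ ⟨u, hu, rfl⟩
    exact ⟨mem_support.2 ⟨A, hA, mem_image_of_mem _ ⟨hv.trans hu.1.le, hu.2.le.trans hw⟩⟩, hV u hu⟩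
  isOpen := by
    refine ⟨interior (A.carrier ∪ (support 𝓐)ᶜ) ∩ {p | (frame A.ang p).1 ∈ Ioo v w},
      isOpen_interior.inter (isOpen_Ioo.preimage (continuous_frame A.ang).fst), ?_⟩
    ext p
    constructor
    · rintro ⟨⟨hp, hp'⟩, hpG, -⟩
      have hpA := (interior_subset hp).resolve_right fun h1 => h1 hpG
      exact ⟨_, hp', side_eq_zero_iff.1 (Arc.mem_carrier.1 hpA).2.2⟩
    · rintro ⟨u, hu, rfl⟩
      have hmem : A.pt u ∈ A.carrier := mem_image_of_mem _ ⟨hv.trans hu.1.le, hu.2.le.trans hw⟩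
      refine ⟨⟨mem_interior_iff_mem_nhds.2 ?_, ?_⟩, mem_support.2 ⟨A, hA, hmem⟩, hV u hu⟩
      · filter_upwards [h.eventually_mem_carrier hA hmem (hV u hu)] with q hq
        by_cases hqs : q ∈ support 𝓐
        exacts [Or.inl (hq hqs), Or.inr hqs]
      · rw [mem_ofPred_eq, A.frame_pt]
        exact hu

theorem LocFin.exists_cover_zero (h : LocFin 𝓐) (R : ℝ) : ∃ F : Set (Set Plane), F.Finite ∧
    (∀ e ∈ F, IsCell 0 ∅ (vertices 𝓐) e) ∧
      ∀ p ∈ vertices 𝓐 \ ∅, ‖p‖ ≤ R → ∃ e ∈ F, p ∈ e := by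
  refine ⟨singleton '' {p ∈ vertices 𝓐 | ‖p‖ ≤ R}, (h.finite_vertices R).image _, ?_, ?_⟩
  · rintro _ ⟨p, hp, rfl⟩
    exact h.isCell_vertex hp.1
  · exact fun p hp hpR => ⟨{p}, mem_image_of_mem _ ⟨hp.1, hpR⟩, rfl⟩

theorem LocFin.exists_cover_one (h : LocFin 𝓐) (R : ℝ) : ∃ F : Set (Set Plane), F.Finite ∧
    (∀ e ∈ F, IsCell 1 (vertices 𝓐) (support 𝓐) e) ∧
      ∀ p ∈ support 𝓐 \ vertices 𝓐, ‖p‖ ≤ R → ∃ e ∈ F, p ∈ e := by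
  set W : Arc → Set ℝ := fun A => {u | u ∈ Icc A.lo A.hi ∧ A.pt u ∈ vertices 𝓐} with hW
  have hWfin : ∀ A, (W A).Finite := by
    intro A
    obtain ⟨K, hK⟩ := A.isCompact_carrier.isBounded.exists_norm_le
    refine Set.Finite.of_finite_image ((h.finite_vertices K).subset ?_) A.pt_injective.injOn
    rintro _ ⟨u, hu, rfl⟩
    exact ⟨hu.2, hK _ (mem_image_of_mem _ hu.1)⟩
  refine ⟨⋃ A ∈ {A ∈ 𝓐 | ∃ p ∈ A.carrier, ‖p‖ ≤ R}, {e | ∃ v ∈ W A, ∃ w ∈ W A, v < w ∧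
      (∀ u ∈ Ioo v w, A.pt u ∉ vertices 𝓐) ∧ A.pt '' Ioo v w = e}, ?_, ?_, ?_⟩
  · refine (h R).biUnion fun A _ => ((hWfin A).image2 (fun v w => A.pt '' Ioo v w)
      (hWfin A)).subset ?_
    rintro e ⟨v, hv, w, hw, -, -, rfl⟩
    exact ⟨v, hv, w, hw, rfl⟩
  · intro e he
    simp only [mem_iUnion] at he
    obtain ⟨A, hA, v, hv, w, hw, hvw, hV, rfl⟩ := he
    exact h.isCell_arc hA.1 hvw hv.1.1 hw.1.2 hv.2 hw.2 hV
  · rintro p ⟨hpG, hpV⟩ hpR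
    obtain ⟨A, hA, hpA⟩ := mem_support.1 hpG
    have hIoo := frame_mem_Ioo hA hpA hpV
    have hpt : A.pt (frame A.ang p).1 = p := side_eq_zero_iff.1 (Arc.mem_carrier.1 hpA).2.2
    set u := (frame A.ang p).1
    have hlohi := hIoo.1.trans hIoo.2
    -- Pairing `A` with itself makes the ends of the arc vertices, so vertices exist on both sides
    -- of `u`.
    have hfr : frontier (A.onArc A) = {A.lo, A.hi} := by rw [A.onArc_self, frontier_Icc hlohi.le]
    have hloW : A.lo ∈ W A := ⟨left_mem_Icc.2 hlohi.le, pt_mem_vertices hA hA (hfr ▸ by simp)⟩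
    have hhiW : A.hi ∈ W A := ⟨right_mem_Icc.2 hlohi.le, pt_mem_vertices hA hA (hfr ▸ by simp)⟩
    obtain ⟨v, hv, hvmax⟩ := ((hWfin A).inter_of_left (Iio u)).exists_maximalFor id _
      ⟨A.lo, hloW, hIoo.1⟩
    obtain ⟨w, hw, hwmin⟩ := ((hWfin A).inter_of_left (Ioi u)).exists_minimalFor id _
      ⟨A.hi, hhiW, hIoo.2⟩
    have hvu : v < u := hv.2
    have huw : u < w := hw.2
    refine ⟨A.pt '' Ioo v w, ?_, u, ⟨hvu, huw⟩, hpt⟩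
    simp only [mem_iUnion]
    refine ⟨A, ⟨hA, p, hpA, hpR⟩, v, hv.1, w, hw.1, hvu.trans huw, ?_, rfl⟩
    intro x hx hxV
    have hxW : x ∈ W A := ⟨⟨hv.1.1.1.trans hx.1.le, hx.2.le.trans hw.1.1.2⟩, hxV⟩
    rcases lt_trichotomy x u with h1 | h1 | h1
    · exact absurd (hvmax ⟨hxW, h1⟩ hx.1.le) hx.1.not_ge
    · exact hpV (hpt ▸ h1 ▸ hxV)
    · exact absurd (hwmin ⟨hxW, h1⟩ hx.2.le) hx.2.not_ge


/-! ### Cells of dimension two -/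

/-- The point with coordinates `x` and `y`. -/
def mkPt (x y : ℝ) : Plane := !₂[x, y]

@[simp] theorem mkPt_zero (x y : ℝ) : mkPt x y 0 = x := by simp [mkPt]

@[simp] theorem mkPt_one (x y : ℝ) : mkPt x y 1 = y := by simp [mkPt]

theorem mkPt_eta (p : Plane) : mkPt (p 0) (p 1) = p := plane_ext (by simp) (by simp)

theorem continuous_coord (i : Fin 2) : Continuous fun p : Plane => p i := by fun_prop

theorem continuousOn_mkPt {T : Type*} [TopologicalSpace T] {f g : T → ℝ} {s : Set T}
    (hf : ContinuousOn f s) (hg : ContinuousOn g s) : ContinuousOn (fun t => mkPt (f t) (g t)) s := by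
  refine (PiLp.continuous_toLp 2 _).comp_continuousOn (continuousOn_pi.2 fun i => ?_)
  fin_cases i
  exacts [hf, hg]

theorem norm_le_abs_add_abs (p : Plane) : ‖p‖ ≤ |p 0| + |p 1| := by
  rw [EuclideanSpace.norm_eq, Fin.sum_univ_two]
  refine Real.sqrt_le_iff.2 ⟨by positivity, ?_⟩
  simp only [Real.norm_eq_abs]
  nlinarith [abs_nonneg (p 0), abs_nonneg (p 1)]

theorem abs_coord_le (p : Plane) : |p 0| ≤ ‖p‖ ∧ |p 1| ≤ ‖p‖ := by
  have h1 := abs_frame_fst_le 0 p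
  have h2 := abs_frame_snd_le 0 p
  rw [frame_zero] at h1 h2
  exact ⟨h1, h2⟩

/-- The ball of the sup norm is a square, mapped affinely on each vertical line. The two graphs may
meet over `α` or `β`, so `low < up` is required only inside and the inverse is continuous on the
open band. The vertical sides go into the walls over `α` and `β`, which lie in `K`. -/
theorem hasCharMap_band {α β n n' : ℝ} (hαβ : α < β) {low up : ℝ → ℝ} {K : Set Plane}
    (hlow : ContinuousOn low (Icc α β)) (hup : ContinuousOn up (Icc α β))
    (hlt : ∀ x ∈ Ioo α β, low x < up x) (hln : ∀ x ∈ Icc α β, low x ∈ Icc n n')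
    (hun : ∀ x ∈ Icc α β, up x ∈ Icc n n') (hlK : ∀ x ∈ Icc α β, mkPt x (low x) ∈ K)
    (huK : ∀ x ∈ Icc α β, mkPt x (up x) ∈ K) (hαK : ∀ y ∈ Icc n n', mkPt α y ∈ K)
    (hβK : ∀ y ∈ Icc n n', mkPt β y ∈ K) :
    HasCharMap 2 K {q | q 0 ∈ Ioo α β ∧ low (q 0) < q 1 ∧ q 1 < up (q 0)} := by
  set e : Set Plane := {q | q 0 ∈ Ioo α β ∧ low (q 0) < q 1 ∧ q 1 < up (q 0)} with he
  have hpos : 0 < (β - α) / 2 := by linarith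
  set s : (Fin 2 → ℝ) → ℝ := fun x => (α + β) / 2 + (β - α) / 2 * x 0 with hs
  have hsc : Continuous s := by fun_prop
  set φ : (Fin 2 → ℝ) → Plane := fun x =>
    mkPt (s x) ((low (s x) + up (s x)) / 2 + (up (s x) - low (s x)) / 2 * x 1) with hφ
  set ψ : Plane → Fin 2 → ℝ := fun q => ![(q 0 - (α + β) / 2) / ((β - α) / 2),
    (q 1 - (low (q 0) + up (q 0)) / 2) / ((up (q 0) - low (q 0)) / 2)] with hψ
  have hball : ∀ x : Fin 2 → ℝ, x ∈ Metric.ball (0 : Fin 2 → ℝ) 1 ↔ |x 0| < 1 ∧ |x 1| < 1 :=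
    fun x => by
      rw [mem_ball_zero_iff, pi_norm_lt_iff one_pos]
      simp [Fin.forall_fin_two]
  have hcball : ∀ x : Fin 2 → ℝ, x ∈ Metric.closedBall (0 : Fin 2 → ℝ) 1 ↔
      |x 0| ≤ 1 ∧ |x 1| ≤ 1 := fun x => by
    rw [mem_closedBall_zero_iff, pi_norm_le_iff_of_nonneg zero_le_one]
    simp [Fin.forall_fin_two]
  have hsI : ∀ x : Fin 2 → ℝ, |x 0| < 1 → s x ∈ Ioo α β := fun x hx => by
    have := abs_lt.1 hx
    exact ⟨by simp only [hs]; nlinarith [this.1], by simp only [hs]; nlinarith [this.2]⟩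
  have hsI' : ∀ x : Fin 2 → ℝ, |x 0| ≤ 1 → s x ∈ Icc α β := fun x hx => by
    have := abs_le.1 hx
    exact ⟨by simp only [hs]; nlinarith [this.1], by simp only [hs]; nlinarith [this.2]⟩
  have hφe : ∀ x ∈ Metric.ball (0 : Fin 2 → ℝ) 1, φ x ∈ e := fun x hx => by
    obtain ⟨h0, h1⟩ := (hball x).1 hx
    have h1 := abs_lt.1 h1
    have h2 := sub_pos.2 (hlt _ (hsI x h0))
    simp only [he, hφ, mem_ofPred_eq, mkPt_zero, mkPt_one]
    exact ⟨hsI x h0, by nlinarith [h1.1], by nlinarith [h1.2]⟩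
  have hψb : ∀ q ∈ e, ψ q ∈ Metric.ball (0 : Fin 2 → ℝ) 1 := fun q hq => by
    have h2 : 0 < (up (q 0) - low (q 0)) / 2 := by linarith [hlt _ hq.1]
    rw [hball]
    simp only [hψ, Matrix.cons_val_zero, Matrix.cons_val_one, abs_lt, lt_div_iff₀ hpos,
      div_lt_iff₀ hpos, lt_div_iff₀ h2, div_lt_iff₀ h2]
    exact ⟨⟨by linarith [hq.1.1], by linarith [hq.1.2]⟩,
      ⟨by linarith [hq.2.1], by linarith [hq.2.2]⟩⟩
  have hψφ : ∀ x ∈ Metric.ball (0 : Fin 2 → ℝ) 1, ψ (φ x) = x := fun x hx => by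
    obtain ⟨h0, h1⟩ := (hball x).1 hx
    have h2 : up (s x) - low (s x) ≠ 0 := (sub_pos.2 (hlt _ (hsI x h0))).ne'
    have h3 : β - α ≠ 0 := (sub_pos.2 hαβ).ne'
    ext i
    fin_cases i
    · simp only [hψ, hφ, mkPt_zero, Fin.zero_eta, Matrix.cons_val_zero, hs]
      field_simp
      ring
    · simp only [hψ, hφ, mkPt_zero, mkPt_one, Fin.mk_one, Matrix.cons_val_one, Matrix.cons_val_fin_one]
      field_simp
      ring
  have hφψ : ∀ q ∈ e, φ (ψ q) = q := fun q hq => by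
    have h2 : up (q 0) - low (q 0) ≠ 0 := (sub_pos.2 (hlt _ hq.1)).ne'
    have h3 : β - α ≠ 0 := (sub_pos.2 hαβ).ne'
    have hsq : s (ψ q) = q 0 := by
      simp only [hs, hψ, Matrix.cons_val_zero]
      field_simp
      ring
    apply plane_ext
    · simp only [hφ, mkPt_zero, hsq]
    · simp only [hφ, mkPt_one, hsq]
      simp only [hψ, Matrix.cons_val_one, Matrix.cons_val_fin_one]
      field_simp
      ring
  have hmaps : MapsTo s (Metric.closedBall 0 1) (Icc α β) := fun x hx => hsI' x ((hcball x).1 hx).1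
  have hlc := hlow.comp hsc.continuousOn hmaps
  have huc := hup.comp hsc.continuousOn hmaps
  have hcoord : ∀ i, ContinuousOn (fun q : Plane => q i) e := fun i =>
    (continuous_coord i).continuousOn
  have hmaps' : MapsTo (fun q : Plane => q 0) e (Icc α β) := fun q hq => Ioo_subset_Icc_self hq.1
  have hle := hlow.comp (hcoord 0) hmaps'
  have hue := hup.comp (hcoord 0) hmaps'
  refine ⟨{ toFun := φ, invFun := ψ, source := Metric.ball 0 1, target := e,
            map_source' := fun x hx => hφe x hx, map_target' := fun q hq => hψb q hq,
            left_inv' := fun x hx => hψφ x hx, right_inv' := fun q hq => hφψ q hq },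
    rfl, ?_, ?_, ?_, ?_⟩
  · exact continuousOn_mkPt hsc.continuousOn (((hlc.add huc).div_const 2).add
      (((huc.sub hlc).div_const 2).mul (continuous_apply 1).continuousOn))
  · refine continuousOn_pi.2 fun i => ?_
    fin_cases i
    · exact ((hcoord 0).sub continuousOn_const).div_const _
    · refine ((hcoord 1).sub ((hle.add hue).div_const 2)).div ((hue.sub hle).div_const 2) ?_
      intro q hq
      have := hlt _ hq.1
      exact (show 0 < (up (q 0) - low (q 0)) / 2 by linarith).ne'
  · apply Subset.antisymm
    · rintro _ ⟨x, hx, rfl⟩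
      exact hφe x hx
    · exact fun q hq => ⟨ψ q, hψb q hq, hφψ q hq⟩
  · intro x hx
    have hx' := (hcball x).1 (Metric.sphere_subset_closedBall hx)
    have hxb : ¬ (|x 0| < 1 ∧ |x 1| < 1) := fun h1 => by
      have := (hball x).2 h1
      rw [mem_ball_zero_iff] at this
      rw [mem_sphere_zero_iff_norm] at hx
      linarith
    have hsx := hsI' x hx'.1
    change φ x ∈ K
    rcases hx'.1.lt_or_eq with h0 | h0
    · have h1 : |x 1| = 1 := le_antisymm hx'.2 (not_lt.1 fun h => hxb ⟨h0, h⟩)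
      rcases eq_or_eq_neg_of_abs_eq h1 with h2 | h2
      · convert huK _ hsx using 2
        rw [h2]
        ring
      · convert hlK _ hsx using 2
        rw [h2]
        ring
    · have h1 := abs_le.1 hx'.2
      have hy : (low (s x) + up (s x)) / 2 + (up (s x) - low (s x)) / 2 * x 1 ∈ Icc n n' := by
        have h2 := hln _ hsx
        have h3 := hun _ hsx
        have e1 : (low (s x) + up (s x)) / 2 + (up (s x) - low (s x)) / 2 * x 1 =
            (1 - x 1) / 2 * low (s x) + (1 + x 1) / 2 * up (s x) := by ring
        have h4 : 0 ≤ (1 - x 1) / 2 := by linarith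
        have h5 : 0 ≤ (1 + x 1) / 2 := by linarith
        rw [e1]
        constructor
        · nlinarith [mul_le_mul_of_nonneg_left h2.1 h4, mul_le_mul_of_nonneg_left h3.1 h5]
        · nlinarith [mul_le_mul_of_nonneg_left h2.2 h4, mul_le_mul_of_nonneg_left h3.2 h5]
      rcases eq_or_eq_neg_of_abs_eq h0 with h2 | h2
      · convert hβK _ hy using 2
        simp only [hs, h2]
        ring
      · convert hαK _ hy using 2
        simp only [hs, h2]
        ring

namespace Arc

/-- No two points of the arc have the same abscissa. -/
def Slanted (A : Arc) : Prop := InjOn (fun p : Plane => p 0) A.carrier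

/-- All points of the arc have the same abscissa. -/
def Upright (A : Arc) : Prop := ∀ p ∈ A.carrier, ∀ q ∈ A.carrier, p 0 = q 0

end Arc

/-- Around `p` the arc `A` runs along `B`. On a slanted arc the abscissa is continuous and injective
in the parameter, hence strictly monotone, so it takes all values near `p 0`. -/
theorem eventually_exists_mem {A B : Arc} (hA : A ∈ 𝓐) (hB : B ∈ 𝓐) (hs : A.Slanted) {p : Plane}
    (hpA : p ∈ A.carrier) (hpB : p ∈ B.carrier) (hp : p ∉ vertices 𝓐) {U : Set Plane}
    (hU : U ∈ nhds p) : ∀ᶠ x in nhds (p 0), ∃ q ∈ A.carrier, q ∈ B.carrier ∧ q ∈ U ∧ q 0 = x := by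
  have hint := mem_interior_onArc hA hB hpA hpB hp
  have hpt : A.pt (frame A.ang p).1 = p := side_eq_zero_iff.1 (Arc.mem_carrier.1 hpA).2.2
  set u := (frame A.ang p).1
  have hS : interior (A.onArc B) ∩ A.pt ⁻¹' U ∈ nhds u :=
    Filter.inter_mem (isOpen_interior.mem_nhds hint)
      (A.continuous_pt.continuousAt.preimage_mem_nhds (by rwa [hpt]))
  obtain ⟨ε, hε, hεS⟩ := Metric.nhds_basis_closedBall.mem_iff.1 hS
  rw [Real.closedBall_eq_Icc] at hεS
  have hon : ∀ v ∈ Icc (u - ε) (u + ε), A.pt v ∈ A.carrier ∧ A.pt v ∈ B.carrier ∧ A.pt v ∈ U :=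
    fun v hv => ⟨mem_image_of_mem _ (interior_subset (hεS hv).1).1,
      (interior_subset (hεS hv).1).2, (hεS hv).2⟩
  have hle : u - ε ≤ u + ε := by linarith
  have hc : ContinuousOn (fun v => A.pt v 0) (Icc (u - ε) (u + ε)) :=
    ((continuous_coord 0).comp A.continuous_pt).continuousOn
  have hinj : InjOn (fun v => A.pt v 0) (Icc (u - ε) (u + ε)) := fun v hv w hw hvw =>
    A.pt_injective (hs (hon v hv).1 (hon w hw).1 hvw)
  have hul : u - ε ∈ Icc (u - ε) (u + ε) := left_mem_Icc.2 hle
  have hur : u + ε ∈ Icc (u - ε) (u + ε) := right_mem_Icc.2 hle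
  have hum : u ∈ Icc (u - ε) (u + ε) := ⟨by linarith, by linarith⟩
  have hu0 : A.pt u 0 = p 0 := by rw [hpt]
  rcases hc.strictMonoOn_of_injOn_Icc' hle hinj with hm | hm
  · have h1 := hm hul hum (by linarith)
    have h2 := hm hum hur (by linarith)
    simp only [hu0] at h1 h2
    filter_upwards [Ioo_mem_nhds h1 h2] with x hx
    obtain ⟨v, hv, hvx⟩ := intermediate_value_Icc hle hc (Ioo_subset_Icc_self hx)
    exact ⟨_, (hon v hv).1, (hon v hv).2.1, (hon v hv).2.2, hvx⟩
  · have h1 := hm hul hum (by linarith)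
    have h2 := hm hum hur (by linarith)
    simp only [hu0] at h1 h2
    filter_upwards [Ioo_mem_nhds h2 h1] with x hx
    obtain ⟨v, hv, hvx⟩ := intermediate_value_Icc' hle hc (Ioo_subset_Icc_self hx)
    exact ⟨_, (hon v hv).1, (hon v hv).2.1, (hon v hv).2.2, hvx⟩

/-- A rectangle whose horizontal sides lie on arcs of the family and whose interior contains
neither vertices of the family nor points of vertical arcs. -/
structure IsStrip (𝓐 : Set Arc) (α β n n' : ℝ) : Prop where
  lt : α < β
  le : n ≤ n'
  slanted_or_upright : ∀ A ∈ 𝓐, A.Slanted ∨ A.Upright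
  bottom : ∃ H ∈ 𝓐, (∀ p ∈ H.carrier, p 1 = n) ∧ ∀ x ∈ Icc α β, mkPt x n ∈ H.carrier
  top : ∃ H ∈ 𝓐, (∀ p ∈ H.carrier, p 1 = n') ∧ ∀ x ∈ Icc α β, mkPt x n' ∈ H.carrier
  notMem_vertices : ∀ p : Plane, p 0 ∈ Ioo α β → p 1 ∈ Icc n n' → p ∉ vertices 𝓐
  not_upright : ∀ A ∈ 𝓐, A.Upright → ∀ p ∈ A.carrier, p 0 ∈ Ioo α β → p 1 ∉ Icc n n'

namespace IsStrip

variable {α β n n' : ℝ} (h : IsStrip 𝓐 α β n n')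
include h

theorem slanted {A : Arc} (hA : A ∈ 𝓐) {p : Plane} (hp : p ∈ A.carrier) (hp0 : p 0 ∈ Ioo α β)
    (hp1 : p 1 ∈ Icc n n') : A.Slanted :=
  (h.slanted_or_upright A hA).resolve_right fun hu => h.not_upright A hA hu p hp hp0 hp1

/-- An arc which enters a strip crosses it. -/
theorem exists_mem {A : Arc} (hA : A ∈ 𝓐) {p : Plane} (hp : p ∈ A.carrier) (hp0 : p 0 ∈ Ioo α β)
    (hp1 : p 1 ∈ Icc n n') : ∀ x ∈ Icc α β, ∃ q ∈ A.carrier, q 0 = x ∧ q 1 ∈ Icc n n' := by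
  have hs := h.slanted hA hp hp0 hp1
  set K : Set Plane := A.carrier ∩ {q | q 1 ∈ Icc n n'} with hK
  have hKc : IsCompact K :=
    A.isCompact_carrier.inter_right (isClosed_Icc.preimage (continuous_coord 1))
  -- The abscissae of the points of `A` in the strip form a closed set that is also open within `(α,
  -- β)`; by connectedness it contains the whole interval.
  set T : Set ℝ := (fun q : Plane => q 0) '' K with hT
  have hTc : IsClosed T := (hKc.image (continuous_coord 0)).isClosed
  have hopen : ∀ x ∈ T, x ∈ Ioo α β → T ∈ nhds x := by
    rintro _ ⟨q, ⟨hqA, hq1⟩, rfl⟩ hq0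
    have hqV := h.notMem_vertices q hq0 hq1
    -- At a point on a horizontal side, `A` runs along the arc `H` that carries this side, so it
    -- cannot leave the strip there.
    have key : ∀ H ∈ 𝓐, ∀ c ∈ Icc n n', (∀ p ∈ H.carrier, p 1 = c) → q ∈ H.carrier →
        T ∈ nhds (q 0) := by
      intro H hH c hc hHc hqH
      filter_upwards [eventually_exists_mem hA hH hs hqA hqH hqV Filter.univ_mem] with x hx
      obtain ⟨r, hrA, hrH, -, rfl⟩ := hx
      exact ⟨r, ⟨hrA, by rw [mem_ofPred_eq, hHc r hrH]; exact hc⟩, rfl⟩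
    have hq01 := Ioo_subset_Icc_self hq0
    rcases hq1.1.eq_or_lt with h1 | h1
    · obtain ⟨H, hH, hHc, hHm⟩ := h.bottom
      refine key H hH n (left_mem_Icc.2 h.le) hHc ?_
      have := hHm (q 0) hq01
      rwa [h1, mkPt_eta] at this
    rcases hq1.2.eq_or_lt with h2 | h2
    · obtain ⟨H, hH, hHc, hHm⟩ := h.top
      refine key H hH n' (right_mem_Icc.2 h.le) hHc ?_
      have := hHm (q 0) hq01
      rwa [← h2, mkPt_eta] at this
    · have hU : {r : Plane | r 1 ∈ Ioo n n'} ∈ nhds q :=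
        (isOpen_Ioo.preimage (continuous_coord 1)).mem_nhds ⟨h1, h2⟩
      filter_upwards [eventually_exists_mem hA hA hs hqA hqA hqV hU] with x hx
      obtain ⟨r, hrA, -, hrU, rfl⟩ := hx
      exact ⟨r, ⟨hrA, Ioo_subset_Icc_self hrU⟩, rfl⟩
  have hsub : Ioo α β ⊆ T := by
    have hcov : Ioo α β ⊆ interior T ∪ Tᶜ := fun x hx => by
      by_cases hxT : x ∈ T
      · exact Or.inl (mem_interior_iff_mem_nhds.2 (hopen x hxT hx))
      · exact Or.inr hxT
    have hdisj : Ioo α β ∩ (interior T ∩ Tᶜ) = ∅ := by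
      ext x
      simp only [mem_inter_iff, mem_empty_iff_false, iff_false]
      exact fun hx => hx.2.2 (interior_subset hx.2.1)
    rcases isPreconnected_iff_subset_of_disjoint.1 isPreconnected_Ioo _ _ isOpen_interior
      hTc.isOpen_compl hcov hdisj with h1 | h1
    · exact h1.trans interior_subset
    · exact absurd ⟨p, ⟨hp, hp1⟩, rfl⟩ (h1 hp0)
  intro x hx
  have := closure_minimal hsub hTc
  rw [closure_Ioo h.lt.ne] at this
  obtain ⟨q, hq, hqx⟩ := this hx
  exact ⟨q, hq.1, hqx, hq.2⟩

-- Continuity holds because the preimage of a closed set of heights is the projection of a compact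
-- part of the arc.
omit h in
theorem exists_function {A : Arc} (hs : A.Slanted)
    (hA : ∀ x ∈ Icc α β, ∃ q ∈ A.carrier, q 0 = x ∧ q 1 ∈ Icc n n') :
    ∃ g : ℝ → ℝ, ContinuousOn g (Icc α β) ∧
      ∀ x ∈ Icc α β, mkPt x (g x) ∈ A.carrier ∧ g x ∈ Icc n n' := by
  choose! q hqA hq0 hq1 using hA
  have hmk : ∀ x ∈ Icc α β, mkPt x (q x 1) = q x := fun x hx => by
    conv_rhs => rw [← mkPt_eta (q x), hq0 x hx]
  refine ⟨fun x => q x 1, ?_, fun x hx => ⟨(hmk x hx).symm ▸ hqA x hx, hq1 x hx⟩⟩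
  rw [continuousOn_iff_isClosed]
  intro t ht
  refine ⟨(fun p : Plane => p 0) '' (A.carrier ∩ {p | p 1 ∈ t}),
    ((A.isCompact_carrier.inter_right (ht.preimage (continuous_coord 1))).image
      (continuous_coord 0)).isClosed, ?_⟩
  ext x
  constructor
  · rintro ⟨hxt, hx⟩
    exact ⟨⟨q x, ⟨hqA x hx, hxt⟩, hq0 x hx⟩, hx⟩
  · rintro ⟨⟨p, ⟨hpA, hpt⟩, hpx⟩, hx⟩
    refine ⟨?_, hx⟩
    have : p = q x := hs hpA (hqA x hx) (hpx.trans (hq0 x hx).symm)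
    change q x 1 ∈ t
    rw [← this]
    exact hpt

/-- Two arcs which cross a strip coincide there or do not meet. -/
theorem trichotomy {A B : Arc} (hA : A ∈ 𝓐) (hB : B ∈ 𝓐) (hAs : A.Slanted) (hBs : B.Slanted)
    {f g : ℝ → ℝ} (hf : ContinuousOn f (Icc α β)) (hg : ContinuousOn g (Icc α β))
    (hfA : ∀ x ∈ Icc α β, mkPt x (f x) ∈ A.carrier ∧ f x ∈ Icc n n')
    (hgB : ∀ x ∈ Icc α β, mkPt x (g x) ∈ B.carrier ∧ g x ∈ Icc n n') :
    (∀ x ∈ Ioo α β, f x = g x) ∨ (∀ x ∈ Ioo α β, f x < g x) ∨ ∀ x ∈ Ioo α β, g x < f x := by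
  have hfg : ContinuousOn (fun x => g x - f x) (Ioo α β) := (hg.sub hf).mono Ioo_subset_Icc_self
  by_cases hex : ∃ x ∈ Ioo α β, f x = g x
  · left
    -- The coincidence set is open in `(α, β)`, since the strip contains no vertices there, and
    -- closed by continuity.
    set E : Set ℝ := {x | f x = g x} with hE
    have hcov : Ioo α β ⊆ interior E ∪ (Ioo α β ∩ (fun x => g x - f x) ⁻¹' {0}ᶜ) := fun x hx => by
      by_cases hxE : f x = g x
      · left
        rw [mem_interior_iff_mem_nhds]
        have hx' := Ioo_subset_Icc_self hx
        obtain ⟨h1, h2⟩ := hfA x hx'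
        have h3 := (hgB x hx').1
        rw [← hxE] at h3
        have := eventually_exists_mem hA hB hAs h1 h3 (h.notMem_vertices _ (by simpa) (by simpa))
          Filter.univ_mem
        rw [mkPt_zero] at this
        filter_upwards [this, Ioo_mem_nhds hx.1 hx.2] with y hy hyI
        obtain ⟨q, hqA, hqB, -, rfl⟩ := hy
        have hy' := Ioo_subset_Icc_self hyI
        have e1 : mkPt (q 0) (f (q 0)) = q := hAs (hfA _ hy').1 hqA (by simp)
        have e2 : mkPt (q 0) (g (q 0)) = q := hBs (hgB _ hy').1 hqB (by simp)
        change f (q 0) = g (q 0)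
        simpa using congrArg (fun p : Plane => p 1) (e1.trans e2.symm)
      · exact Or.inr ⟨hx, fun h0 => hxE (sub_eq_zero.1 h0).symm⟩
    have hdisj : Ioo α β ∩ (interior E ∩ (Ioo α β ∩ (fun x => g x - f x) ⁻¹' {0}ᶜ)) = ∅ := by
      ext x
      simp only [mem_inter_iff, mem_empty_iff_false, iff_false]
      rintro ⟨-, hx1, -, hx2⟩
      exact hx2 (sub_eq_zero.2 (interior_subset hx1).symm)
    rcases isPreconnected_iff_subset_of_disjoint.1 isPreconnected_Ioo _ _ isOpen_interior
      (hfg.isOpen_inter_preimage isOpen_Ioo isOpen_compl_singleton) hcov hdisj with h1 | h1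
    · exact fun x hx => (interior_subset (h1 hx) : x ∈ E)
    · obtain ⟨x, hx, hxE⟩ := hex
      exact absurd (sub_eq_zero.2 hxE.symm) (h1 hx).2
  · right
    push Not at hex
    rcases forall_pos_or_neg_of_ne_zero ordConnected_Ioo hfg
      (fun x hx h0 => hex x hx (sub_eq_zero.1 h0).symm) with h1 | h1
    · exact Or.inl fun x hx => sub_pos.1 (h1 x hx)
    · exact Or.inr fun x hx => sub_neg.1 (h1 x hx)

/-- A point of a strip which is not on an arc lies between two neighbouring arcs. -/
theorem exists_between (hfin : LocFin 𝓐) {p : Plane} (hp0 : p 0 ∈ Ioo α β) (hp1 : p 1 ∈ Ioo n n')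
    (hp : p ∉ support 𝓐) : ∃ A ∈ 𝓐, ∃ B ∈ 𝓐, A.Slanted ∧ B.Slanted ∧ ∃ low up : ℝ → ℝ,
      ContinuousOn low (Icc α β) ∧ ContinuousOn up (Icc α β) ∧
      (∀ x ∈ Icc α β, mkPt x (low x) ∈ A.carrier ∧ low x ∈ Icc n n') ∧
      (∀ x ∈ Icc α β, mkPt x (up x) ∈ B.carrier ∧ up x ∈ Icc n n') ∧
      low (p 0) < p 1 ∧ p 1 < up (p 0) ∧ (∀ x ∈ Ioo α β, low x < up x) ∧
      ∀ q : Plane, q 0 ∈ Ioo α β → low (q 0) < q 1 → q 1 < up (q 0) → q ∉ support 𝓐 := by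
  have hp0' := Ioo_subset_Icc_self hp0
  set F : Set Arc := {A ∈ 𝓐 | A.Slanted ∧
    ∀ x ∈ Icc α β, ∃ q ∈ A.carrier, q 0 = x ∧ q 1 ∈ Icc n n'} with hF
  have hFfin : F.Finite := by
    refine (hfin (|p 0| + (|n| + |n'|))).subset ?_
    rintro A ⟨hA, -, hcr⟩
    obtain ⟨q, hqA, hq0, hq1⟩ := hcr _ hp0'
    refine ⟨hA, q, hqA, (norm_le_abs_add_abs q).trans ?_⟩
    rw [hq0]
    refine add_le_add le_rfl (abs_le.2 ⟨?_, ?_⟩)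
    · linarith [neg_abs_le n, abs_nonneg n', hq1.1]
    · linarith [le_abs_self n', abs_nonneg n, hq1.2]
  have hfun : ∀ A : Arc, A ∈ F → ∃ g : ℝ → ℝ, ContinuousOn g (Icc α β) ∧
      ∀ x ∈ Icc α β, mkPt x (g x) ∈ A.carrier ∧ g x ∈ Icc n n' := fun A hA =>
    exists_function hA.2.1 hA.2.2
  choose! g hgc hgm using hfun
  have hmemF : ∀ A ∈ 𝓐, ∀ q ∈ A.carrier, q 0 ∈ Ioo α β → q 1 ∈ Icc n n' →
      A ∈ F ∧ g A (q 0) = q 1 := by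
    intro A hA q hq hq0 hq1
    have hAF : A ∈ F := ⟨hA, h.slanted hA hq hq0 hq1, h.exists_mem hA hq hq0 hq1⟩
    refine ⟨hAF, ?_⟩
    have : mkPt (q 0) (g A (q 0)) = q :=
      hAF.2.1 (hgm A hAF _ (Ioo_subset_Icc_self hq0)).1 hq (by simp)
    simpa using congrArg (fun p : Plane => p 1) this
  have htri := fun A (hA : A ∈ F) B (hB : B ∈ F) => h.trichotomy hA.1 hB.1 hA.2.1 hB.2.1
    (hgc A hA) (hgc B hB) (hgm A hA) (hgm B hB)
  obtain ⟨H₀, hH₀, -, hH₀m⟩ := h.bottom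
  obtain ⟨H₁, hH₁, -, hH₁m⟩ := h.top
  have h₀ := hmemF H₀ hH₀ _ (hH₀m (p 0) hp0') (by simpa) (by simpa using h.le)
  have h₁ := hmemF H₁ hH₁ _ (hH₁m (p 0) hp0') (by simpa) (by simpa using h.le)
  simp only [mkPt_zero, mkPt_one] at h₀ h₁
  -- By `htri`, the order of the crossing arcs over `p 0` is their order throughout the strip. Hence
  -- the highest one below `p` and the lowest one above `p` bound a band free of arcs.
  obtain ⟨A, ⟨hAF, hAlt⟩, hAmax⟩ := (hFfin.inter_of_left {A | g A (p 0) < p 1}).exists_maximalFor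
    (fun A => g A (p 0)) _ ⟨H₀, h₀.1, by rw [mem_ofPred_eq, h₀.2]; exact hp1.1⟩
  obtain ⟨B, ⟨hBF, hBlt⟩, hBmin⟩ := (hFfin.inter_of_left {A | p 1 < g A (p 0)}).exists_minimalFor
    (fun A => g A (p 0)) _ ⟨H₁, h₁.1, by rw [mem_ofPred_eq, h₁.2]; exact hp1.2⟩
  have hlt : ∀ E ∈ F, ∀ E' ∈ F, g E (p 0) < g E' (p 0) → ∀ x ∈ Ioo α β, g E x < g E' x := by
    intro E hE E' hE' hlt
    rcases htri E hE E' hE' with h1 | h1 | h1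
    · exact absurd (h1 _ hp0) hlt.ne
    · exact h1
    · exact absurd (h1 _ hp0) hlt.not_gt
  have hle : ∀ E ∈ F, ∀ E' ∈ F, g E (p 0) ≤ g E' (p 0) → ∀ x ∈ Ioo α β, g E x ≤ g E' x := by
    intro E hE E' hE' hle x hx
    rcases htri E hE E' hE' with h1 | h1 | h1
    · exact (h1 x hx).le
    · exact (h1 x hx).le
    · exact absurd (h1 _ hp0) hle.not_gt
  refine ⟨A, hAF.1, B, hBF.1, hAF.2.1, hBF.2.1, g A, g B, hgc A hAF, hgc B hBF, hgm A hAF,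
    hgm B hBF, hAlt, hBlt, hlt A hAF B hBF (lt_trans hAlt hBlt), ?_⟩
  intro q hq0 hq1 hq2 hqs
  obtain ⟨E, hE, hqE⟩ := mem_support.1 hqs
  have hq0' := Ioo_subset_Icc_self hq0
  obtain ⟨hEF, hEq⟩ := hmemF E hE q hqE hq0
    ⟨(hgm A hAF _ hq0').2.1.trans hq1.le, hq2.le.trans (hgm B hBF _ hq0').2.2⟩
  rcases lt_trichotomy (g E (p 0)) (p 1) with h1 | h1 | h1
  · have h2 : g E (p 0) ≤ g A (p 0) := by
      by_contra! h3
      exact absurd (hAmax ⟨hEF, h1⟩ h3.le) h3.not_ge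
    have := hle E hEF A hAF h2 _ hq0
    linarith
  · apply hp
    have := (hgm E hEF _ hp0').1
    rw [h1, mkPt_eta] at this
    exact mem_support.2 ⟨E, hE, this⟩
  · have h2 : g B (p 0) ≤ g E (p 0) := by
      by_contra! h3
      exact absurd (hBmin ⟨hEF, h1⟩ h3.le) h3.not_ge
    have := hle B hBF E hEF h2 _ hq0
    linarith

end IsStrip


/-! ### The cell decomposition generated by a locally finite family of arcs -/

namespace Arc

/-- The segment of the line with abscissa `c`, in the frame rotated by `θ`, between the heights
`lo` and `hi`. -/
def wall (θ c lo hi : ℝ) : Arc := ⟨C (-c), θ + Real.pi / 2, lo, hi⟩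

theorem mem_wall {θ c lo hi : ℝ} {p : Plane} : p ∈ (wall θ c lo hi).carrier ↔
    (frame θ p).1 = c ∧ (frame θ p).2 ∈ Icc lo hi := by
  simp only [wall, mem_carrier, side, frame_add_pi_div_two, eval_C, mem_Icc]
  constructor
  · exact fun h => ⟨by linarith [h.2.2], h.1, h.2.1⟩
  · exact fun h => ⟨h.2.1, h.2.2, by linarith [h.1]⟩

theorem mem_carrier_iff_eval {A : Arc} {p : Plane} : p ∈ A.carrier ↔
    (frame A.ang p).1 ∈ Icc A.lo A.hi ∧ (frame A.ang p).2 = A.poly.eval (frame A.ang p).1 := by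
  rw [mem_carrier, side, sub_eq_zero, eq_comm (a := eval _ _)]
  exact and_assoc.symm

/-- The arc of `A` between the parameters `v` and `w`. -/
def sub (A : Arc) (v w : ℝ) : Arc := ⟨A.poly, A.ang, v, w⟩

end Arc

/-- The sides of the unit squares which are parallel to the first axis. -/
def rung (m n : ℤ) : Arc := ⟨C (n : ℝ), 0, m, m + 1⟩

theorem mem_rung {m n : ℤ} {p : Plane} :
    p ∈ (rung m n).carrier ↔ p 0 ∈ Icc (m : ℝ) (m + 1) ∧ p 1 = n := by
  rw [Arc.mem_carrier_iff_eval]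
  simp [rung, frame_zero]

theorem locFin_of_index {ι : Type*} {s : Set ι} {A : ι → Arc}
    (h : ∀ R : ℝ, {i ∈ s | ∃ p ∈ (A i).carrier, ‖p‖ ≤ R}.Finite) : LocFin (A '' s) := by
  intro R
  refine ((h R).image A).subset ?_
  rintro _ ⟨⟨i, hi, rfl⟩, hp⟩
  exact ⟨i, ⟨hi, hp⟩, rfl⟩

theorem LocFin.union {𝓐 𝓑 : Set Arc} (hA : LocFin 𝓐) (hB : LocFin 𝓑) : LocFin (𝓐 ∪ 𝓑) := by
  intro R
  refine ((hA R).union (hB R)).subset ?_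
  rintro A ⟨h | h, hp⟩
  exacts [Or.inl ⟨h, hp⟩, Or.inr ⟨h, hp⟩]

theorem finite_int_of_near (R : ℝ) : {n : ℤ | ∃ x : ℝ, x ∈ Icc (n : ℝ) (n + 1) ∧ |x| ≤ R}.Finite := by
  refine (finite_Icc ⌊-R - 1⌋ ⌈R⌉).subset ?_
  rintro n ⟨x, hx, hxR⟩
  have := abs_le.1 hxR
  constructor
  · exact_mod_cast (Int.floor_le (-R - 1)).trans (by linarith [hx.2] : -R - 1 ≤ (n : ℝ))
  · exact_mod_cast (by linarith [hx.1] : (n : ℝ) ≤ R).trans (Int.le_ceil R)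

/-- A point which is not in a locally finite set lies between consecutive elements. -/
theorem exists_consecutive {S : Set ℝ} {lo x hi : ℝ} (hlo : lo ∈ S) (hhi : hi ∈ S) (hlox : lo ≤ x)
    (hxhi : x ≤ hi) (hx : x ∉ S) (hfin : (S ∩ Icc lo hi).Finite) :
    ∃ a b, Consecutive S a b ∧ x ∈ Ioo a b := by
  have hlox := lt_of_le_of_ne hlox fun h => hx (h ▸ hlo)
  have hxhi := lt_of_le_of_ne hxhi fun h => hx (h ▸ hhi)
  obtain ⟨a, ha, hamax⟩ := (hfin.inter_of_left (Iio x)).exists_maximalFor id _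
    ⟨lo, ⟨hlo, left_mem_Icc.2 (hlox.trans hxhi).le⟩, hlox⟩
  obtain ⟨b, hb, hbmin⟩ := (hfin.inter_of_left (Ioi x)).exists_minimalFor id _
    ⟨hi, ⟨hhi, right_mem_Icc.2 (hlox.trans hxhi).le⟩, hxhi⟩
  have hax : a < x := ha.2
  have hxb : x < b := hb.2
  refine ⟨a, b, ⟨ha.1.1, hb.1.1, hax.trans hxb, fun c hc => ?_⟩, hax, hxb⟩
  by_contra! h
  have hcI : c ∈ S ∩ Icc lo hi := ⟨hc, ha.1.2.1.trans h.1.le, h.2.le.trans hb.1.2.2⟩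
  rcases lt_trichotomy c x with h1 | h1 | h1
  · exact h.1.not_ge (hamax ⟨hcI, h1⟩ h.1.le)
  · exact hx (h1 ▸ hc)
  · exact h.2.not_ge (hbmin ⟨hcI, h1⟩ h.2.le)

/-- The family with all horizontal sides of unit squares added. -/
def withRungs (𝓑 : Set Arc) : Set Arc := 𝓑 ∪ (fun i : ℤ × ℤ => rung i.1 i.2) '' univ

theorem rung_mem_withRungs (𝓑 : Set Arc) (m n : ℤ) : rung m n ∈ withRungs 𝓑 :=
  Or.inr ⟨(m, n), trivial, rfl⟩

theorem locFin_withRungs {𝓑 : Set Arc} (h : LocFin 𝓑) : LocFin (withRungs 𝓑) := by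
  refine h.union (locFin_of_index fun R => ?_)
  refine ((finite_int_of_near R).prod (finite_int_of_near R)).subset ?_
  rintro ⟨m, n⟩ ⟨-, p, hp, hpR⟩
  obtain ⟨h0, h1⟩ := mem_rung.1 hp
  have h2 := abs_coord_le p
  exact ⟨⟨_, h0, h2.1.trans hpR⟩, p 1, ⟨h1.ge, by rw [h1]; linarith⟩, h2.2.trans hpR⟩

/-- The abscissae where the unit square with lower left corner `(m, n)` is cut vertically. -/
def cuts (𝓐 : Set Arc) (m n : ℤ) : Set ℝ :=
  {x | x ∈ Icc (m : ℝ) (m + 1) ∧ (x = m ∨ x = m + 1 ∨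
    (∃ p ∈ vertices 𝓐, p 0 = x ∧ p 1 ∈ Icc (n : ℝ) (n + 1)) ∨
    ∃ A ∈ 𝓐, A.Upright ∧ ∃ p ∈ A.carrier, p 0 = x ∧ p 1 ∈ Icc (n : ℝ) (n + 1))}

theorem exists_norm_le_of_mem_square (m n : ℤ) : ∃ R : ℝ, ∀ p : Plane,
    p 0 ∈ Icc (m : ℝ) (m + 1) → p 1 ∈ Icc (n : ℝ) (n + 1) → ‖p‖ ≤ R := by
  refine ⟨|(m : ℝ)| + 1 + (|(n : ℝ)| + 1), fun p h0 h1 => (norm_le_abs_add_abs p).trans ?_⟩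
  refine add_le_add (abs_le.2 ⟨?_, ?_⟩) (abs_le.2 ⟨?_, ?_⟩)
  · linarith [neg_abs_le (m : ℝ), h0.1]
  · linarith [le_abs_self (m : ℝ), h0.2]
  · linarith [neg_abs_le (n : ℝ), h1.1]
  · linarith [le_abs_self (n : ℝ), h1.2]

theorem LocFin.finite_cuts {𝓐 : Set Arc} (h : LocFin 𝓐) (m n : ℤ) : (cuts 𝓐 m n).Finite := by
  obtain ⟨R, hR⟩ := exists_norm_le_of_mem_square m n
  have h1 : {x : ℝ | ∃ A ∈ {A ∈ 𝓐 | ∃ p ∈ A.carrier, ‖p‖ ≤ R},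
      A.Upright ∧ ∃ p ∈ A.carrier, p 0 = x}.Finite := by
    have : {x : ℝ | ∃ A ∈ {A ∈ 𝓐 | ∃ p ∈ A.carrier, ‖p‖ ≤ R},
      A.Upright ∧ ∃ p ∈ A.carrier, p 0 = x} = ⋃ A ∈ {A ∈ 𝓐 | ∃ p ∈ A.carrier, ‖p‖ ≤ R},
        {x | A.Upright ∧ ∃ p ∈ A.carrier, p 0 = x} := by
      ext
      simp only [mem_ofPred_eq, mem_iUnion, exists_prop]
    rw [this]
    refine (h R).biUnion fun A _ => Set.Subsingleton.finite ?_
    rintro _ ⟨hA, p, hp, rfl⟩ _ ⟨-, q, hq, rfl⟩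
    exact hA p hp q hq
  refine (((finite_singleton (m : ℝ)).union (finite_singleton ((m : ℝ) + 1))).union
    (((h.finite_vertices R).image fun p : Plane => p 0).union h1)).subset ?_
  rintro x ⟨hx, rfl | rfl | ⟨p, hp, rfl, hp1⟩ | ⟨A, hA, hu, p, hp, rfl, hp1⟩⟩
  · exact Or.inl (Or.inl rfl)
  · exact Or.inl (Or.inr rfl)
  · exact Or.inr (Or.inl ⟨p, ⟨hp, hR p hx hp1⟩, rfl⟩)
  · exact Or.inr (Or.inr ⟨A, ⟨hA, p, hp, hR p hx hp1⟩, hu, p, hp, rfl⟩)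

/-- The vertical segments through the cuts. -/
def posts (𝓐 : Set Arc) : Set Arc :=
  (fun i : (ℤ × ℤ) × ℝ => Arc.wall 0 i.2 i.1.2 (i.1.2 + 1)) '' {i | i.2 ∈ cuts 𝓐 i.1.1 i.1.2}

theorem mem_post {c : ℝ} {n : ℤ} {p : Plane} :
    p ∈ (Arc.wall 0 c n (n + 1)).carrier ↔ p 0 = c ∧ p 1 ∈ Icc (n : ℝ) (n + 1) := by
  rw [Arc.mem_wall, frame_zero]

theorem locFin_posts {𝓐 : Set Arc} (h : LocFin 𝓐) : LocFin (posts 𝓐) := by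
  refine locFin_of_index fun R => ?_
  have : (⋃ m ∈ {n : ℤ | ∃ x : ℝ, x ∈ Icc (n : ℝ) (n + 1) ∧ |x| ≤ R},
      ⋃ n ∈ {n : ℤ | ∃ x : ℝ, x ∈ Icc (n : ℝ) (n + 1) ∧ |x| ≤ R},
        (Prod.mk (m, n)) '' (cuts 𝓐 m n)).Finite :=
    (finite_int_of_near R).biUnion fun m _ => (finite_int_of_near R).biUnion fun n _ =>
      (h.finite_cuts m n).image _
  refine this.subset ?_
  rintro ⟨⟨m, n⟩, c⟩ ⟨hc, p, hp, hpR⟩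
  obtain ⟨rfl, h1⟩ := mem_post.1 hp
  have h2 := abs_coord_le p
  simp only [mem_iUnion]
  exact ⟨m, ⟨p 0, hc.1, h2.1.trans hpR⟩, n, ⟨p 1, h1, h2.2.trans hpR⟩, p 0, hc, rfl⟩

/-- The points whose abscissa is in `(α, β)` and which lie between the arcs `A` and `B`. -/
def between (A B : Arc) (α β : ℝ) : Set Plane :=
  {q | q 0 ∈ Ioo α β ∧ (∃ r ∈ A.carrier, r 0 = q 0 ∧ r 1 < q 1) ∧
    ∃ r ∈ B.carrier, r 0 = q 0 ∧ q 1 < r 1}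

/-- The functions `low` and `up` come from a choice. The description by two arcs and two abscissae
shows that there are only finitely many candidates for bands near a disc. -/
theorem between_eq {A B : Arc} (hA : A.Slanted) (hB : B.Slanted) {α β : ℝ} {low up : ℝ → ℝ}
    (hlow : ∀ x ∈ Icc α β, mkPt x (low x) ∈ A.carrier)
    (hup : ∀ x ∈ Icc α β, mkPt x (up x) ∈ B.carrier) :
    between A B α β = {q | q 0 ∈ Ioo α β ∧ low (q 0) < q 1 ∧ q 1 < up (q 0)} := by
  ext q
  refine and_congr_right fun hq => ?_
  have hq' := Ioo_subset_Icc_self hq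
  refine and_congr ⟨?_, fun h => ⟨_, hlow _ hq', by simp, by simpa using h⟩⟩
    ⟨?_, fun h => ⟨_, hup _ hq', by simp, by simpa using h⟩⟩
  · rintro ⟨r, hr, hr0, hr1⟩
    rw [← hA (hlow _ hq') hr (by simp [hr0])] at hr1
    simpa using hr1
  · rintro ⟨r, hr, hr0, hr1⟩
    rw [← hB (hup _ hq') hr (by simp [hr0])] at hr1
    simpa using hr1

theorem isOpen_band {α β : ℝ} {low up : ℝ → ℝ} (hlow : ContinuousOn low (Icc α β))
    (hup : ContinuousOn up (Icc α β)) :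
    IsOpen {q : Plane | q 0 ∈ Ioo α β ∧ low (q 0) < q 1 ∧ q 1 < up (q 0)} := by
  have hU : IsOpen {q : Plane | q 0 ∈ Ioo α β} := isOpen_Ioo.preimage (continuous_coord 0)
  have hm : MapsTo (fun q : Plane => q 0) {q : Plane | q 0 ∈ Ioo α β} (Icc α β) :=
    fun q hq => Ioo_subset_Icc_self hq
  have h1 := (continuous_coord 1).continuousOn.sub
    (hlow.comp (continuous_coord 0).continuousOn hm)
  have h2 := (hup.comp (continuous_coord 0).continuousOn hm).sub
    (continuous_coord 1).continuousOn
  have h3 := (h1.isOpen_inter_preimage hU isOpen_Ioi (t := Ioi 0)).inter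
    (h2.isOpen_inter_preimage hU isOpen_Ioi (t := Ioi 0))
  convert h3 using 1
  ext q
  simp only [mem_ofPred_eq, mem_inter_iff, mem_preimage, mem_Ioi, Pi.sub_apply, Function.comp_apply, sub_pos]
  tauto

section

variable {𝓐 : Set Arc} (hfin : LocFin 𝓐) (hsu : ∀ A ∈ 𝓐, A.Slanted ∨ A.Upright)
  (hr : ∀ m n : ℤ, rung m n ∈ 𝓐)

include hsu hr in
theorem isStrip_of_consecutive {m n : ℤ} {α β : ℝ} (h : Consecutive (cuts 𝓐 m n) α β) :
    IsStrip 𝓐 α β n ((n : ℝ) + 1) where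
  lt := h.2.2.1
  le := by linarith
  slanted_or_upright := hsu
  bottom := ⟨rung m n, hr m n, fun p hp => (mem_rung.1 hp).2, fun x hx =>
    mem_rung.2 ⟨by simpa using ⟨h.1.1.1.trans hx.1, hx.2.trans h.2.1.1.2⟩, by simp⟩⟩
  top := ⟨rung m (n + 1), hr m (n + 1), fun p hp => by simpa using (mem_rung.1 hp).2,
    fun x hx => mem_rung.2
      ⟨by simpa using ⟨h.1.1.1.trans hx.1, hx.2.trans h.2.1.1.2⟩, by simp⟩⟩
  notMem_vertices := fun p hp0 hp1 hp => by
    rcases h.2.2.2 (p 0) ⟨⟨h.1.1.1.trans hp0.1.le, hp0.2.le.trans h.2.1.1.2⟩,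
      Or.inr (Or.inr (Or.inl ⟨p, hp, rfl, hp1⟩))⟩ with h1 | h1
    exacts [hp0.1.not_ge h1, hp0.2.not_ge h1]
  not_upright := fun A hA hu p hp hp0 hp1 => by
    rcases h.2.2.2 (p 0) ⟨⟨h.1.1.1.trans hp0.1.le, hp0.2.le.trans h.2.1.1.2⟩,
      Or.inr (Or.inr (Or.inr ⟨A, hA, hu, p, hp, rfl, hp1⟩))⟩ with h1 | h1
    exacts [hp0.1.not_ge h1, hp0.2.not_ge h1]

theorem mem_support_posts {m n : ℤ} {p : Plane} (h0 : p 0 ∈ cuts 𝓐 m n)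
    (h1 : p 1 ∈ Icc (n : ℝ) (n + 1)) : p ∈ support (posts 𝓐) :=
  mem_support.2 ⟨_, ⟨((m, n), p 0), h0, rfl⟩, mem_post.2 ⟨rfl, h1⟩⟩

theorem int_eq_of_mem {m m' : ℤ} {x : ℝ} (h : x ∈ Ioo (m : ℝ) (m + 1))
    (h' : x ∈ Icc (m' : ℝ) (m' + 1)) : m' = m := by
  have h1 : (m' : ℝ) < (m + 1 : ℤ) := by push_cast; exact h'.1.trans_lt h.2
  have h2 : (m : ℝ) < (m' + 1 : ℤ) := by push_cast; exact h.1.trans_le h'.2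
  have := Int.cast_lt.1 h1
  have := Int.cast_lt.1 h2
  omega

/-- A post through the interior of a unit square belongs to this square, so it stands over one of
its cuts. -/
theorem notMem_support_posts {m n : ℤ} {α β : ℝ} (h : Consecutive (cuts 𝓐 m n) α β) {p : Plane}
    (h0 : p 0 ∈ Ioo α β) (h1 : p 1 ∈ Ioo (n : ℝ) (n + 1)) : p ∉ support (posts 𝓐) := by
  intro hp
  obtain ⟨_, ⟨⟨⟨m', n'⟩, c⟩, hc, rfl⟩, hp⟩ := mem_support.1 hp
  obtain ⟨rfl, hp1⟩ := mem_post.1 hp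
  obtain rfl := int_eq_of_mem h1 hp1
  obtain rfl := int_eq_of_mem (m := m) ⟨h.1.1.1.trans_lt h0.1, h0.2.trans_le h.2.1.1.2⟩ hc.1
  rcases h.2.2.2 _ hc with h2 | h2
  exacts [h0.1.not_ge h2, h0.2.not_ge h2]

theorem support_union {𝓑 : Set Arc} {p : Plane} :
    p ∈ support (𝓐 ∪ 𝓑) ↔ p ∈ support 𝓐 ∨ p ∈ support 𝓑 := by
  simp only [mem_support, mem_union, or_and_right, exists_or]

include hfin hsu hr in
/-- A point off the arcs and posts lies in an open cell between two arcs. -/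
theorem exists_isCell_between {p : Plane} (hp : p ∉ support (𝓐 ∪ posts 𝓐)) :
    ∃ α ∈ cuts 𝓐 ⌊p 0⌋ ⌊p 1⌋, ∃ β ∈ cuts 𝓐 ⌊p 0⌋ ⌊p 1⌋,
      ∃ A ∈ 𝓐, (∃ q ∈ A.carrier, ‖q‖ ≤ 2 * ‖p‖ + 1) ∧
      ∃ B ∈ 𝓐, (∃ q ∈ B.carrier, ‖q‖ ≤ 2 * ‖p‖ + 1) ∧ p ∈ between A B α β ∧
        IsCell 2 (support (𝓐 ∪ posts 𝓐)) univ (between A B α β) := by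
  set m := ⌊p 0⌋
  set n := ⌊p 1⌋
  rw [support_union, not_or] at hp
  have hm : p 0 ∈ Icc (m : ℝ) (m + 1) := ⟨Int.floor_le _, (Int.lt_floor_add_one _).le⟩
  have hn : p 1 ∈ Icc (n : ℝ) (n + 1) := ⟨Int.floor_le _, (Int.lt_floor_add_one _).le⟩
  have hn' : p 1 ∈ Ioo (n : ℝ) (n + 1) := by
    refine ⟨lt_of_le_of_ne hn.1 fun h => hp.1 ?_, Int.lt_floor_add_one _⟩
    exact mem_support.2 ⟨_, hr m n, mem_rung.2 ⟨hm, h.symm⟩⟩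
  have hc : p 0 ∉ cuts 𝓐 m n := fun h => hp.2 (mem_support_posts h hn)
  have hle : (m : ℝ) ≤ m + 1 := by linarith
  have hmc : (m : ℝ) ∈ cuts 𝓐 m n := ⟨left_mem_Icc.2 hle, Or.inl rfl⟩
  have hmc' : (m : ℝ) + 1 ∈ cuts 𝓐 m n := ⟨right_mem_Icc.2 hle, Or.inr (Or.inl rfl)⟩
  obtain ⟨α, β, hcons, hαp, hpβ⟩ := exists_consecutive hmc hmc' hm.1 hm.2 hc
    ((hfin.finite_cuts m n).inter_of_left _)
  have hstrip := isStrip_of_consecutive hsu hr hcons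
  obtain ⟨A, hA, B, hB, hAs, hBs, low, up, hlow, hup, hlA, huB, hlp, hpu, hlu, hdisj⟩ :=
    hstrip.exists_between hfin (p := p) ⟨hαp, hpβ⟩ hn' hp.1
  have heq := between_eq hAs hBs (fun x hx => (hlA x hx).1) fun x hx => (huB x hx).1
  have hp0 : p 0 ∈ Icc α β := ⟨hαp.le, hpβ.le⟩
  -- The norm is at most `|p 0| + (|p 1| + 1)`. This bound keeps the two bounding arcs among
  -- finitely many when `p` ranges over a disc.
  have hnorm : ∀ y ∈ Icc (n : ℝ) (n + 1), ‖mkPt (p 0) y‖ ≤ 2 * ‖p‖ + 1 := fun y hy => by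
    have h1 := norm_le_abs_add_abs (mkPt (p 0) y)
    have h2 := abs_coord_le p
    have h3 : |y| ≤ |p 1| + 1 := by
      rw [abs_le]
      exact ⟨by linarith [neg_abs_le (p 1), hy.1, hn'.2], by linarith [le_abs_self (p 1), hy.2, hn.1]⟩
    simp only [mkPt_zero, mkPt_one] at h1
    linarith
  refine ⟨α, hcons.1, β, hcons.2.1, A, hA, ⟨_, (hlA _ hp0).1, hnorm _ (hlA _ hp0).2⟩, B, hB,
    ⟨_, (huB _ hp0).1, hnorm _ (huB _ hp0).2⟩, ?_, ?_⟩
  · rw [heq]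
    exact ⟨⟨hαp, hpβ⟩, hlp, hpu⟩
  rw [heq]
  have hsub : {q : Plane | q 0 ∈ Ioo α β ∧ low (q 0) < q 1 ∧ q 1 < up (q 0)} ⊆
      univ \ support (𝓐 ∪ posts 𝓐) := by
    rintro q ⟨hq0, hq1, hq2⟩
    refine ⟨trivial, ?_⟩
    rw [support_union, not_or]
    have hq0' := Ioo_subset_Icc_self hq0
    exact ⟨hdisj q hq0 hq1 hq2, notMem_support_posts hcons hq0
      ⟨(hlA _ hq0').2.1.trans_lt hq1, hq2.trans_le (huB _ hq0').2.2⟩⟩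
  refine ⟨?_, hsub, _, isOpen_band hlow hup, inter_eq_left.2 hsub⟩
  refine hasCharMap_band hcons.2.2.1 hlow hup hlu (fun x hx => (hlA x hx).2)
    (fun x hx => (huB x hx).2) (fun x hx => ?_) (fun x hx => ?_) (fun y hy => ?_) fun y hy => ?_
  · exact support_union.2 (Or.inl (mem_support.2 ⟨A, hA, (hlA x hx).1⟩))
  · exact support_union.2 (Or.inl (mem_support.2 ⟨B, hB, (huB x hx).1⟩))
  · exact support_union.2 (Or.inr (mem_support_posts (by simpa using hcons.1) (by simpa using hy)))
  · exact support_union.2 (Or.inr (mem_support_posts (by simpa using hcons.2.1) (by simpa using hy)))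

-- A 2-cell is given by a unit square, two of its cuts and two arcs; for points of a disc there are
-- finitely many choices.
include hfin hsu hr in
theorem exists_cover_two (R : ℝ) : ∃ F : Set (Set Plane), F.Finite ∧
    (∀ e ∈ F, IsCell 2 (support (𝓐 ∪ posts 𝓐)) univ e) ∧
      ∀ p ∈ univ \ support (𝓐 ∪ posts 𝓐), ‖p‖ ≤ R → ∃ e ∈ F, p ∈ e := by
  set N : Set Arc := {A ∈ 𝓐 | ∃ q ∈ A.carrier, ‖q‖ ≤ 2 * R + 1}
  set Z : Set ℤ := {n : ℤ | ∃ x : ℝ, x ∈ Icc (n : ℝ) (n + 1) ∧ |x| ≤ R}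
  have hfloor : ∀ x : ℝ, |x| ≤ R → ⌊x⌋ ∈ Z := fun x hx =>
    ⟨x, ⟨Int.floor_le _, (Int.lt_floor_add_one _).le⟩, hx⟩
  have hG : (⋃ m ∈ Z, ⋃ n ∈ Z, ⋃ α ∈ cuts 𝓐 m n, ⋃ β ∈ cuts 𝓐 m n, ⋃ A ∈ N, ⋃ B ∈ N,
      {between A B α β}).Finite :=
    (finite_int_of_near R).biUnion fun m _ => (finite_int_of_near R).biUnion fun n _ =>
      (hfin.finite_cuts m n).biUnion fun α _ => (hfin.finite_cuts m n).biUnion fun β _ =>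
        (hfin _).biUnion fun A _ => (hfin _).biUnion fun B _ => finite_singleton _
  refine ⟨_, hG.inter_of_left {e | IsCell 2 (support (𝓐 ∪ posts 𝓐)) univ e},
    fun e he => he.2, ?_⟩
  rintro p ⟨-, hp⟩ hpR
  obtain ⟨α, hα, β, hβ, A, hA, ⟨q, hq, hqR⟩, B, hB, ⟨r, hr, hrR⟩, hpe, he⟩ :=
    exists_isCell_between hfin hsu hr hp
  refine ⟨_, ⟨?_, he⟩, hpe⟩
  simp only [mem_iUnion]
  exact ⟨_, hfloor _ ((abs_coord_le p).1.trans hpR), _, hfloor _ ((abs_coord_le p).2.trans hpR),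
    α, hα, β, hβ, A, ⟨hA, q, hq, by linarith⟩, B, ⟨hB, r, hr, by linarith⟩, rfl⟩

end


/-! ### Cutting arcs into slanted and upright pieces -/

/-- The abscissa is a polynomial in the parameter. By Rolle, if it is not constant, two parameters
with equal abscissae are separated by one of the finitely many roots of its derivative. -/
theorem Arc.upright_or_finite_critical (A : Arc) : A.Upright ∨
    ∃ Z : Set ℝ, Z.Finite ∧ ∀ v w, v < w → A.pt v 0 = A.pt w 0 → ∃ u ∈ Ioo v w, u ∈ Z := by
  have hp : IsPoly fun u => A.pt u 0 := isPoly_graphPt_zero A.poly A.ang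
  obtain ⟨P, hP⟩ := hp
  beta_reduce at hP
  by_cases h0 : P.derivative = 0
  · left
    have hc : P = C (P.coeff 0) := eq_C_of_derivative_eq_zero h0
    rintro _ ⟨u, -, rfl⟩ _ ⟨v, -, rfl⟩
    rw [← hP u, ← hP v, hc, eval_C, eval_C]
  · right
    refine ⟨P.derivative.rootSet ℝ, rootSet_finite _ _, fun v w hvw h => ?_⟩
    obtain ⟨u, hu, hu0⟩ := exists_deriv_eq_zero (f := fun u => P.eval u) hvw
      P.continuous.continuousOn (by simpa only [hP] using h)
    refine ⟨u, hu, (mem_rootSet.2 ⟨h0, ?_⟩)⟩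
    rw [Polynomial.deriv] at hu0
    simpa using hu0

theorem Arc.exists_pieces (A : Arc) : ∃ F : Set Arc, F.Finite ∧
    (∀ B ∈ F, B.Slanted ∨ B.Upright) ∧ ⋃ B ∈ F, B.carrier = A.carrier := by
  rcases A.upright_or_finite_critical with hA | ⟨Z, hZ, hroll⟩
  · exact ⟨{A}, finite_singleton A, fun B hB => Or.inr (hB ▸ hA), by simp⟩
  set W : Set ℝ := {A.lo, A.hi} ∪ Z ∩ Icc A.lo A.hi
  have hW : W.Finite := (toFinite _).union (hZ.inter_of_left _)
  -- The case `v = w` is allowed: the covering argument uses the degenerate piece at a parameter in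
  -- `W`.
  refine ⟨{B | ∃ v ∈ W, ∃ w ∈ W, A.lo ≤ v ∧ w ≤ A.hi ∧ (∀ u ∈ Ioo v w, u ∉ W) ∧ A.sub v w = B},
    (hW.image2 A.sub hW).subset ?_, ?_, Subset.antisymm ?_ ?_⟩
  · rintro B ⟨v, hv, w, hw, -, -, -, rfl⟩
    exact ⟨v, hv, w, hw, rfl⟩
  · rintro B ⟨v, hv, w, hw, hlo, hhi, huW, rfl⟩
    left
    have key : ∀ a ∈ Icc v w, ∀ b ∈ Icc v w, a < b → A.pt a 0 ≠ A.pt b 0 := by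
      intro a ha b hb hab h
      obtain ⟨u, hu, huZ⟩ := hroll a b hab h
      have hu' : u ∈ Ioo v w := ⟨ha.1.trans_lt hu.1, hu.2.trans_le hb.2⟩
      exact huW u hu' (Or.inr ⟨huZ, hlo.trans hu'.1.le, hu'.2.le.trans hhi⟩)
    rintro _ ⟨a, ha, rfl⟩ _ ⟨b, hb, rfl⟩ h
    rcases lt_trichotomy a b with hab | rfl | hab
    · exact absurd h (key a ha b hb hab)
    · rfl
    · exact absurd h.symm (key b hb a ha hab)
  · refine iUnion₂_subset ?_
    rintro B ⟨v, hv, w, hw, hlo, hhi, -, rfl⟩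
    exact image_mono (Icc_subset_Icc hlo hhi)
  · rintro _ ⟨u, hu, rfl⟩
    obtain ⟨v, hv, hvmax⟩ := (hW.inter_of_left (Iic u)).exists_maximalFor id _
      ⟨A.lo, Or.inl (Or.inl rfl), hu.1⟩
    obtain ⟨w, hw, hwmin⟩ := (hW.inter_of_left (Ici u)).exists_minimalFor id _
      ⟨A.hi, Or.inl (Or.inr rfl), hu.2⟩
    have hvu : v ≤ u := hv.2
    have huw : u ≤ w := hw.2
    have hlohi := hu.1.trans hu.2
    have hWI : ∀ x ∈ W, x ∈ Icc A.lo A.hi := by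
      rintro x ((rfl | rfl) | hx)
      exacts [left_mem_Icc.2 hlohi, right_mem_Icc.2 hlohi, hx.2]
    refine mem_iUnion₂.2 ⟨A.sub v w, ⟨v, hv.1, w, hw.1, (hWI v hv.1).1, (hWI w hw.1).2, ?_, rfl⟩,
      mem_image_of_mem _ ⟨hvu, huw⟩⟩
    intro x hx hxW
    rcases le_total x u with h1 | h1
    · exact hx.1.not_ge (hvmax ⟨hxW, h1⟩ hx.1.le)
    · exact hx.2.not_ge (hwmin ⟨hxW, h1⟩ hx.2.le)

theorem slanted_rung (m n : ℤ) : (rung m n).Slanted :=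
  fun _ hp _ hq h => plane_ext h ((mem_rung.1 hp).2.trans (mem_rung.1 hq).2.symm)

/-- A locally finite family of arcs is contained in the 1-skeleton of a decomposition of the plane
whose cells are not cut by the arcs. -/
theorem LocFin.exists_decomposition {𝓑 : Set Arc} (h𝓑 : LocFin 𝓑) :
    ∃ (D : PlaneDecomposition) (𝓐 : Set Arc), LocFin 𝓐 ∧ D.skel 1 = vertices 𝓐 ∧
      D.skel 2 = support 𝓐 ∧
      ∀ n, ∀ e ∈ D.cells n, ∀ B ∈ 𝓑, e ⊆ B.carrier ∨ Disjoint e B.carrier := by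
  choose F hFfin hFsu hFc using Arc.exists_pieces
  set 𝓒 : Set Arc := ⋃ B ∈ 𝓑, F B
  have h𝓒 : LocFin 𝓒 := fun R => by
    refine ((h𝓑 R).biUnion fun B _ => hFfin B).subset ?_
    rintro A ⟨hA, p, hp, hpR⟩
    simp only [mem_iUnion]
    obtain ⟨B, hB, hAB⟩ := mem_iUnion₂.1 hA
    exact ⟨B, ⟨hB, p, (hFc B).subset (mem_iUnion₂.2 ⟨A, hAB, hp⟩), hpR⟩, hAB⟩
  have h𝓓 := locFin_withRungs h𝓒
  have hsu : ∀ A ∈ withRungs 𝓒, A.Slanted ∨ A.Upright := by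
    rintro A (hA | ⟨i, -, rfl⟩)
    · obtain ⟨B, hB, hAB⟩ := mem_iUnion₂.1 hA
      exact hFsu B A hAB
    · exact Or.inl (slanted_rung _ _)
  -- The posts create new vertices, but the 2-cells depend only on the union of arcs and posts, so
  -- no further posts are needed.
  set 𝓐 : Set Arc := withRungs 𝓒 ∪ posts (withRungs 𝓒)
  have h𝓐 : LocFin 𝓐 := h𝓓.union (locFin_posts h𝓓)
  let sk : ℕ → Set Plane
    | 0 => ∅
    | 1 => vertices 𝓐
    | 2 => support 𝓐
    | _ + 3 => univ
  let D : PlaneDecomposition :=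
    { skel := sk
      skel_zero := rfl
      skel_three := rfl
      skel_mono := monotone_nat_of_le_succ fun n => match n with
        | 0 => empty_subset _
        | 1 => vertices_subset
        | 2 => subset_univ _
        | _ + 3 => Subset.rfl
      exists_cover := fun n _ R => match n with
        | 0 => h𝓐.exists_cover_zero R
        | 1 => h𝓐.exists_cover_one R
        | 2 => exists_cover_two h𝓓 hsu (rung_mem_withRungs 𝓒) R
        | _ + 3 => absurd ‹_› (by omega) }
  refine ⟨D, 𝓐, h𝓐, rfl, rfl, ?_⟩
  have hpiece : ∀ B ∈ 𝓑, ∀ A ∈ F B, A ∈ 𝓐 := fun B hB A hA =>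
    Or.inl (Or.inl (mem_iUnion₂.2 ⟨B, hB, hA⟩))
  have hsupp : ∀ B ∈ 𝓑, B.carrier ⊆ support 𝓐 := fun B hB p hp => by
    obtain ⟨A, hA, hpA⟩ := mem_iUnion₂.1 ((hFc B).superset hp)
    exact mem_support.2 ⟨A, hpiece B hB A hA, hpA⟩
  intro n e he B hB
  obtain ⟨hn, he⟩ := he
  match n, hn with
  | 0, _ =>
    have hsub : e.Subsingleton := by
      obtain ⟨φ, -, -, -, rfl, -⟩ := he.hasCharMap
      exact (Set.subsingleton_of_subsingleton (s := Metric.ball (0 : Fin 0 → ℝ) 1)).image _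
    rw [or_iff_not_imp_right]
    intro hd
    obtain ⟨p, hpe, hpB⟩ := Set.not_disjoint_iff.1 hd
    exact fun q hq => (hsub hq hpe) ▸ hpB
  | 1, _ =>
    rw [or_iff_not_imp_right]
    intro hd
    obtain ⟨p, hpe, hpB⟩ := Set.not_disjoint_iff.1 hd
    obtain ⟨A, hA, hpA⟩ := mem_iUnion₂.1 ((hFc B).superset hpB)
    refine Subset.trans ?_ ((subset_iUnion₂ (s := fun A _ => A.carrier) A hA).trans (hFc B).subset)
    exact (h𝓐.subset_or_disjoint (hpiece B hB A hA) he.hasCharMap.isPreconnected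
      he.subset).resolve_right (Set.not_disjoint_iff.2 ⟨p, hpe, hpA⟩)
  | 2, _ =>
    exact Or.inr (Set.disjoint_left.2 fun p hp hpB => (he.subset hp).2 (hsupp B hB hpB))


/-! ### Bricks -/

theorem lt_of_isPreconnected {T : Type*} [TopologicalSpace T] {s : Set T} (hs : IsPreconnected s)
    {g h : T → ℝ} (hg : Continuous g) (hh : Continuous h) (hne : ∀ q ∈ s, g q ≠ h q) {p : T}
    (hp : p ∈ s) (hlt : g p < h p) : ∀ q ∈ s, g q < h q := by
  intro q hq
  by_contra! hle
  have := (hs.image (fun t => g t - h t) (hg.sub hh).continuousOn).ordConnected.out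
    (mem_image_of_mem _ hp) (mem_image_of_mem _ hq) ⟨sub_nonpos.2 hlt.le, sub_nonneg.2 hle⟩
  obtain ⟨r, hr, hr0⟩ := this
  exact hne r hr (sub_eq_zero.1 hr0)

/-! ### Cut points, levels and heights -/

section CutPoints

variable {f : ℝ[X]}

theorem IsStrictInflection.eval_eq_zero {x : ℝ} (h : IsStrictInflection f x) :
    f.derivative.derivative.eval x = 0 := by
  have hl : Filter.Tendsto (fun t => f.derivative.derivative.eval t) (nhdsWithin x (Iio x))
    (nhds (f.derivative.derivative.eval x)) :=
    f.derivative.derivative.continuous.continuousAt.tendsto.mono_left nhdsWithin_le_nhds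
  have hr : Filter.Tendsto (fun t => f.derivative.derivative.eval t) (nhdsWithin x (Ioi x))
    (nhds (f.derivative.derivative.eval x)) :=
    f.derivative.derivative.continuous.continuousAt.tendsto.mono_left nhdsWithin_le_nhds
  rcases h with ⟨h1, h2⟩ | ⟨h1, h2⟩
  · exact le_antisymm (le_of_tendsto hl (h1.mono fun _ h => h.le))
      (ge_of_tendsto hr (h2.mono fun _ h => h.le))
  · exact le_antisymm (le_of_tendsto hr (h2.mono fun _ h => h.le))
      (ge_of_tendsto hl (h1.mono fun _ h => h.le))

variable (f) in
theorem finite_cutPoints (lo hi : ℝ) : (cutPoints f ∩ Icc lo hi).Finite := by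
  have hZ : ((fun n : ℤ => (n : ℝ)) '' Icc ⌈lo⌉ ⌊hi⌋).Finite := (finite_Icc _ _).image _
  by_cases hd : 2 ≤ f.natDegree
  · have h1 : f.derivative ≠ 0 := fun h => by
      have := derivative_eq_zero.1 h
      omega
    have h2 : f.derivative.derivative ≠ 0 := fun h => by
      have := derivative_eq_zero.1 h
      have := natDegree_derivative f
      omega
    refine (hZ.union ((rootSet_finite f.derivative.derivative ℝ).union
      (rootSet_finite f.derivative ℝ))).subset ?_
    rintro x ⟨⟨n, rfl⟩ | ⟨-, hx | hx⟩, hlo, hhi⟩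
    · exact Or.inl ⟨n, ⟨Int.ceil_le.2 hlo, Int.le_floor.2 hhi⟩, rfl⟩
    · exact Or.inr (Or.inl (mem_rootSet.2 ⟨h2, by simpa using hx.eval_eq_zero⟩))
    · refine Or.inr (Or.inr (mem_rootSet.2 ⟨h1, ?_⟩))
      have := hx.deriv_eq_zero
      rw [Polynomial.deriv] at this
      simpa using this
  · refine hZ.subset ?_
    rintro x ⟨⟨n, rfl⟩ | ⟨h, -⟩, hlo, hhi⟩
    · exact ⟨n, ⟨Int.ceil_le.2 hlo, Int.le_floor.2 hhi⟩, rfl⟩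
    · exact absurd h hd

theorem intCast_mem_cutPoints (n : ℤ) : (n : ℝ) ∈ cutPoints f := Or.inl ⟨n, rfl⟩

theorem consecutive_le_add_one {a b : ℝ} (h : Consecutive (cutPoints f) a b) : b ≤ a + 1 := by
  rcases h.2.2.2 _ (intCast_mem_cutPoints (⌊a⌋ + 1)) with h1 | h1
  · push_cast at h1
    linarith [Int.lt_floor_add_one a]
  · push_cast at h1
    linarith [Int.floor_le a]

variable (f) in
theorem exists_consecutive_cutPoints (x : ℝ) :
    ∃ a b, Consecutive (cutPoints f) a b ∧ x ∈ Ico a b := by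
  by_cases hx : x ∈ cutPoints f
  · have hlt : x < ⌊x⌋ + 1 := Int.lt_floor_add_one x
    have hmem : (⌊x⌋ : ℝ) + 1 ∈ cutPoints f := by
      exact_mod_cast intCast_mem_cutPoints (f := f) (⌊x⌋ + 1)
    obtain ⟨b, hb, hbmin⟩ := ((finite_cutPoints f x (⌊x⌋ + 1)).inter_of_left
      (Ioi x)).exists_minimalFor id _ ⟨_, ⟨hmem, hlt.le, le_rfl⟩, hlt⟩
    have hxb : x < b := hb.2
    refine ⟨x, b, ⟨hx, hb.1.1, hxb, fun c hc => ?_⟩, le_rfl, hxb⟩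
    by_contra! h
    exact h.2.not_ge (hbmin ⟨⟨hc, h.1.le, h.2.le.trans hb.1.2.2⟩, h.1⟩ h.2.le)
  · obtain ⟨a, b, hab, h⟩ := exists_consecutive (intCast_mem_cutPoints ⌊x⌋)
      (intCast_mem_cutPoints ⌈x⌉) (Int.floor_le x) (Int.le_ceil x) hx (finite_cutPoints f _ _)
    exact ⟨a, b, hab, Ioo_subset_Ico_self h⟩

end CutPoints

section Level

variable {f : ℝ[X]} {a b x : ℝ}

/-- The levels sink to minus infinity. Hence the edges are locally finite and the bricks exhaust the
part of the strip below the graph. -/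
theorem level_le (hx : x ∈ Icc a b) (j : ℕ) : level f a b j x ≤ f.eval x - j := by
  unfold level
  split_ifs with h1 h2
  · simp [h1]
  · rfl
  · exact sub_le_sub_right (csInf_le (isCompact_Icc.image f.continuous).bddBelow
      (mem_image_of_mem _ hx)) _

theorem level_zero : level f a b 0 x = f.eval x := by simp [level]

theorem exists_level_lt (hx : x ∈ Icc a b) (y : ℝ) : ∃ j, level f a b j x < y := by
  obtain ⟨j, hj⟩ := exists_nat_gt (f.eval x - y)
  exact ⟨j, (level_le hx j).trans_lt (by linarith)⟩

theorem exists_level_between (hx : x ∈ Icc a b) {y : ℝ} (hy : y ≤ f.eval x)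
    (hne : ∀ j, y ≠ level f a b j x) :
    ∃ j, level f a b (j + 1) x < y ∧ y < level f a b j x := by
  classical
  have hex := exists_level_lt (f := f) hx y
  rcases h : Nat.find hex with - | j
  · have := Nat.find_spec hex
    rw [h, level_zero] at this
    exact absurd hy this.not_ge
  · refine ⟨j, h ▸ Nat.find_spec hex, lt_of_le_of_ne (not_lt.1 ?_) (hne j)⟩
    exact Nat.find_min hex (by omega)

end Level

section Heights

variable {f : ℝ[X]} {c : ℝ}

/-- The intervals ending at `c` have length at most `1`, so their ends are among finitely many cut
points; `level_le` bounds the index of the edge. -/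
theorem finite_heights (f : ℝ[X]) (c y : ℝ) : (heights f c ∩ Ici y).Finite := by
  have hfin := finite_cutPoints f (c - 1) (c + 1)
  refine ((hfin.prod (hfin.prod (finite_Iic ⌊f.eval c - y⌋₊))).image
    (fun t : ℝ × ℝ × ℕ => level f t.1 t.2.1 t.2.2 c)).subset ?_
  rintro z ⟨⟨a, b, hab, hc, j, rfl⟩, hz⟩
  have hlt := hab.2.2.1
  have hle := consecutive_le_add_one hab
  have hcI : c ∈ Icc a b := by rcases hc with rfl | rfl <;> constructor <;> linarith
  refine ⟨(a, b, j), ⟨⟨hab.1, ?_⟩, ⟨hab.2.1, ?_⟩, ?_⟩, rfl⟩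
  · constructor <;> linarith [hcI.1, hcI.2]
  · constructor <;> linarith [hcI.1, hcI.2]
  · have h1 := level_le (f := f) hcI j
    exact Nat.le_floor (by linarith [mem_Ici.1 hz])

theorem exists_consecutive_heights (hc : c ∈ cutPoints f) {y : ℝ} (hy : y ≤ f.eval c)
    (hyH : y ∉ heights f c) : ∃ z w, Consecutive (heights f c) z w ∧ y ∈ Ioo z w := by
  obtain ⟨a, b, hab, hcab⟩ := exists_consecutive_cutPoints f c
  have hca : c = a := by
    rcases hab.2.2.2 c hc with h | h
    exacts [le_antisymm h hcab.1, absurd hcab.2 h.not_gt]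
  have hmem : ∀ j, level f a b j c ∈ heights f c := fun j => ⟨a, b, hab, Or.inl hca, j, rfl⟩
  obtain ⟨j, hj⟩ := exists_level_lt (f := f) (Ico_subset_Icc_self hcab) y
  have htop := hmem 0
  rw [level_zero] at htop
  exact exists_consecutive (hmem j) htop hj.le hy hyH ((finite_heights f c (level f a b j c)).subset
    (inter_subset_inter_right _ Icc_subset_Ici_self))

end Heights

/-- The polynomial whose graph carries the `j`-th edge between `a` and `b`. -/
def levelPoly (f : ℝ[X]) (a b : ℝ) (j : ℕ) : ℝ[X] :=
  if j = 0 then f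
  else if f.natDegree ≤ 1 then f - C (j : ℝ)
  else C (sInf ((fun t => f.eval t) '' Icc a b) - j)

theorem eval_levelPoly (f : ℝ[X]) (a b : ℝ) (j : ℕ) (x : ℝ) :
    (levelPoly f a b j).eval x = level f a b j x := by
  unfold levelPoly level
  split_ifs <;> simp

/-- The closed edge number `j` between `a` and `b`. -/
def edgeArc (f : ℝ[X]) (θ a b : ℝ) (j : ℕ) : Arc := ⟨levelPoly f a b j, θ, a, b⟩

theorem mem_edgeArc {f : ℝ[X]} {θ a b : ℝ} {j : ℕ} {p : Plane} : p ∈ (edgeArc f θ a b j).carrier ↔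
    (frame θ p).1 ∈ Icc a b ∧ (frame θ p).2 = level f a b j (frame θ p).1 := by
  rw [Arc.mem_carrier_iff_eval]
  simp only [edgeArc, eval_levelPoly]

/-- The arcs which separate the bricks, and the vertical lines above the graph. -/
def brickArcs (f : ℝ[X]) (θ : ℝ) : Set Arc :=
  (fun i : ℝ × ℤ => Arc.wall θ i.1 i.2 (i.2 + 1)) '' {i | i.1 ∈ cutPoints f} ∪
    (fun i : (ℝ × ℝ) × ℕ => edgeArc f θ i.1.1 i.1.2 i.2) ''
      {i | Consecutive (cutPoints f) i.1.1 i.1.2}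

theorem locFin_brickArcs (f : ℝ[X]) (θ : ℝ) : LocFin (brickArcs f θ) := by
  refine (locFin_of_index fun R => ?_).union (locFin_of_index fun R => ?_)
  · refine ((finite_cutPoints f (-R) R).prod (finite_int_of_near R)).subset ?_
    rintro ⟨c, n⟩ ⟨hc, p, hp, hpR⟩
    obtain ⟨h1, h2⟩ := Arc.mem_wall.1 hp
    have h3 := abs_le.1 ((abs_frame_fst_le θ p).trans hpR)
    exact ⟨⟨hc, h1 ▸ h3⟩, _, h2, (abs_frame_snd_le θ p).trans hpR⟩
  · obtain ⟨M, hM⟩ := (isCompact_Icc (a := -R) (b := R)).exists_bound_of_continuousOn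
      f.continuous.continuousOn
    have hfin := finite_cutPoints f (-R - 1) (R + 1)
    refine ((hfin.prod hfin).prod (finite_Iic ⌊M + R⌋₊)).subset ?_
    rintro ⟨⟨a, b⟩, j⟩ ⟨hab, p, hp, hpR⟩
    obtain ⟨h1, h2⟩ := mem_edgeArc.1 hp
    have h3 := abs_le.1 ((abs_frame_fst_le θ p).trans hpR)
    have h4 := abs_le.1 ((abs_frame_snd_le θ p).trans hpR)
    have h5 := consecutive_le_add_one hab
    have h6 := level_le (f := f) h1 j
    have h7 := (abs_le.1 (hM _ h3)).2
    have h8 := hab.2.2.1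
    simp only at h5 h8
    refine ⟨⟨⟨hab.1, ?_⟩, ⟨hab.2.1, ?_⟩⟩, Nat.le_floor ?_⟩
    · constructor <;> simp only <;> linarith [h1.1, h1.2]
    · constructor <;> simp only <;> linarith [h1.1, h1.2]
    · linarith

/-! ### Connected sets that are not cut by the arcs -/

section Uncut

variable {f : ℝ[X]} {θ : ℝ} {e : Set Plane} (he : IsPreconnected e)
  (hB : ∀ B ∈ brickArcs f θ, e ⊆ B.carrier ∨ Disjoint e B.carrier)

include hB

theorem subset_of_mem_brickArcs {B : Arc} (hBm : B ∈ brickArcs f θ) {p : Plane} (hp : p ∈ e)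
    (hpB : p ∈ B.carrier) : e ⊆ B.carrier :=
  (hB B hBm).resolve_right (Set.not_disjoint_iff.2 ⟨p, hp, hpB⟩)

/-- The unit walls fill the whole vertical line, above the graph as well, so an uncut set with a
point on this line stays on it. -/
theorem forall_fst_eq {p : Plane} (hp : p ∈ e) (hc : (frame θ p).1 ∈ cutPoints f) :
    ∀ q ∈ e, (frame θ q).1 = (frame θ p).1 := by
  have := subset_of_mem_brickArcs hB (B := Arc.wall θ (frame θ p).1 ⌊(frame θ p).2⌋
    (⌊(frame θ p).2⌋ + 1)) (Or.inl ⟨(_, _), hc, rfl⟩) hp (Arc.mem_wall.2 ⟨rfl, Int.floor_le _,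
      (Int.lt_floor_add_one _).le⟩)
  exact fun q hq => (Arc.mem_wall.1 (this hq)).1

theorem forall_mem_edgeArc {a b : ℝ} {j : ℕ} (hab : Consecutive (cutPoints f) a b) {p : Plane}
    (hp : p ∈ e) (hpI : (frame θ p).1 ∈ Icc a b)
    (hpl : (frame θ p).2 = level f a b j (frame θ p).1) :
    ∀ q ∈ e, (frame θ q).1 ∈ Icc a b ∧ (frame θ q).2 = level f a b j (frame θ q).1 := by
  have := subset_of_mem_brickArcs hB (B := edgeArc f θ a b j) (Or.inr ⟨((a, b), j), hab, rfl⟩) hp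
    (mem_edgeArc.2 ⟨hpI, hpl⟩)
  exact fun q hq => mem_edgeArc.1 (this hq)

include he

/-- A connected set which is not cut by the arcs lies in the half plane or in its complement. -/
theorem subset_halfPlane {p : Plane} (hp : p ∈ e) (hpX : p ∈ halfPlane f θ) : e ⊆ halfPlane f θ := by
  have hzero : ∀ r ∈ e, side f θ r = 0 → ∀ q ∈ e, side f θ q = 0 := by
    intro r hr hr0 q hq
    obtain ⟨a, b, hab, hI⟩ := exists_consecutive_cutPoints f (frame θ r).1
    have := forall_mem_edgeArc hB (j := 0) hab hr (Ico_subset_Icc_self hI)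
      (by rw [level_zero]; exact (sub_eq_zero.1 hr0).symm) q hq
    rw [level_zero] at this
    exact sub_eq_zero.2 this.2.symm
  intro q hq
  rw [mem_halfPlane] at hpX ⊢
  by_cases h : ∃ r ∈ e, side f θ r = 0
  · obtain ⟨r, hr, hr0⟩ := h
    exact (hzero r hr hr0 q hq).ge
  · push Not at h
    exact (lt_of_isPreconnected he continuous_const (continuous_side f θ)
      (fun r hr => (h r hr).symm) hp (hpX.lt_of_ne (h p hp).symm) q hq).le

/-- A connected subset of the half plane which is not cut by the arcs lies in a brick cell. -/
theorem exists_isBrickCell (hne : e.Nonempty) (heX : e ⊆ halfPlane f θ) :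
    ∃ c, IsBrickCell f c ∧ e ⊆ frame θ ⁻¹' c := by
  obtain ⟨p, hp⟩ := hne
  have hpf : (frame θ p).2 ≤ f.eval (frame θ p).1 := sub_nonneg.1 (heX hp)
  have hu := (continuous_frame θ).fst
  have hv := (continuous_frame θ).snd
  by_cases hc : (frame θ p).1 ∈ cutPoints f
  · have hfst := forall_fst_eq hB hp hc
    have hend : ∀ {a b : ℝ}, Consecutive (cutPoints f) a b →
        (frame θ p).1 = a ∨ (frame θ p).1 = b → (frame θ p).1 ∈ Icc a b := by
      rintro a b hab (h | h)
      · exact h ▸ left_mem_Icc.2 (h ▸ hab.2.2.1.le)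
      · exact h ▸ right_mem_Icc.2 (h ▸ hab.2.2.1.le)
    -- Each height is the end of a closed edge on the left or on the right. An uncut subset of the
    -- vertical line through this end lies on the edge, hence at one height.
    have hkey : ∀ r ∈ e, (frame θ r).2 ∈ heights f (frame θ p).1 →
        ∀ q ∈ e, (frame θ q).2 = (frame θ r).2 := by
      rintro r hr ⟨a, b, hab, hor, j, hj⟩ q hq
      have := (forall_mem_edgeArc hB (j := j) hab hr (by rw [hfst r hr]; exact hend hab hor)
        (by rw [hj, hfst r hr]) q hq).2
      rw [this, hj, hfst q hq]
    by_cases hh : (frame θ p).2 ∈ heights f (frame θ p).1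
    · exact ⟨_, .vertex _ _ hc hh, fun q hq => Prod.ext (hfst q hq) (hkey p hp hh q hq)⟩
    · obtain ⟨y, z, hyz, hpy, hpz⟩ := exists_consecutive_heights hc hpf hh
      have hno : ∀ q ∈ e, (frame θ q).2 ∉ heights f (frame θ p).1 := fun q hq hq' =>
        hh (by rw [hkey q hq hq' p hp]; exact hq')
      refine ⟨_, .wall _ y z hc hyz, fun q hq => ⟨hfst q hq, ?_, ?_⟩⟩
      · exact lt_of_isPreconnected he continuous_const hv
          (fun r hr h => hno r hr (by rw [← h]; exact hyz.1)) hp hpy q hq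
      · exact lt_of_isPreconnected he hv continuous_const
          (fun r hr h => hno r hr (by rw [h]; exact hyz.2.1)) hp hpz q hq
  · have hno : ∀ q ∈ e, (frame θ q).1 ∉ cutPoints f := fun q hq hq' =>
      hc (by rw [forall_fst_eq hB hq hq' p hp]; exact hq')
    obtain ⟨a, b, hab, hpI⟩ := exists_consecutive_cutPoints f (frame θ p).1
    have hap : a < (frame θ p).1 := hpI.1.lt_of_ne fun h => hc (by rw [← h]; exact hab.1)
    have ha := lt_of_isPreconnected he continuous_const hu
      (fun r hr h => hno r hr (by rw [← h]; exact hab.1)) hp hap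
    have hb := lt_of_isPreconnected he hu continuous_const
      (fun r hr h => hno r hr (by rw [h]; exact hab.2.1)) hp hpI.2
    have hI : ∀ q ∈ e, (frame θ q).1 ∈ Icc a b := fun q hq => ⟨(ha q hq).le, (hb q hq).le⟩
    by_cases hl : ∃ j, (frame θ p).2 = level f a b j (frame θ p).1
    · obtain ⟨j, hj⟩ := hl
      exact ⟨_, .edge a b j hab, fun q hq => ⟨ha q hq, hb q hq,
        (forall_mem_edgeArc hB hab hp (hI p hp) hj q hq).2⟩⟩
    · push Not at hl
      obtain ⟨j, hj1, hj0⟩ := exists_level_between (hI p hp) hpf hl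
      have hno' : ∀ j, ∀ q ∈ e, (frame θ q).2 ≠ level f a b j (frame θ q).1 := fun j q hq h =>
        hl j (forall_mem_edgeArc hB hab hq (hI q hq) h p hp).2
      have hcont : ∀ j, Continuous fun q : Plane => level f a b j (frame θ q).1 := fun j => by
        simp only [← eval_levelPoly]
        exact (levelPoly f a b j).continuous.comp hu
      exact ⟨_, .brick a b j hab, fun q hq => ⟨ha q hq, hb q hq,
        lt_of_isPreconnected he (hcont (j + 1)) hv (fun r hr => (hno' (j + 1) r hr).symm) hp hj1 q hq,
        lt_of_isPreconnected he hv (hcont j) (hno' j) hp hj0 q hq⟩⟩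

end Uncut


/-! ### Shortest curves and cells -/

variable {k : ℕ} {f : Fin k → ℝ[X]} {θ : Fin k → ℝ} {A B : Plane} {a b : ℝ} {γ : ℝ → Plane}

theorem isClosed_iInter_halfPlane (f : Fin k → ℝ[X]) (θ : Fin k → ℝ) :
    IsClosed (⋂ i, halfPlane (f i) (θ i)) :=
  isClosed_iInter fun i => isClosed_le continuous_const (continuous_side (f i) (θ i))

theorem IsShortestCurve.exists_norm_le {X : Set Plane} (h : IsShortestCurve X A B a b γ) :
    ∃ R : ℝ, ∀ t ∈ Icc a b, ‖γ t‖ ≤ R := by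
  obtain ⟨R, hR⟩ := (isCompact_Icc.image_of_continuousOn h.1.continuousOn).isBounded.exists_norm_le
  exact ⟨R, fun t ht => hR _ (mem_image_of_mem _ ht)⟩

theorem IsShortestCurve.tame_support (h : IsShortestCurve (⋂ i, halfPlane (f i) (θ i)) A B a b γ)
    {𝓐 : Set Arc} (hA : LocFin 𝓐) : Tame {t | t ∈ Icc a b ∧ γ t ∈ support 𝓐} := by
  obtain ⟨R, hR⟩ := h.exists_norm_le
  convert Tame.biUnion (hA R) fun E _ => h.tame_arc E using 1
  ext t
  simp only [mem_ofPred_eq, mem_support, mem_iUnion, exists_prop]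
  constructor
  · rintro ⟨ht, E, hE, htE⟩
    exact ⟨E, ⟨hE, _, htE, hR t ht⟩, ht, htE⟩
  · rintro ⟨E, ⟨hE, -⟩, ht, htE⟩
    exact ⟨ht, E, hE, htE⟩

theorem IsShortestCurve.tame_vertices (h : IsShortestCurve (⋂ i, halfPlane (f i) (θ i)) A B a b γ)
    {𝓐 : Set Arc} (hA : LocFin 𝓐) : Tame {t | t ∈ Icc a b ∧ γ t ∈ vertices 𝓐} := by
  obtain ⟨R, hR⟩ := h.exists_norm_le
  convert Tame.biUnion (hA.finite_vertices R) fun p _ => h.tame_fibre p using 1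
  ext t
  simp only [mem_ofPred_eq, mem_iUnion, exists_prop]
  constructor
  · rintro ⟨ht, hV⟩
    exact ⟨_, ⟨hV, hR t ht⟩, ht, rfl⟩
  · rintro ⟨p, ⟨hp, -⟩, ht, rfl⟩
    exact ⟨ht, hp⟩

/-- Connectedness of the image of an interval of times keeps the curve in the cell as long as it
stays in `skel (n + 1) \ skel n`. -/
theorem IsShortestCurve.tame_cell (h : IsShortestCurve (⋂ i, halfPlane (f i) (θ i)) A B a b γ)
    {D : PlaneDecomposition} {𝓐 : Set Arc} (hA : LocFin 𝓐) (h1 : D.skel 1 = vertices 𝓐)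
    (h2 : D.skel 2 = support 𝓐) {n : ℕ} {e : Set Plane} (he : e ∈ D.cells n) :
    Tame (Icc a b ∩ γ ⁻¹' e) := by
  have hIcc : Tame (Icc a b) := tame_of_ordConnected ordConnected_Icc
  have hskel : ∀ m ≤ 3, Tame {t | t ∈ Icc a b ∧ γ t ∈ D.skel m} := by
    intro m hm
    interval_cases m
    · simpa [D.skel_zero] using tame_empty
    · rw [h1]
      exact h.tame_vertices hA
    · rw [h2]
      exact h.tame_support hA
    · convert hIcc using 1
      ext t
      simp [D.skel_three]
  have hT := (hskel (n + 1) he.1).diff (hskel n he.1.le)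
  refine hT.of_components (fun t ht => ?_) fun I hI hIT hne t ht => ?_
  · have := he.2.subset ht.2
    exact ⟨⟨ht.1, this.1⟩, fun h' => this.2 h'.2⟩
  · have hsub : γ '' I ⊆ D.skel (n + 1) \ D.skel n := by
      rintro _ ⟨s, hs, rfl⟩
      exact ⟨(hIT hs).1.2, fun h' => (hIT hs).2 ⟨(hIT hs).1.1, h'⟩⟩
    have hpre : IsPreconnected (γ '' I) := hI.isPreconnected.image _
      (h.1.continuousOn.mono fun s hs => (hIT hs).1.1)
    obtain ⟨s, hs, hse⟩ := hne
    exact ⟨(hIT ht).1.1, he.2.subset_of_isPreconnected hpre hsub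
      ⟨γ s, mem_image_of_mem _ hs, hse.2⟩ (mem_image_of_mem _ ht)⟩

end TypeIRegion

end

theorem proposition3p1 {k : ℕ} (f : Fin k → Polynomial ℝ) (θ : Fin k → ℝ)
    (X : Set TypeIRegion.Plane) (hX : TypeIRegion.IsTypeIRegion f θ X) :
    ∃ _ : Topology.CWComplex X,
      TypeIRegion.RefinesOverlay f θ X ∧
      ∀ (A B : TypeIRegion.Plane) (a b : ℝ) (γ : ℝ → TypeIRegion.Plane),
        TypeIRegion.IsShortestCurve X A B a b γ →
        ∀ (n : ℕ) (e : Topology.RelCWComplex.cell X n),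
          TypeIRegion.InteractsFinitely a b γ (Topology.RelCWComplex.openCell n e) := by
  obtain rfl := hX.eq_iInter
  have hloc : TypeIRegion.LocFin (⋃ i, TypeIRegion.brickArcs (f i) (θ i)) := fun R => by
    refine (finite_iUnion fun i => TypeIRegion.locFin_brickArcs (f i) (θ i) R).subset ?_
    rintro E ⟨hE, hp⟩
    obtain ⟨i, hi⟩ := mem_iUnion.1 hE
    exact mem_iUnion.2 ⟨i, hi, hp⟩
  obtain ⟨D, 𝓐, hA, h1, h2, huncut⟩ := hloc.exists_decomposition
  have hB : ∀ n, ∀ e ∈ D.cells n, ∀ i, ∀ E ∈ TypeIRegion.brickArcs (f i) (θ i),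
      e ⊆ E.carrier ∨ Disjoint e E.carrier := fun n e he i E hE =>
    huncut n e he E (mem_iUnion.2 ⟨i, hE⟩)
  -- The boundary graphs are among the arcs, so a cell which meets the region is contained in it.
  obtain ⟨hCW, hcell⟩ := D.exists_cwComplex
    (TypeIRegion.isClosed_iInter_halfPlane f θ) (fun n e he hne => by
      obtain ⟨p, hp, hpX⟩ := hne
      exact subset_iInter fun i => TypeIRegion.subset_halfPlane he.2.hasCharMap.isPreconnected
        (hB n e he i) hp (mem_iInter.1 hpX i))
  refine ⟨hCW, fun n c i => ?_, fun A B a b γ hγ n c => ?_⟩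
  · obtain ⟨he, heX⟩ := hcell n c
    exact TypeIRegion.exists_isBrickCell he.2.hasCharMap.isPreconnected (hB n _ he i)
      he.2.hasCharMap.nonempty (heX.trans (iInter_subset _ i))
  · exact (hγ.tame_cell hA h1 h2 (hcell n c).1).finite_connectedComponents
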